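/- Let $\Bbbk$ be a field and $n\ge 2$. **Notation.** An $n\times n$ matrix $\mathbf p=(p_{ij})$ over $\Bbbk$ is *multiplicatively antisymmetric* if $p_{ii}=1$ and $p_{ij}p_{ji}=1$ for all $i,j$. Let $V$ have basis $y_1,\dots,y_n$ and $V^*$ the dual basis $x_1,\dots,x_n$. An $m$-linear form $t$ on a finite-dimensional space $Z$ is *preregular* if $t(z_1,\dots,z_m)=0$ for all $z_2,\dots,z_m$ implies $z_1=0$, and $t(z_1,\dots,z_m)=t(\phi(z_m),z_1,\dots,z_{m-1})$ for some $\phi\in GL(Z)$. For $n$-linear forms $\mathsf e$ on $V$ and $\mathsf f$ on $V^*$ write $\mathsf e_{i_1\cdots i_n}=\mathsf e(y_{i_1},\dots,y_{i_n})$, $\mathsf f_{i_1\cdots i_n}=\mathsf f(x_{i_1},\dots,x_{i_n})$. * $\mathcal H(\mathsf e,\mathsf f)$ is the algebra with generators $u_{ij}$, $\mathsf D_{\mathsf e}^{\pm1}$, $\mathsf D_{\mathsf f}^{\pm1}$ and relations $\sum_i \mathsf e_{i_1\cdots i_n}u_{i_1j_1}\cdots u_{i_nj_n}=\mathsf e_{j_1\cdots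 j_n}\mathsf D_{\mathsf e}$ and $\sum_i \mathsf f_{i_1\cdots i_n}u_{j_1i_1}\cdots u_{j_ni_n}=\mathsf f_{j_1\cdots j_n}\mathsf D_{\mathsf f}^{-1}$ for all $j_1,\dots,j_n$ (and $\mathsf D_{\mathsf e}\mathsf D_{\mathsf e}^{-1}=\mathsf D_{\mathsf e}^{-1}\mathsf D_{\mathsf e}=\mathsf D_{\mathsf f}\mathsf D_{\mathsf f}^{-1}=\mathsf D_{\mathsf f}^{-1}\mathsf D_{\mathsf f}=1$); $\mathcal G(\mathsf e,\mathsf f)=\mathcal H(\mathsf e,\mathsf f)/(\mathsf D_{\mathsf e}\mathsf D_{\mathsf f}-1)$. * $\mathcal O_{A(\mathsf e,2),A(\mathsf f,2)}(M)$ is the algebra with generators $z_{ij}$ and relations $\sum \mathsf e_{l_1\cdots l_{n-2}i_1i_2}\,\mu_{j_1j_2}\,z_{i_1j_1}z_{i_2j_2}=0$ and $\sum \mathsf f_{l_1\cdots l_{n-2}j_1j_2}\,\nu_{i_1i_2}\,z_{i_1j_1}z_{i_2j_2}=0$ (sums over $i_1,i_2,j_1,j_2$), for all $l_1,\dots,l_{n-2}$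 and all $\mu,\nu$ such that $\sum_{i_1,i_2}\mathsf e_{l'_1\cdots l'_{n-2}i_1i_2}\mu_{i_1i_2}=0$ and $\sum_{i_1,i_2}\mathsf f_{l'_1\cdots l'_{n-2}i_1i_2}\nu_{i_1i_2}=0$ for all $l'$. * In an algebra containing a matrix $(u_{ij})$ (in $\mathcal O_{A(\mathsf e,2),A(\mathsf f,2)}(M)$ take $u_{ij}=z_{ij}$) we write $$(\ast)\qquad \mathsf D=\sum_{i}\mathsf e_{i_1\cdots i_n}u_{i_11}\cdots u_{i_nn}=\sum_i\mathsf f_{i_1\cdots i_n}u_{1i_1}\cdots u_{ni_n}.$$ * For algebras $A$, $B$ generated by $x_1,\dots,x_n$ and by $y_1,\dots,y_n$, a *balanced coaction* of a Hopf algebra $K$ is a left $K$-comodule algebra structure on $A$ and a right one on $B$ of the form $x_i\mapsto\sum_jk_{ij}\otimes x_j$, $y_j\mapsto\sum_iy_i\otimes k_{ij}$ with the same $k_{ij}\in K$. $\mathcal O_{A,B}(GL)$ denotes the Hopf algebra with a universal balanced coaction: every balanced coaction of a Hopf algebra $K$ is induced from it along a unique Hopf algebra map $\mathcal O_{A,B}(GL)\to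 K$. **(1) Artin–Schelter–Tate.** Let $\mathbf p,\mathbf q$ be multiplicatively antisymmetric and let $\lambda\in\Bbbk$, $\lambda\ne-1$, satisfy $q_{ji}=\lambda p_{ji}$ for all $j>i$. Let $\Bbbk_{\mathbf q}[x_1,\dots,x_n]$ and $\Bbbk_{\mathbf p}[y_1,\dots,y_n]$ have the relations $x_jx_i=q_{ji}x_ix_j$, respectively $y_jy_i=p_{ij}y_iy_j$. Let $\mathsf e_{\mathbf q}$, $\mathsf f_{\mathbf p}$ be the $n$-linear forms with $$\mathsf e_{\mathbf q}(y_{\sigma(1)},\dots,y_{\sigma(n)})=\prod_{j<j',\,\sigma(j)>\sigma(j')}(-q_{\sigma(j')\sigma(j)}),\qquad \mathsf f_{\mathbf p}(x_{\sigma(1)},\dots,x_{\sigma(n)})=\prod_{j<j',\,\sigma(j)>\sigma(j')}(-p_{\sigma(j)\sigma(j')})$$ for $\sigma\in S_n$, vanishing on all other tuples of basis vectors. Let $\mathcal O_{\mathbf p,\lambda}(GL_n)$ be the algebra generated by $u_{ij}$, $\mathsf D^{\pm1}$ with $\mathsf D\mathsf D^{-1}=\mathsf D^{-1}\mathsf D=1$,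 both equalities $(\ast)$ for $\mathsf e=\mathsf e_{\mathbf q}$, $\mathsf f=\mathsf f_{\mathbf p}$, and $$u_{j\beta}u_{i\alpha}=\begin{cases}p_{ji}p_{\alpha\beta}u_{i\alpha}u_{j\beta}+(\lambda-1)p_{ji}u_{i\beta}u_{j\alpha}& j>i,\ \beta>\alpha,\\ \lambda p_{ji}p_{\alpha\beta}u_{i\alpha}u_{j\beta}& j>i,\ \beta\le\alpha,\\ p_{\alpha\beta}u_{i\alpha}u_{j\beta}& j=i,\ \beta>\alpha.\end{cases}$$ Then $\mathsf e_{\mathbf q}$ and $\mathsf f_{\mathbf p}$ are preregular; $\mathcal O_{A(\mathsf e_{\mathbf q},2),A(\mathsf f_{\mathbf p},2)}(M)$ is a bialgebra with $\Delta(z_{ij})=\sum_l z_{il}\otimes z_{lj}$, $\varepsilon(z_{ij})=\delta_{ij}$, in which the two expressions $(\ast)$ for $\mathsf D$ agree and the powers of $\mathsf D$ form a (two-sided) Ore set; this localization, $\mathcal O_{\mathbf p,\lambda}(GL_n)$, $\mathcal H(\mathsf e_{\mathbf q},\mathsf f_{\mathbf p})$ and $\mathcal G(\mathsf e_{\mathbf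 q},\mathsf f_{\mathbf p})$ are Hopf algebras in which the matrix of generators satisfies $\Delta(u_{ij})=\sum_lu_{il}\otimes u_{lj}$, $\varepsilon(u_{ij})=\delta_{ij}$ and the remaining generators are grouplike; and there are isomorphisms of Hopf algebras, matching the generators $u_{ij}$ (the matrix entries of the universal coaction in the case of the third algebra), $$\mathcal O_{\mathbf p,\lambda}(GL_n)\cong\mathcal O_{A(\mathsf e_{\mathbf q},2),A(\mathsf f_{\mathbf p},2)}(M)\mathsf D^{-1}\cong\mathcal O_{\Bbbk_{\mathbf q}[x_1,\dots,x_n],\,\Bbbk_{\mathbf p}[y_1,\dots,y_n]}(GL)\cong\mathcal H(\mathsf e_{\mathbf q},\mathsf f_{\mathbf p})\cong\mathcal G(\mathsf e_{\mathbf q},\mathsf f_{\mathbf p}).$$ **(2) Takeuchi.** Let $p,q\in\Bbbk^\times$ with $pq\ne-1$. Let $\Bbbk_q[x_1,\dots,x_n]$ have the relations $x_jx_i=q\,x_ix_j$ for $j>i$, let $\Bbbk_p[y_1,\dots,y_n]$ have the relations $y_jy_i=p\,y_iy_j$ for $j>i$, and let $\mathsf e_q$ on $V$, $\mathsf f_p$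 on $V^*$ be the forms with values $(-q)^{-\ell(\sigma)}$, respectively $(-p)^{-\ell(\sigma)}$, on the tuples of basis vectors indexed by $\sigma\in S_n$ ($\ell$ is the number of inversions), vanishing on all other tuples of basis vectors. Let $\mathcal O_{p,q}(GL_n)$ be generated by $u_{ij}$, $\mathsf D^{\pm1}$ with $\mathsf D\mathsf D^{-1}=\mathsf D^{-1}\mathsf D=1$, both equalities $(\ast)$ for $\mathsf e_q,\mathsf f_p$, and $$u_{j\beta}u_{i\alpha}=\begin{cases}u_{i\alpha}u_{j\beta}+(q-p^{-1})u_{i\beta}u_{j\alpha}& j>i,\ \beta>\alpha,\\ q\,u_{i\alpha}u_{j\beta}& j>i,\ \beta=\alpha,\\ qp^{-1}u_{i\alpha}u_{j\beta}& j>i,\ \beta<\alpha,\\ p\,u_{i\alpha}u_{j\beta}& j=i,\ \beta>\alpha.\end{cases}$$ Then all assertions of (1) hold with $\mathcal O_{p,q}(GL_n)$, $\mathsf e_q$, $\mathsf f_p$, $\Bbbk_q[x_1,\dots,x_n]$, $\Bbbk_p[y_1,\dots,y_n]$ in place of $\mathcal O_{\mathbf p,\lambda}(GL_n)$, $\mathsf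 e_{\mathbf q}$, $\mathsf f_{\mathbf p}$, $\Bbbk_{\mathbf q}[x_1,\dots,x_n]$, $\Bbbk_{\mathbf p}[y_1,\dots,y_n]$. **(3) $\mathcal O(GL_n)$.** If $1\ne-1$ in $\Bbbk$, then all assertions of (1) hold with the commutative algebra $\mathcal O(GL_n)=\Bbbk[u_{ij}][\det^{-1}]$ ($\mathsf D=\det$), with both forms equal to the signature form $\varepsilon$ (the sign of $\sigma$ on the tuple of basis vectors indexed by $\sigma\in S_n$, and $0$ on all other tuples of basis vectors), and with the commutative polynomial rings $\Bbbk[x_1,\dots,x_n]$, $\Bbbk[y_1,\dots,y_n]$. -/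

import Mathlib

open scoped TensorProduct

universe u v w

noncomputable section

namespace QGL

/-! ### Hopf algebra structures on a given algebra -/

/-- A bialgebra structure on a given `k`-algebra `A`. -/
structure BialgebraData (k : Type u) (A : Type v) [Field k] [Ring A] [Algebra k A] where
  comul : A →ₐ[k] A ⊗[k] A
  counit : A →ₐ[k] k
  coassoc : (Algebra.TensorProduct.assoc k k k A A A).toAlgHom.comp
      ((Algebra.TensorProduct.map comul (.id k A)).comp comul)
      = (Algebra.TensorProduct.map (.id k A) comul).comp comul
  counit_left : (Algebra.TensorProduct.map counit (.id k A)).comp comul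
      = (Algebra.TensorProduct.lid k A).symm
  counit_right : (Algebra.TensorProduct.map (.id k A) counit).comp comul
      = (Algebra.TensorProduct.rid k k A).symm

/-- The Mathlib bialgebra given by `S`; its underlying algebra is the given one. -/
abbrev BialgebraData.bialgebra {k : Type u} {A : Type v} [Field k] [Ring A] [Algebra k A]
    (S : BialgebraData k A) : Bialgebra k A :=
  Bialgebra.ofAlgHom S.comul S.counit S.coassoc S.counit_left S.counit_right

/-- A Hopf algebra structure on a given `k`-algebra `A`. -/
structure HopfData (k : Type u) (A : Type v) [Field k] [Ring A] [Algebra k A]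
    extends BialgebraData k A where
  antipode : A →ₗ[k] A
  antipode_left : LinearMap.mul' k A ∘ₗ antipode.rTensor A ∘ₗ comul.toLinearMap
      = Algebra.linearMap k A ∘ₗ counit.toLinearMap
  antipode_right : LinearMap.mul' k A ∘ₗ antipode.lTensor A ∘ₗ comul.toLinearMap
      = Algebra.linearMap k A ∘ₗ counit.toLinearMap

/-- The Mathlib Hopf algebra given by `S`; its underlying algebra is the given one. -/
abbrev HopfData.hopfAlgebra {k : Type u} {A : Type v} [Field k] [Ring A] [Algebra k A]
    (S : HopfData k A) : HopfAlgebra k A :=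
  { S.toBialgebraData.bialgebra with
    antipode := S.antipode
    mul_antipode_rTensor_comul := S.antipode_left
    mul_antipode_lTensor_comul := S.antipode_right }

/-- `Δ(a_ij) = ∑ₗ a_il ⊗ a_lj` and `ε(a_ij) = δ_ij`. -/
def IsMatrixCoalgebra (k : Type u) {A : Type v} [Field k] [Ring A] [Bialgebra k A] {n : ℕ}
    (a : Fin n → Fin n → A) : Prop :=
  ∀ i j, Coalgebra.comul (R := k) (a i j) = ∑ l, a i l ⊗ₜ[k] a l j ∧
    Coalgebra.counit (R := k) (a i j) = if i = j then 1 else 0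

/-- There is an isomorphism of Hopf algebras carrying the matrix `a` to the matrix `b`. -/
def HopfIso {k : Type u} {A : Type v} {B : Type w} [Field k] [Ring A] [Algebra k A]
    [Ring B] [Algebra k B] {n : ℕ} (S : HopfData k A) (T : HopfData k B)
    (a : Fin n → Fin n → A) (b : Fin n → Fin n → B) : Prop :=
  letI := S.hopfAlgebra
  letI := T.hopfAlgebra
  ∃ φ : A ≃ₐc[k] B, ∀ i j, φ (a i j) = b i j

/-! ### Multilinear forms -/

section Forms

variable (k : Type u) [Field k]

/-- `m`-linear forms on an `n`-dimensional space with a fixed basis (`V` with its basis, or `V*`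
with the dual basis), whose elements are written in coordinates. -/
abbrev Form (n m : ℕ) : Type u := MultilinearMap k (fun _ : Fin m => Fin n → k) k

variable {k} {n m : ℕ}

/-- The coefficient `t_{i₁ ⋯ iₘ}` of a form: its value on basis vectors. -/
def coeff (t : Form k n m) (i : Fin m → Fin n) : k := t fun r => Pi.single (i r) 1

/-- The cyclic rotation `(z₁, …, zₘ) ↦ (φ zₘ, z₁, …, zₘ₋₁)`. -/
def rotate {Z : Type v} (φ : Z → Z) (z : Fin m → Z) : Fin m → Z := fun r =>
  if r.1 = 0 then φ (z ⟨m - 1, by have := r.2; omega⟩) else z ⟨r.1 - 1, by have := r.2; omega⟩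

/-- Preregular forms: nondegenerate in the first argument, and `φ`-cyclic for some `φ ∈ GL`. -/
def IsPreregular (t : Form k n m) : Prop :=
  (∀ v : Fin n → k,
    (∀ z : Fin m → Fin n → k, (∀ r : Fin m, r.1 = 0 → z r = v) → t z = 0) → v = 0) ∧
  ∃ φ : (Fin n → k) ≃ₗ[k] (Fin n → k), ∀ z : Fin m → Fin n → k, t z = t (rotate φ z)

/-- The `n`-linear form with value `c σ` on `(v_{σ(1)}, …, v_{σ(n)})` for a permutation `σ`, and
value `0` on all other tuples of basis vectors. -/
def permForm (c : Equiv.Perm (Fin n) → k) : Form k n n :=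
  ∑ σ : Equiv.Perm (Fin n), c σ •
    (MultilinearMap.mkPiAlgebra k (Fin n) k).compLinearMap
      fun r : Fin n => LinearMap.proj (R := k) (φ := fun _ : Fin n => k) (σ r)

theorem coeff_permForm (c : Equiv.Perm (Fin n) → k) (i : Fin n → Fin n) :
    coeff (permForm c) i = ∑ σ : Equiv.Perm (Fin n), if i = σ then c σ else 0 := by
  simp only [coeff, permForm, sum_apply, smul_apply,
    MultilinearMap.compLinearMap_apply, MultilinearMap.mkPiAlgebra_apply, LinearMap.proj_apply,
    smul_eq_mul]
  refine Finset.sum_congr rfl fun σ _ => ?_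
  split_ifs with h
  · subst h
    simp
  · obtain ⟨r, hr⟩ := Function.ne_iff.mp h
    rw [Finset.prod_eq_zero (Finset.mem_univ r) (by rw [Pi.single_apply, if_neg (Ne.symm hr)]),
      mul_zero]

theorem coeff_permForm_perm (c : Equiv.Perm (Fin n) → k) (σ : Equiv.Perm (Fin n)) :
    coeff (permForm c) σ = c σ := by
  rw [coeff_permForm, Finset.sum_eq_single σ] <;> simp +contextual [DFunLike.coe_fn_eq, eq_comm]

theorem coeff_permForm_of_not_perm (c : Equiv.Perm (Fin n) → k) (i : Fin n → Fin n)
    (hi : ∀ σ : Equiv.Perm (Fin n), i ≠ σ) : coeff (permForm c) i = 0 := by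
  rw [coeff_permForm]
  exact Finset.sum_eq_zero fun σ _ => if_neg (hi σ)

/-- The form `e_q`. -/
def formE (q : Fin n → Fin n → k) : Form k n n := permForm fun σ =>
  ∏ j, ∏ j', if j < j' ∧ σ j' < σ j then - q (σ j') (σ j) else 1

/-- The form `f_p`. -/
def formF (p : Fin n → Fin n → k) : Form k n n := permForm fun σ =>
  ∏ j, ∏ j', if j < j' ∧ σ j' < σ j then - p (σ j) (σ j') else 1

/-- The number of inversions of a permutation. -/
def inversions (σ : Equiv.Perm (Fin n)) : ℕ :=
  (Finset.univ.filter fun a : Fin n × Fin n => a.1 < a.2 ∧ σ a.2 < σ a.1).card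

/-- The one-parameter form with value `(-q)^{-ℓ(σ)}` at a permutation `σ`. -/
def formT (n : ℕ) (q : k) : Form k n n := permForm fun σ => (-q) ^ (-(inversions σ : ℤ))

/-- The signature form. -/
def signForm (k : Type u) [Field k] (n : ℕ) : Form k n n :=
  permForm fun σ => ((Equiv.Perm.sign σ : ℤ) : k)

end Forms

/-! ### Words in the entries of a matrix -/

/-- The product `a_{i₁ j₁} ⋯ a_{iₘ jₘ}`, in this order. -/
def word {A : Type v} [Ring A] {n m : ℕ} (a : Fin n → Fin n → A) (i j : Fin m → Fin n) : A :=
  (List.ofFn fun r => a (i r) (j r)).prod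

/-- `∑ e_{i₁ ⋯ iₙ} a_{i₁ 1} ⋯ a_{iₙ n}`. -/
def colDet {k : Type u} [Field k] {A : Type v} [Ring A] [Algebra k A] {n : ℕ}
    (e : Form k n n) (a : Fin n → Fin n → A) : A :=
  ∑ i : Fin n → Fin n, coeff e i • word a i id

/-- `∑ f_{i₁ ⋯ iₙ} a_{1 i₁} ⋯ a_{n iₙ}`. -/
def rowDet {k : Type u} [Field k] {A : Type v} [Ring A] [Algebra k A] {n : ℕ}
    (f : Form k n n) (a : Fin n → Fin n → A) : A :=
  ∑ i : Fin n → Fin n, coeff f i • word a id i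

/-! ### The algebras `H(e, f)` and `G(e, f)` -/

/-- Generators of `H(e, f)`. -/
inductive HGen (n : ℕ) : Type
  | u (i j : Fin n)
  | De
  | DeInv
  | Df
  | DfInv

section HG

variable {k : Type u} [Field k] {n m : ℕ}

/-- The defining relations of `H(e, f)`. -/
inductive HRel (e f : Form k n m) : FreeAlgebra k (HGen n) → FreeAlgebra k (HGen n) → Prop
  | relE (j : Fin m → Fin n) : HRel e f
      (∑ i : Fin m → Fin n, coeff e i • word (fun a b => FreeAlgebra.ι k (HGen.u a b)) i j)
      (coeff e j • FreeAlgebra.ι k HGen.De)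
  | relF (j : Fin m → Fin n) : HRel e f
      (∑ i : Fin m → Fin n, coeff f i • word (fun a b => FreeAlgebra.ι k (HGen.u a b)) j i)
      (coeff f j • FreeAlgebra.ι k HGen.DfInv)
  | De_mul_inv : HRel e f (FreeAlgebra.ι k HGen.De * FreeAlgebra.ι k HGen.DeInv) 1
  | De_inv_mul : HRel e f (FreeAlgebra.ι k HGen.DeInv * FreeAlgebra.ι k HGen.De) 1
  | Df_mul_inv : HRel e f (FreeAlgebra.ι k HGen.Df * FreeAlgebra.ι k HGen.DfInv) 1
  | Df_inv_mul : HRel e f (FreeAlgebra.ι k HGen.DfInv * FreeAlgebra.ι k HGen.Df) 1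

/-- The algebra `H(e, f)`. -/
abbrev H (e f : Form k n m) : Type u := RingQuot (HRel e f)

/-- The generators of `H(e, f)`. -/
def H.gen (e f : Form k n m) (g : HGen n) : H e f :=
  RingQuot.mkAlgHom k (HRel e f) (FreeAlgebra.ι k g)

/-- The matrix `(u_ij)` in `H(e, f)`. -/
def H.u (e f : Form k n m) (i j : Fin n) : H e f := H.gen e f (HGen.u i j)

/-- The relation `D_e D_f = 1`. -/
inductive GRel (e f : Form k n m) : H e f → H e f → Prop
  | De_mul_Df : GRel e f (H.gen e f HGen.De * H.gen e f HGen.Df) 1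

/-- The algebra `G(e, f) = H(e, f) / (D_e D_f - 1)`. -/
abbrev G (e f : Form k n m) : Type u := RingQuot (GRel e f)

/-- The images in `G(e, f)` of the generators of `H(e, f)`. -/
def G.gen (e f : Form k n m) (g : HGen n) : G e f :=
  RingQuot.mkAlgHom k (GRel e f) (H.gen e f g)

/-- The matrix `(u_ij)` in `G(e, f)`. -/
def G.u (e f : Form k n m) (i j : Fin n) : G e f := G.gen e f (HGen.u i j)

/-! ### The algebra `O_{A(e,N),A(f,N)}(M)` -/

/-- The concatenation `(λ₁, …, λ_{m-N}, i₁, …, i_N)`. -/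
def concat {N : ℕ} (l : Fin (m - N) → Fin n) (i : Fin N → Fin n) : Fin m → Fin n := fun r =>
  if h : r.1 < m - N then l ⟨r.1, h⟩ else i ⟨r.1 - (m - N), by have := r.2; omega⟩

/-- The coefficient tensors in the annihilator of `∂^{m-N}(k t*)`. -/
def perp (t : Form k n m) (N : ℕ) : Set ((Fin N → Fin n) → k) :=
  {μ | ∀ l : Fin (m - N) → Fin n, ∑ i : Fin N → Fin n, coeff t (concat l i) * μ i = 0}

/-- The defining relations of `O_{A(e,N),A(f,N)}(M)`. -/
inductive MRel (e f : Form k n m) (N : ℕ) :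
    FreeAlgebra k (Fin n × Fin n) → FreeAlgebra k (Fin n × Fin n) → Prop
  | relE (l : Fin (m - N) → Fin n) (μ : (Fin N → Fin n) → k) (hμ : μ ∈ perp e N) : MRel e f N
      (∑ i : Fin N → Fin n, ∑ j : Fin N → Fin n, (coeff e (concat l i) * μ j) •
        word (fun a b => FreeAlgebra.ι k (a, b)) i j) 0
  | relF (l : Fin (m - N) → Fin n) (ν : (Fin N → Fin n) → k) (hν : ν ∈ perp f N) : MRel e f N
      (∑ i : Fin N → Fin n, ∑ j : Fin N → Fin n, (coeff f (concat l j) * ν i) •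
        word (fun a b => FreeAlgebra.ι k (a, b)) i j) 0

/-- The algebra `O_{A(e,N),A(f,N)}(M)`. -/
abbrev OM (e f : Form k n m) (N : ℕ) : Type u := RingQuot (MRel e f N)

/-- The generators `z_ij` of `O_{A(e,N),A(f,N)}(M)`. -/
def OM.z (e f : Form k n m) (N : ℕ) (i j : Fin n) : OM e f N :=
  RingQuot.mkAlgHom k (MRel e f N) (FreeAlgebra.ι k (i, j))

/-- The multiplicative set `⟨D⟩` in `O_{A(e,2),A(f,2)}(M)`. -/
abbrev OM.powersD (e f : Form k n n) : Submonoid (OM e f 2) :=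
  Submonoid.powers (colDet e (OM.z e f 2))

end HG

/-! ### Skew polynomial rings -/

section Skew

variable {k : Type u} [Field k] {n : ℕ}

/-- Multiplicatively antisymmetric matrices. -/
def IsMulAntisymm (p : Fin n → Fin n → k) : Prop :=
  (∀ i, p i i = 1) ∧ ∀ i j, p i j * p j i = 1

/-- The relations `x_j x_i = q_ji x_i x_j`. -/
inductive SkewRel (q : Fin n → Fin n → k) :
    FreeAlgebra k (Fin n) → FreeAlgebra k (Fin n) → Prop
  | comm (i j : Fin n) : SkewRel q (FreeAlgebra.ι k j * FreeAlgebra.ι k i)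
      (q j i • (FreeAlgebra.ι k i * FreeAlgebra.ι k j))

/-- The algebra with generators `x_i` and relations `x_j x_i = q_ji x_i x_j`. -/
abbrev SkewPoly (q : Fin n → Fin n → k) : Type u := RingQuot (SkewRel q)

/-- The generators of a skew polynomial ring. -/
def SkewPoly.x (q : Fin n → Fin n → k) (i : Fin n) : SkewPoly q :=
  RingQuot.mkAlgHom k (SkewRel q) (FreeAlgebra.ι k i)

/-- The relations `x_j x_i = q x_i x_j` for `i < j`. -/
inductive QSkewRel (n : ℕ) (q : k) : FreeAlgebra k (Fin n) → FreeAlgebra k (Fin n) → Prop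
  | comm (i j : Fin n) (hij : i < j) : QSkewRel n q (FreeAlgebra.ι k j * FreeAlgebra.ι k i)
      (q • (FreeAlgebra.ι k i * FreeAlgebra.ι k j))

/-- The algebra with generators `x_i` and relations `x_j x_i = q x_i x_j` for `i < j`. -/
abbrev QSkewPoly (n : ℕ) (q : k) : Type u := RingQuot (QSkewRel n q)

/-- The generators of a one-parameter skew polynomial ring. -/
def QSkewPoly.x (n : ℕ) (q : k) (i : Fin n) : QSkewPoly n q :=
  RingQuot.mkAlgHom k (QSkewRel n q) (FreeAlgebra.ι k i)

end Skew

/-! ### The deformations of Artin–Schelter–Tate and of Takeuchi, and `O(GL_n)` -/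

/-- Generators `u_ij`, `D` and `D⁻¹`. -/
inductive DGen (n : ℕ) : Type
  | u (i j : Fin n)
  | D
  | DInv

section Presented

variable {k : Type u} [Field k] {n : ℕ}

/-- The generators `u_ij` in the free algebra. -/
abbrev freeU (k : Type u) [Field k] {n : ℕ} (i j : Fin n) : FreeAlgebra k (DGen n) :=
  FreeAlgebra.ι k (DGen.u i j)

/-- The defining relations of `O_{p,λ}(GL_n)`, where `q_ji = λ p_ji` for `j > i`. -/
inductive ASTRel (p q : Fin n → Fin n → k) (lam : k) :
    FreeAlgebra k (DGen n) → FreeAlgebra k (DGen n) → Prop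
  | rel₁ (i j a b : Fin n) (hij : i < j) (hab : a < b) : ASTRel p q lam
      (freeU k j b * freeU k i a)
      ((p j i * p a b) • (freeU k i a * freeU k j b)
        + ((lam - 1) * p j i) • (freeU k i b * freeU k j a))
  | rel₂ (i j a b : Fin n) (hij : i < j) (hab : b ≤ a) : ASTRel p q lam
      (freeU k j b * freeU k i a) ((lam * p j i * p a b) • (freeU k i a * freeU k j b))
  | rel₃ (i a b : Fin n) (hab : a < b) : ASTRel p q lam
      (freeU k i b * freeU k i a) (p a b • (freeU k i a * freeU k i b))
  | col : ASTRel p q lam (FreeAlgebra.ι k DGen.D) (colDet (formE q) (freeU k))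
  | row : ASTRel p q lam (FreeAlgebra.ι k DGen.D) (rowDet (formF p) (freeU k))
  | mul_inv : ASTRel p q lam (FreeAlgebra.ι k DGen.D * FreeAlgebra.ι k DGen.DInv) 1
  | inv_mul : ASTRel p q lam (FreeAlgebra.ι k DGen.DInv * FreeAlgebra.ι k DGen.D) 1

/-- The algebra `O_{p,λ}(GL_n)`. -/
abbrev AST (p q : Fin n → Fin n → k) (lam : k) : Type u := RingQuot (ASTRel p q lam)

/-- The generators of `O_{p,λ}(GL_n)`. -/
def AST.gen (p q : Fin n → Fin n → k) (lam : k) (g : DGen n) : AST p q lam :=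
  RingQuot.mkAlgHom k (ASTRel p q lam) (FreeAlgebra.ι k g)

/-- The defining relations of `O_{p,q}(GL_n)`. -/
inductive TakRel (n : ℕ) (p q : k) : FreeAlgebra k (DGen n) → FreeAlgebra k (DGen n) → Prop
  | rel₁ (i j a b : Fin n) (hij : i < j) (hab : a < b) : TakRel n p q
      (freeU k j b * freeU k i a)
      (freeU k i a * freeU k j b + (q - p⁻¹) • (freeU k i b * freeU k j a))
  | rel₂ (i j a : Fin n) (hij : i < j) : TakRel n p q
      (freeU k j a * freeU k i a) (q • (freeU k i a * freeU k j a))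
  | rel₃ (i j a b : Fin n) (hij : i < j) (hab : b < a) : TakRel n p q
      (freeU k j b * freeU k i a) ((q * p⁻¹) • (freeU k i a * freeU k j b))
  | rel₄ (i a b : Fin n) (hab : a < b) : TakRel n p q
      (freeU k i b * freeU k i a) (p • (freeU k i a * freeU k i b))
  | col : TakRel n p q (FreeAlgebra.ι k DGen.D)
      (∑ σ : Equiv.Perm (Fin n), (-q) ^ (-(inversions σ : ℤ)) • word (freeU k) σ id)
  | row : TakRel n p q (FreeAlgebra.ι k DGen.D)
      (∑ σ : Equiv.Perm (Fin n), (-p) ^ (-(inversions σ : ℤ)) • word (freeU k) id σ)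
  | mul_inv : TakRel n p q (FreeAlgebra.ι k DGen.D * FreeAlgebra.ι k DGen.DInv) 1
  | inv_mul : TakRel n p q (FreeAlgebra.ι k DGen.DInv * FreeAlgebra.ι k DGen.D) 1

/-- The algebra `O_{p,q}(GL_n)`. -/
abbrev Tak (n : ℕ) (p q : k) : Type u := RingQuot (TakRel n p q)

/-- The generators of `O_{p,q}(GL_n)`. -/
def Tak.gen (n : ℕ) (p q : k) (g : DGen n) : Tak n p q :=
  RingQuot.mkAlgHom k (TakRel n p q) (FreeAlgebra.ι k g)

/-- The determinant of the generic matrix. -/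
abbrev genericDet (k : Type u) [Field k] (n : ℕ) : MvPolynomial (Fin n × Fin n) k :=
  (Matrix.mvPolynomialX (Fin n) (Fin n) k).det

/-- The commutative algebra `O(GL_n) = k[u_ij][det⁻¹]`. -/
abbrev OGL (k : Type u) [Field k] (n : ℕ) : Type u := Localization.Away (genericDet k n)

/-- The coordinate functions, the determinant and its inverse in `O(GL_n)`. -/
def OGL.gen (k : Type u) [Field k] (n : ℕ) : DGen n → OGL k n
  | DGen.u i j => algebraMap (MvPolynomial (Fin n × Fin n) k) (OGL k n) (MvPolynomial.X (i, j))
  | DGen.D => algebraMap (MvPolynomial (Fin n × Fin n) k) (OGL k n) (genericDet k n)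
  | DGen.DInv => IsLocalization.Away.invSelf (genericDet k n)

end Presented

/-! ### Balanced coactions and the balanced quantum general linear group -/

section Balanced

variable {k : Type u} [Field k] {n : ℕ} {A B : Type u} [Ring A] [Algebra k A] [Ring B] [Algebra k B]

/-- A balanced pair of coactions of a Hopf algebra `K`: a left `K`-comodule algebra structure on
`A` and a right one on `B`, given on generators by one common matrix `c` over `K`. -/
structure BalancedCoaction (x : Fin n → A) (y : Fin n → B) (K : Type v) [Ring K]
    [HopfAlgebra k K] where
  left : A →ₐ[k] K ⊗[k] A
  left_coassoc : (Algebra.TensorProduct.assoc k k k K K A).toAlgHom.comp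
      ((Algebra.TensorProduct.map (Bialgebra.comulAlgHom k K) (.id k A)).comp left)
      = (Algebra.TensorProduct.map (.id k K) left).comp left
  left_counit : (Algebra.TensorProduct.map (Bialgebra.counitAlgHom k K) (.id k A)).comp left
      = (Algebra.TensorProduct.lid k A).symm
  right : B →ₐ[k] B ⊗[k] K
  right_coassoc : (Algebra.TensorProduct.assoc k k k B K K).toAlgHom.comp
      ((Algebra.TensorProduct.map right (.id k K)).comp right)
      = (Algebra.TensorProduct.map (.id k B) (Bialgebra.comulAlgHom k K)).comp right
  right_counit : (Algebra.TensorProduct.map (.id k B) (Bialgebra.counitAlgHom k K)).comp right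
      = (Algebra.TensorProduct.rid k k B).symm
  balanced : ∃ c : Fin n → Fin n → K,
      (∀ i, left (x i) = ∑ j, c i j ⊗ₜ[k] x j) ∧ ∀ j, right (y j) = ∑ i, y i ⊗ₜ[k] c i j

/-- The universal property of the balanced quantum general linear group, among Hopf algebras in
an arbitrary universe `w`. -/
def BalancedCoaction.IsUniversal {x : Fin n → A} {y : Fin n → B} {O : Type v} [Ring O]
    [HopfAlgebra k O] (ρ : BalancedCoaction (k := k) x y O) : Prop :=
  ∀ (K : Type w) [Ring K] [HopfAlgebra k K] (τ : BalancedCoaction (k := k) x y K),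
    ∃! φ : O →ₐc[k] K,
      (Algebra.TensorProduct.map (φ : O →ₐ[k] K) (.id k A)).comp ρ.left = τ.left ∧
      (Algebra.TensorProduct.map (.id k B) (φ : O →ₐ[k] K)).comp ρ.right = τ.right

/-- The Hopf algebra `O` is the balanced quantum general linear group `O_{A,B}(GL)`, with
coactions `x_i ↦ ∑ a_ij ⊗ x_j` and `y_j ↦ ∑ y_i ⊗ a_ij`. -/
def IsBalancedGL (x : Fin n → A) (y : Fin n → B) (O : Type v) [Ring O] [HopfAlgebra k O]
    (a : Fin n → Fin n → O) : Prop :=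
  ∃ ρ : BalancedCoaction (k := k) x y O,
    (∀ i, ρ.left (x i) = ∑ j, a i j ⊗ₜ[k] x j) ∧ (∀ j, ρ.right (y j) = ∑ i, y i ⊗ₜ[k] a i j) ∧
    BalancedCoaction.IsUniversal.{u, v, w} ρ

end Balanced

/-! ### The chain of isomorphisms -/

/-- The forms `e`, `f` are preregular; the algebras `O` (with generators `g`),
`O_{A(e,2),A(f,2)}(M)D⁻¹`, `H(e, f)` and `G(e, f)` carry Hopf algebra structures with the standard
formulas on generators (there is at most one such structure on each), where `D` is given by either
of its two expressions and its powers form a left and right Ore set; these Hopf algebras are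
isomorphic, compatibly with the generators; and `O` is the balanced quantum general linear group
of the pair `A`, `B`. -/
def QuantumGLChain {k : Type u} [Field k] {n : ℕ} {O A B : Type u} [Ring O] [Algebra k O]
    [Ring A] [Algebra k A] [Ring B] [Algebra k B] (g : DGen n → O) (e f : Form k n n)
    (x : Fin n → A) (y : Fin n → B) : Prop :=
  IsPreregular e ∧ IsPreregular f ∧
  colDet e (OM.z e f 2) = rowDet f (OM.z e f 2) ∧
  Nonempty (OreLocalization.OreSet (OM.powersD e f).op) ∧
  ∃ (_ : OreLocalization.OreSet (OM.powersD e f)) (hO : HopfData k O)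
    (hM : BialgebraData k (OM e f 2)) (hL : HopfData k (OreLocalization (OM.powersD e f) (OM e f 2)))
    (hH : HopfData k (H e f)) (hG : HopfData k (G e f)),
    (letI := hO.hopfAlgebra; IsMatrixCoalgebra k (fun i j => g (DGen.u i j)) ∧
      IsGroupLikeElem k (g DGen.D) ∧ IsGroupLikeElem k (g DGen.DInv) ∧
      IsBalancedGL.{u, u, w} (k := k) x y O fun i j => g (DGen.u i j)) ∧
    (letI := hM.bialgebra; IsMatrixCoalgebra k (OM.z e f 2)) ∧
    (letI := hL.hopfAlgebra; IsMatrixCoalgebra k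
        (fun i j => OreLocalization.numeratorHom (S := OM.powersD e f) (OM.z e f 2 i j))) ∧
    (letI := hH.hopfAlgebra; IsMatrixCoalgebra k (H.u e f) ∧
      ∀ d, (∀ i j, d ≠ HGen.u i j) → IsGroupLikeElem k (H.gen e f d)) ∧
    (letI := hG.hopfAlgebra; IsMatrixCoalgebra k (G.u e f) ∧
      ∀ d, (∀ i j, d ≠ HGen.u i j) → IsGroupLikeElem k (G.gen e f d)) ∧
    HopfIso hO hL (fun i j => g (DGen.u i j))
      (fun i j => OreLocalization.numeratorHom (S := OM.powersD e f) (OM.z e f 2 i j)) ∧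
    HopfIso hO hH (fun i j => g (DGen.u i j)) (H.u e f) ∧
    HopfIso hO hG (fun i j => g (DGen.u i j)) (G.u e f)

end QGL

end

/-! The localization, `H` and `G` are all shown to have the universal property of the presented
algebra `AST`: homomorphisms to `R` are matrices over `R` satisfying the quadratic relations
`IsQMat`, together with an inverse of the quantum determinant (`IsQGL`). An algebra isomorphic to
`AST` with matching generators is recorded as `IsGLAlgebra`. The Hopf structure, the isomorphisms
and the universal balanced coaction are then derived from this predicate alone.

`IsQMat` consists of a column condition `SkewCols q` and the same condition for the transposed
matrix and the transposed parameters `p`, so one half suffices in most arguments. The column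
condition has several guises. (a) It says that `x_i ↦ ∑ v_ij ⊗ x_j` respects the skew polynomial
relations (`SkewCols.skewCommute`, `IsSkewPoly.skewCols`). (b) It is half of the relations of `OM`
(`perpRel_iff`). (c) Columns and rows together are the Artin–Schelter–Tate relations
(`IsQMat.astQuad`, `ASTQuad.isQMat`). Eliminating one product from the mixed relations leaves a
factor `1 + λ`, which is where `λ ≠ -1` enters. (d) It implies the degree `n` relations `ColRel`,
because a `q`-alternating function of `n` indices is determined by its value at the identity
(`IsSkewAlt.eq_skewSign_smul`). Conversely, when the column and row relations of degree `n` both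
hold with invertible determinants, Laplace expansion (`ColRel.exists_adjugate`) inverts the matrix.
The inverse strips letters off the words (`IsSkewAlt.peel`) until only quadratic relations remain
(`ColRel.skewCols`).

The row and column determinants agree because each monomial of one is sorted into a monomial of the
other by antidiagonal commutations alone (`word_sort`). Hence `D_f⁻¹ = D_e` already holds in `H`,
and `G` is no smaller than `H`. Combining the two adjugates shows that `D²` commutes with the
entries up to scalars (`ColRel.normal`), which gives both Ore conditions. The antipode exists
because the inverse matrix satisfies the degree `n` relations in the opposite algebra
(`ColRel.op_of_right`, `ColRel.op_of_left`).

Takeuchi's algebra is the case of constant parameters with `λ = pq`. For `O(GL_n)` all parameters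
are `1`. -/

noncomputable section

namespace QGL

/-! ### Alternating functions of tuples twisted by `q` -/

section SkewForms

variable {k : Type u} [Field k] {n m : ℕ}

/-- The coefficient of `formE q` on a tuple of indices of arbitrary length. -/
def skewSign (q : Fin n → Fin n → k) (j : Fin m → Fin n) : k :=
  open Classical in
  if Function.Injective j then
    ∏ r, ∏ r', if r < r' ∧ j r' < j r then - q (j r') (j r) else 1
  else 0

/-- Functions on tuples which are `q`-alternating in any two adjacent arguments. -/
structure IsSkewAlt (q : Fin n → Fin n → k) {M : Type v} [AddCommGroup M] [Module k M]
    (S : (Fin m → Fin n) → M) : Prop where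
  eq_zero : ∀ (j : Fin m → Fin n) (r r' : Fin m), r'.1 = r.1 + 1 → j r = j r' → S j = 0
  swap : ∀ (j : Fin m → Fin n) (r r' : Fin m), r'.1 = r.1 + 1 →
    S j = -(q (j r') (j r) • S (j ∘ Equiv.swap r r'))

theorem coeff_formE (q : Fin n → Fin n → k) (j : Fin n → Fin n) :
    coeff (formE q) j = skewSign q j := by
  by_cases hj : Function.Injective j
  · obtain ⟨σ, rfl⟩ : ∃ σ : Equiv.Perm (Fin n), j = σ :=
      ⟨Equiv.ofBijective j (Finite.injective_iff_bijective.1 hj), rfl⟩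
    rw [formE, coeff_permForm_perm, skewSign, if_pos hj]
  · rw [formE, coeff_permForm_of_not_perm, skewSign, if_neg hj]
    rintro σ rfl
    exact hj σ.injective

theorem skewSign_id (q : Fin n → Fin n → k) : skewSign q (id : Fin n → Fin n) = 1 := by
  rw [skewSign, if_pos Function.injective_id]
  refine Finset.prod_eq_one fun r _ => Finset.prod_eq_one fun r' _ => if_neg ?_
  simp only [id]
  rintro ⟨h, h'⟩
  exact lt_asymm h h'

theorem IsMulAntisymm.ne_zero {q : Fin n → Fin n → k} (hq : IsMulAntisymm q) (i j : Fin n) :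
    q i j ≠ 0 := left_ne_zero_of_mul_eq_one (hq.2 i j)

theorem skewSign_ne_zero {q : Fin n → Fin n → k} (hq : IsMulAntisymm q) {j : Fin m → Fin n}
    (hj : Function.Injective j) : skewSign q j ≠ 0 := by
  rw [skewSign, if_pos hj]
  refine Finset.prod_ne_zero_iff.2 fun r _ => Finset.prod_ne_zero_iff.2 fun r' _ => ?_
  split_ifs
  · exact neg_ne_zero.2 (hq.ne_zero _ _)
  · exact one_ne_zero

theorem skewSign_of_not_injective (q : Fin n → Fin n → k) {j : Fin m → Fin n}
    (hj : ¬ Function.Injective j) : skewSign q j = 0 := if_neg hj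

/-- No index lies strictly between two adjacent ones, so exchanging them affects the order of that
pair only. -/
theorem swap_lt_swap_iff {r r' a b : Fin m} (h : r'.1 = r.1 + 1) (h₁ : ¬ (a = r ∧ b = r'))
    (h₂ : ¬ (a = r' ∧ b = r)) : Equiv.swap r r' a < Equiv.swap r r' b ↔ a < b := by
  simp only [Equiv.swap_apply_def, Fin.ext_iff] at *
  split_ifs <;> simp only [Fin.lt_def] <;> omega

/-- Reindexing pairs of positions by the transposition matches the inversions of both tuples, except
that `(r, r')` is an inversion of `j` alone. Its factor is the one split off. -/
theorem skewSign_of_descent (q : Fin n → Fin n → k) {j : Fin m → Fin n} {r r' : Fin m}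
    (h : r'.1 = r.1 + 1) (hj : Function.Injective j) (hd : j r' < j r) :
    skewSign q j = -(q (j r') (j r) * skewSign q (j ∘ Equiv.swap r r')) := by
  have hlt : r < r' := Fin.lt_def.2 (by omega)
  rw [skewSign, skewSign, if_pos hj, if_pos (hj.comp (Equiv.injective _)),
    ← Finset.univ.prod_product' Finset.univ
      (fun a b => if a < b ∧ j b < j a then - q (j b) (j a) else 1),
    ← Finset.univ.prod_product' Finset.univ
      (fun a b => if a < b ∧ (j ∘ Equiv.swap r r') b < (j ∘ Equiv.swap r r') a then
        - q ((j ∘ Equiv.swap r r') b) ((j ∘ Equiv.swap r r') a) else 1)]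
  simp only [Finset.univ_product_univ]
  rw [← (Equiv.prodCongr (Equiv.swap r r') (Equiv.swap r r')).prod_comp
    (fun x : Fin m × Fin m => if x.1 < x.2 ∧ (j ∘ Equiv.swap r r') x.2 < (j ∘ Equiv.swap r r') x.1
      then - q ((j ∘ Equiv.swap r r') x.2) ((j ∘ Equiv.swap r r') x.1) else 1),
    ← Finset.mul_prod_erase _ _ (Finset.mem_univ (r, r')),
    ← Finset.mul_prod_erase _ _ (Finset.mem_univ (r, r'))]
  simp only [hlt, hd, and_self, if_true, Equiv.prodCongr_apply, Prod.map, Equiv.swap_apply_left,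
    Equiv.swap_apply_right, hlt.not_gt, false_and, if_false, one_mul, neg_mul, Function.comp,
    Equiv.swap_apply_self]
  congr 2
  refine Finset.prod_congr rfl fun x hx => ?_
  have h₁ : ¬ (x.1 = r ∧ x.2 = r') := fun h => (Finset.mem_erase.1 hx).1 (Prod.ext h.1 h.2)
  by_cases h₂ : x.1 = r' ∧ x.2 = r
  -- The pair `(r', r)` contributes `1` to both products: its positions are in the wrong order
  -- before the swap, its values after it.
  · simp [h₂.1, h₂.2, hd.not_gt]
  · simp only [swap_lt_swap_iff h h₁ h₂]

theorem isSkewAlt_skewSign {q : Fin n → Fin n → k} (hq : IsMulAntisymm q) :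
    IsSkewAlt q (skewSign q : (Fin m → Fin n) → k) := by
  refine ⟨fun j r r' h e => skewSign_of_not_injective q fun hj => ?_, fun j r r' h => ?_⟩
  · have := hj e
    subst this
    omega
  · by_cases hj : Function.Injective j
    · rcases lt_trichotomy (j r') (j r) with hd | hd | hd
      · exact skewSign_of_descent q h hj hd
      · have := hj hd
        subst this
        omega
      · rw [skewSign_of_descent q h (j := j ∘ Equiv.swap r r') (hj.comp (Equiv.injective _))
          (by simpa using hd)]
        have : (j ∘ Equiv.swap r r') ∘ Equiv.swap r r' = j := by
          ext x; simp
        rw [this]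
        simp only [Function.comp, Equiv.swap_apply_left, Equiv.swap_apply_right, smul_eq_mul,
          mul_neg, neg_neg, ← mul_assoc, hq.2, one_mul]
    · rw [skewSign_of_not_injective q hj, skewSign_of_not_injective, smul_zero, neg_zero]
      intro h'
      apply hj
      have := h'.comp (Equiv.swap r r').injective
      rwa [Function.comp_assoc, ← Equiv.coe_trans, Equiv.swap_swap, Equiv.coe_refl] at this

theorem strictMono_of_adjacent {j : Fin m → Fin n}
    (h : ∀ r r' : Fin m, r'.1 = r.1 + 1 → j r < j r') : StrictMono j := by
  cases m with
  | zero => exact fun a => a.elim0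
  | succ m =>
    rw [Fin.strictMono_iff_lt_succ]
    intro i
    exact h _ _ (by simp)

theorem toLex_swap_lt {j : Fin m → Fin n} {r r' : Fin m} (h : r'.1 = r.1 + 1) (hd : j r' < j r) :
    toLex (j ∘ Equiv.swap r r') < toLex j :=
  Pi.lex_desc (Fin.le_def.2 (by omega)) hd

theorem eq_id_of_strictMono {j : Fin n → Fin n} (hj : StrictMono j) : j = id := by
  refine (StrictMono.range_inj hj strictMono_id).1 ?_
  rw [Set.range_id, (Finite.injective_iff_surjective.1 hj.injective).range_eq]

/-- Bubble sort: exchanging an adjacent descent lowers the tuple lexicographically and changes both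
functions by the same factor, and both vanish at an adjacent repetition. The only strictly
increasing self-map of `Fin n` is the identity, so the induction ends there. -/
theorem IsSkewAlt.eq_of_id {q : Fin n → Fin n → k} {M : Type v} [AddCommGroup M] [Module k M]
    {S T : (Fin n → Fin n) → M} (hS : IsSkewAlt q S) (hT : IsSkewAlt q T) (h : S id = T id)
    (j : Fin n → Fin n) : S j = T j := by
  have key : ∀ x : Lex (Fin n → Fin n), S (ofLex x) = T (ofLex x) := by
    intro x
    induction x using WellFoundedLT.induction with
    | ind x ih =>
      by_cases hx : ∃ r r' : Fin n, r'.1 = r.1 + 1 ∧ ¬ ofLex x r < ofLex x r'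
      · obtain ⟨r, r', hr, hlt⟩ := hx
        rcases (not_lt.1 hlt).eq_or_lt with he | hd
        · rw [hS.eq_zero _ r r' hr he.symm, hT.eq_zero _ r r' hr he.symm]
        · rw [hS.swap _ r r' hr, hT.swap _ r r' hr]
          have := ih (toLex (ofLex x ∘ Equiv.swap r r')) (toLex_swap_lt hr hd)
          rw [ofLex_toLex] at this
          rw [this]
      · push Not at hx
        rw [eq_id_of_strictMono (strictMono_of_adjacent hx), h]
  exact key (toLex j)

theorem IsSkewAlt.eq_skewSign_smul {q : Fin n → Fin n → k} (hq : IsMulAntisymm q) {M : Type v}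
    [AddCommGroup M] [Module k M] {S : (Fin n → Fin n) → M} (hS : IsSkewAlt q S)
    (j : Fin n → Fin n) : S j = skewSign q j • S id := by
  have h := isSkewAlt_skewSign (m := n) hq
  refine hS.eq_of_id (T := fun j => skewSign q j • S id) ⟨fun j r r' hr e => ?_, fun j r r' hr => ?_⟩
    ?_ j
  · rw [h.eq_zero j r r' hr e, zero_smul]
  · rw [h.swap j r r' hr, neg_smul, smul_smul, smul_eq_mul]
  · rw [skewSign_id, one_smul]

end SkewForms

/-! ### Words in matrix entries -/

section Words

variable {k : Type u} [Field k] {n m : ℕ} {R : Type v} [Ring R] [Algebra k R]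

theorem word_cons (a : Fin n → Fin n → R) (x y : Fin n) (i j : Fin m → Fin n) :
    word a (Fin.cons x i : Fin (m + 1) → Fin n) (Fin.cons y j : Fin (m + 1) → Fin n)
      = a x y * word a i j := by
  simp [word, List.ofFn_succ]

theorem word_succ (a : Fin n → Fin n → R) (i j : Fin (m + 1) → Fin n) :
    word a i j = a (i 0) (j 0) * word a (Fin.tail i) (Fin.tail j) := by
  simp [word, List.ofFn_succ, Fin.tail]

theorem word_zero (a : Fin n → Fin n → R) (i j : Fin 0 → Fin n) : word a i j = 1 := by
  simp [word]

theorem word_snoc (a : Fin n → Fin n → R) (x y : Fin n) (i j : Fin m → Fin n) :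
    word a (Fin.snoc i x : Fin (m + 1) → Fin n) (Fin.snoc j y : Fin (m + 1) → Fin n)
      = word a i j * a x y := by
  simp only [word]
  rw [List.ofFn_succ']
  simp

/-- The cofactors `L` and `T` are chosen before the letters at `r` and `r'`, so one pair serves all
the words that differ only there. A relation between quadratic monomials can thus be applied inside
a word. -/
theorem exists_word_adjacent (a : Fin n → Fin n → R) (i j : Fin m → Fin n) {r r' : Fin m}
    (h : r'.1 = r.1 + 1) : ∃ L T : R, ∀ x x' y y' : Fin n,
      word a (Function.update (Function.update i r x) r' x')
        (Function.update (Function.update j r y) r' y') = L * (a x y * a x' y') * T := by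
  induction m with
  | zero => exact r.elim0
  | succ m ih =>
    cases r using Fin.cases with
    | zero =>
      cases m with
      | zero => exact absurd h (by have := r'.2; simp)
      | succ m =>
        obtain rfl : r' = Fin.succ 0 := Fin.ext (by simpa using h)
        refine ⟨1, word a (Fin.tail (Fin.tail i)) (Fin.tail (Fin.tail j)), fun x x' y y' => ?_⟩
        rw [word_succ, word_succ, Fin.tail_update_succ, Fin.tail_update_succ, Fin.tail_update_zero,
          Fin.tail_update_zero, Fin.tail_update_zero, Fin.tail_update_zero]
        simp [mul_assoc]
    | succ r =>
      cases r' using Fin.cases with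
      | zero => simp at h
      | succ r' =>
        obtain ⟨L, T, hL⟩ := ih (Fin.tail i) (Fin.tail j) (r := r) (r' := r') (by simpa using h)
        refine ⟨a (i 0) (j 0) * L, T, fun x x' y y' => ?_⟩
        rw [word_succ, Fin.tail_update_succ, Fin.tail_update_succ, Fin.tail_update_succ,
          Fin.tail_update_succ, hL]
        simp [Function.update_of_ne (Fin.succ_ne_zero _).symm, mul_assoc]

theorem exists_word_swap (a : Fin n → Fin n → R) (i j : Fin m → Fin n) {r r' : Fin m}
    (h : r'.1 = r.1 + 1) : ∃ L T : R,
      word a i j = L * (a (i r) (j r) * a (i r') (j r')) * T ∧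
      word a (i ∘ Equiv.swap r r') j = L * (a (i r') (j r) * a (i r) (j r')) * T ∧
      word a i (j ∘ Equiv.swap r r') = L * (a (i r) (j r') * a (i r') (j r)) * T ∧
      word a (i ∘ Equiv.swap r r') (j ∘ Equiv.swap r r')
        = L * (a (i r') (j r') * a (i r) (j r)) * T := by
  obtain ⟨L, T, hL⟩ := exists_word_adjacent a i j h
  have hne : r ≠ r' := fun e => by subst e; omega
  have e : ∀ f : Fin m → Fin n, Function.update (Function.update f r (f r)) r' (f r') = f := by
    intro f; simp
  have e' : ∀ f : Fin m → Fin n,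
      Function.update (Function.update f r (f r')) r' (f r) = f ∘ Equiv.swap r r' := by
    intro f
    ext x
    simp only [Function.update_apply, Function.comp, Equiv.swap_apply_def]
    split_ifs <;> simp_all
  refine ⟨L, T, ?_, ?_, ?_, ?_⟩
  · rw [← hL, e, e]
  · rw [← hL, e', e]
  · rw [← hL, e, e']
  · rw [← hL, e', e']

end Words

/-! ### From quadratic relations to determinant identities -/

section SkewMatrices

variable {k : Type u} [Field k] {n m : ℕ} {R : Type v} [Ring R] [Algebra k R]

/-- The quadratic relations which make `x_i ↦ ∑ⱼ v_ij ⊗ x_j` compatible with the relations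
`x_j x_i = q_ji x_i x_j`. -/
structure SkewCols (q : Fin n → Fin n → k) (v : Fin n → Fin n → R) : Prop where
  same : ∀ i j a, v j a * v i a = q j i • (v i a * v j a)
  mixed : ∀ i j a b, v j a * v i b + q b a • (v j b * v i a)
    = q j i • (v i a * v j b + q b a • (v i b * v j a))

/-- The relations `∑ᵢ e_{i₁ ⋯ iₙ} v_{i₁ j₁} ⋯ v_{iₙ jₙ} = e_{j₁ ⋯ jₙ} D` for `e = formE q`. -/
def ColRel (q : Fin n → Fin n → k) (v : Fin n → Fin n → R) (D : R) : Prop :=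
  ∀ j : Fin n → Fin n, ∑ i : Fin n → Fin n, skewSign q i • word v i j = skewSign q j • D

theorem IsMulAntisymm.transpose {q : Fin n → Fin n → k} (hq : IsMulAntisymm q) :
    IsMulAntisymm fun i j => q j i :=
  ⟨hq.1, fun i j => hq.2 j i⟩

theorem comp_swap_swap {r r' : Fin m} {X : Type*} (f : Fin m → X) :
    (f ∘ Equiv.swap r r') ∘ Equiv.swap r r' = f := by
  ext x; simp

/-- The row words `i` and `i ∘ swap r r'` are paired. Since `t` is `q`-alternating, the two terms
combine into a multiple of a quadratic relation: `same` when the columns at `r` and `r'` coincide,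
`mixed` for the exchange rule. -/
theorem SkewCols.isSkewAlt_sum {q : Fin n → Fin n → k} {v : Fin n → Fin n → R}
    (hv : SkewCols q v) {t : (Fin m → Fin n) → k} (ht : IsSkewAlt q t) :
    IsSkewAlt q fun j : Fin m → Fin n => ∑ i, t i • word v i j := by
  refine ⟨fun j r r' h e => ?_, fun j r r' h => ?_⟩
  · refine Finset.sum_involution (fun i _ => i ∘ Equiv.swap r r') (fun i _ => ?_) (fun i _ hi he => ?_)
      (fun i _ => Finset.mem_univ _) (fun i _ => comp_swap_swap i)
    · obtain ⟨L, T, h₁, h₂, -⟩ := exists_word_swap v i j h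
      rw [h₁, h₂, ht.swap i r r' h, ← e, hv.same (i r) (i r') (j r)]
      simp only [smul_eq_mul, mul_smul_comm, smul_mul_assoc, smul_smul, neg_smul]
      rw [mul_comm (t _), neg_add_cancel]
    -- A row word fixed by the swap has equal letters at `r` and `r'`, and there `t` vanishes.
    · refine hi ?_
      rw [ht.eq_zero i r r' h, zero_smul]
      simpa using (congr_fun he r).symm
  · rw [eq_neg_iff_add_eq_zero, Finset.smul_sum, ← Finset.sum_add_distrib]
    refine Finset.sum_involution (fun i _ => i ∘ Equiv.swap r r') (fun i _ => ?_) (fun i _ hi he => ?_)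
      (fun i _ => Finset.mem_univ _) (fun i _ => comp_swap_swap i)
    · obtain ⟨L, T, h₁, h₂, h₃, h₄⟩ := exists_word_swap v i j h
      rw [h₁, h₂, h₃, h₄, ht.swap i r r' h]
      have := congr_arg (fun z => t (i ∘ Equiv.swap r r') • (L * z * T))
        (hv.mixed (i r) (i r') (j r) (j r'))
      simp only [smul_eq_mul, mul_smul_comm, smul_mul_assoc, smul_smul, neg_smul, smul_add, mul_add,
        add_mul, smul_neg] at this ⊢
      rw [add_comm, mul_comm (q (j r') (j r)), this]
      module
    · refine hi ?_
      rw [ht.eq_zero i r r' h]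
      · simp
      · simpa using (congr_fun he r).symm

theorem colDet_eq (q : Fin n → Fin n → k) (v : Fin n → Fin n → R) :
    colDet (formE q) v = ∑ i : Fin n → Fin n, skewSign q i • word v i id := by
  simp only [colDet, coeff_formE]

theorem SkewCols.colRel {q : Fin n → Fin n → k} (hq : IsMulAntisymm q) {v : Fin n → Fin n → R}
    (hv : SkewCols q v) : ColRel q v (colDet (formE q) v) := fun j => by
  rw [colDet_eq]
  exact (hv.isSkewAlt_sum (isSkewAlt_skewSign hq)).eq_skewSign_smul hq j

theorem ColRel.colDet_eq {q : Fin n → Fin n → k} {v : Fin n → Fin n → R} {D : R}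
    (h : ColRel q v D) : colDet (formE q) v = D := by
  rw [QGL.colDet_eq, h id, skewSign_id, one_smul]

/-! ### Comparison of the two determinants -/

theorem sum_skewSign_eq_sum_perm {M : Type w} [AddCommGroup M] [Module k M] (q : Fin n → Fin n → k)
    (F : (Fin n → Fin n) → M) :
    ∑ i : Fin n → Fin n, skewSign q i • F i = ∑ σ : Equiv.Perm (Fin n), skewSign q σ • F σ := by
  refine (Fintype.sum_of_injective (fun σ : Equiv.Perm (Fin n) => (σ : Fin n → Fin n))
    DFunLike.coe_injective _ _ (fun i hi => ?_) fun σ => rfl).symm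
  rw [skewSign_of_not_injective, zero_smul]
  intro h
  exact hi ⟨Equiv.ofBijective i (Finite.injective_iff_bijective.1 h), rfl⟩

/-- The hypothesis `hc` puts each inversion of the row word in antidiagonal position: the larger row
index stands with the smaller column index. Sorting the rows therefore uses only the commutation
`hv`, which has no correction term, and sorting preserves `hc`. -/
theorem word_sort {p q : Fin n → Fin n → k} (hp : IsMulAntisymm p) (hq : IsMulAntisymm q) {lam : k}
    (hpq : ∀ i j, i < j → q j i = lam * p j i) {v : Fin n → Fin n → R}
    (hv : ∀ i j a b, i < j → a < b → v j a * v i b = (lam * p j i * p b a) • (v i b * v j a))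
    (c : Fin n → Fin n) (i : Fin n → Fin n) (hi : Function.Injective i)
    (hc : ∀ r r', r < r' → i r' < i r → c (i r) < c (i r')) :
    (skewSign q i * skewSign (fun a b => p b a) (c ∘ i)) • word v i (c ∘ i)
      = (skewSign q (id : Fin n → Fin n) * skewSign (fun a b => p b a) c) • word v id c := by
  suffices key : ∀ x : Lex (Fin n → Fin n), Function.Injective (ofLex x) →
      (∀ r r', r < r' → ofLex x r' < ofLex x r → c (ofLex x r) < c (ofLex x r')) →
      (skewSign q (ofLex x) * skewSign (fun a b => p b a) (c ∘ ofLex x)) • word v (ofLex x) (c ∘ ofLex x)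
      = (skewSign q (id : Fin n → Fin n) * skewSign (fun a b => p b a) c) • word v id c from
    key (toLex i) hi hc
  intro x
  induction x using WellFoundedLT.induction with
  | ind x ih =>
    intro hi hc
    by_cases hx : ∃ r r' : Fin n, r'.1 = r.1 + 1 ∧ ¬ ofLex x r < ofLex x r'
    · obtain ⟨r, r', hr, hlt⟩ := hx
      have hrr : r < r' := Fin.lt_def.2 (by omega)
      have hd : ofLex x r' < ofLex x r := lt_of_le_of_ne (not_lt.1 hlt) fun e => hrr.ne' (hi e)
      have hcd := hc r r' hrr hd
      have IH := ih (toLex (ofLex x ∘ Equiv.swap r r')) (toLex_swap_lt hr hd)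
        (hi.comp (Equiv.injective _)) ?_
      · rw [← IH, ofLex_toLex]
        obtain ⟨L, T, h₁, h₂, h₃, h₄⟩ := exists_word_swap v (ofLex x) (c ∘ ofLex x) hr
        rw [Function.comp_assoc] at h₄
        rw [h₁, h₄, (isSkewAlt_skewSign hq).swap _ r r' hr,
          (isSkewAlt_skewSign hp.transpose).swap (c ∘ ofLex x) r r' hr, Function.comp_assoc]
        simp only [Function.comp_apply]
        rw [hv _ _ _ _ hd hcd]
        simp only [smul_eq_mul, mul_smul_comm, smul_mul_assoc, smul_smul]
        congr 1
        -- The exchange costs a factor of `q` for the rows, one of `p` for the columns, and `λ p p`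
        -- for the commutation. Their product is `1` because `q_ji = λ p_ji` and both matrices are
        -- multiplicatively antisymmetric.
        have h1 := hq.2 (ofLex x r') (ofLex x r)
        rw [hpq _ _ hd] at h1
        have h2 := hp.2 (c (ofLex x r)) (c (ofLex x r'))
        simp only [Function.comp_def]
        set A := skewSign q fun x_1 => ofLex x (Equiv.swap r r' x_1)
        set B := skewSign (fun a b => p b a) fun x_1 => c (ofLex x (Equiv.swap r r' x_1))
        linear_combination (A * B * (p (c (ofLex x r)) (c (ofLex x r')) *
          p (c (ofLex x r')) (c (ofLex x r)))) * h1 + A * B * h2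
      · intro s s' hs hss
        rw [ofLex_toLex] at *
        simp only [Function.comp_apply] at *
        -- The pair just exchanged is now in increasing order, so it imposes nothing; every other
        -- inversion comes from one of the original word.
        by_cases e : s = r ∧ s' = r'
        · rw [e.1, e.2, Equiv.swap_apply_left, Equiv.swap_apply_right] at hss
          exact absurd hd hss.not_gt
        · refine hc _ _ ?_ hss
          rwa [swap_lt_swap_iff hr e]
          rintro ⟨rfl, rfl⟩
          exact absurd hs hrr.not_gt
    · push Not at hx
      rw [eq_id_of_strictMono (strictMono_of_adjacent hx), Function.comp_id]

/-- The monomial of `σ` in the column determinant becomes that of `σ⁻¹` in the row determinant. With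
`c = σ⁻¹` the antidiagonal condition of `word_sort` is just the definition of an inversion of `σ`.
-/
theorem colDet_eq_rowDet {p q : Fin n → Fin n → k} (hp : IsMulAntisymm p) (hq : IsMulAntisymm q)
    {lam : k} (hpq : ∀ i j, i < j → q j i = lam * p j i) {v : Fin n → Fin n → R}
    (hv : ∀ i j a b, i < j → a < b → v j a * v i b = (lam * p j i * p b a) • (v i b * v j a)) :
    colDet (formE q) v = rowDet (formF p) v := by
  have hrow : rowDet (formF p) v = colDet (formE fun a b => p b a) fun a b => v b a := rfl
  rw [hrow, colDet_eq, colDet_eq, sum_skewSign_eq_sum_perm, sum_skewSign_eq_sum_perm]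
  refine Fintype.sum_equiv (Equiv.inv _) _ _ fun σ => ?_
  have h := word_sort hp hq hpq hv (σ⁻¹ : Equiv.Perm (Fin n)) σ σ.injective
    (fun r r' h _ => by simpa using h)
  rw [show (σ⁻¹ : Equiv.Perm (Fin n)) ∘ σ = (id : Fin n → Fin n) by ext x; simp, skewSign_id,
    skewSign_id, mul_one, one_mul] at h
  rw [h]
  rfl

end SkewMatrices

/-! ### Laplace expansion and the adjugate matrix -/

section Adjugate

variable {k : Type u} [Field k] {n m : ℕ} {R : Type v} [Ring R] [Algebra k R]

theorem skewSign_cons (q : Fin n → Fin n → k) {x : Fin n} {i : Fin m → Fin n}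
    (h : x ∉ Set.range i) : skewSign q (Fin.cons x i : Fin (m + 1) → Fin n)
      = (∏ r, if i r < x then - q (i r) x else 1) * skewSign q i := by
  by_cases hi : Function.Injective i
  · rw [skewSign, skewSign, if_pos (Fin.cons_injective_iff.2 ⟨h, hi⟩), if_pos hi,
      Fin.prod_univ_succ, Fin.prod_univ_succ]
    simp only [Fin.prod_univ_succ, Fin.cons_zero, Fin.cons_succ, lt_irrefl, false_and, if_false,
      Fin.succ_pos, true_and, one_mul, Fin.not_lt_zero, Fin.succ_lt_succ_iff]
  · rw [skewSign_of_not_injective q hi, skewSign_of_not_injective, mul_zero]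
    exact fun h' => hi (Fin.cons_injective_iff.1 h').2

theorem skewSign_snoc (q : Fin n → Fin n → k) {x : Fin n} {i : Fin m → Fin n}
    (h : x ∉ Set.range i) : skewSign q (Fin.snoc i x : Fin (m + 1) → Fin n)
      = (∏ r, if x < i r then - q x (i r) else 1) * skewSign q i := by
  by_cases hi : Function.Injective i
  · rw [skewSign, skewSign, if_pos (Fin.snoc_injective_iff.2 ⟨hi, h⟩), if_pos hi,
      Fin.prod_univ_castSucc]
    simp only [Fin.prod_univ_castSucc, Fin.snoc_castSucc, Fin.snoc_last, false_and,
      if_false, Fin.castSucc_lt_last, true_and, mul_one, Fin.castSucc_lt_castSucc_iff,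
      (Fin.le_last _).not_gt, Finset.prod_const_one, Finset.prod_mul_distrib]
    exact mul_comm _ _
  · rw [skewSign_of_not_injective q hi, skewSign_of_not_injective, mul_zero]
    exact fun h' => hi (Fin.snoc_injective_iff.1 h').1

/-- The entries of the diagonal twist of `formE q`. -/
def twist (q : Fin n → Fin n → k) (x : Fin n) : k := ∏ y ∈ Finset.univ.erase x, - q x y

theorem twist_ne_zero {q : Fin n → Fin n → k} (hq : IsMulAntisymm q) (x : Fin n) :
    twist q x ≠ 0 :=
  Finset.prod_ne_zero_iff.2 fun _ _ => neg_ne_zero.2 (hq.ne_zero _ _)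

/-- For each other letter `y`, the pair of `x` and `y` is inverted in exactly one of the two tuples.
As `q x y * q y x = 1`, either case accounts for a factor `-q x y`. This is the twisted cyclicity of
the form, with a diagonal twist. -/
theorem skewSign_snoc_eq {q : Fin (m + 1) → Fin (m + 1) → k} (hq : IsMulAntisymm q)
    (i : Fin m → Fin (m + 1)) (x : Fin (m + 1)) :
    skewSign q (Fin.snoc i x : Fin (m + 1) → Fin (m + 1))
      = twist q x * skewSign q (Fin.cons x i : Fin (m + 1) → Fin (m + 1)) := by
  by_cases h : x ∉ Set.range i ∧ Function.Injective i
  · obtain ⟨h, hi⟩ := h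
    -- The letters of `i` are exactly those other than `x`, so the product over positions is the
    -- product defining `twist`.
    have him : Finset.univ.erase x = Finset.univ.image i := by
      refine (Finset.eq_of_subset_of_card_le (fun y hy => ?_) ?_).symm
      · obtain ⟨r, -, rfl⟩ := Finset.mem_image.1 hy
        exact Finset.mem_erase.2 ⟨fun e => h ⟨r, e⟩, Finset.mem_univ _⟩
      · rw [Finset.card_image_of_injective _ hi, Finset.card_erase_of_mem (Finset.mem_univ _)]
        simp
    rw [skewSign_cons q h, skewSign_snoc q h, twist, him, Finset.prod_image hi.injOn, ← mul_assoc,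
      ← Finset.prod_mul_distrib]
    congr 1
    refine Finset.prod_congr rfl fun r _ => ?_
    rcases lt_trichotomy x (i r) with hr | hr | hr
    · rw [if_pos hr, if_neg hr.not_gt, mul_one]
    · exact absurd ⟨r, hr.symm⟩ h
    · rw [if_neg hr.not_gt, if_pos hr, neg_mul_neg, hq.2]
  · rw [skewSign_of_not_injective, skewSign_of_not_injective, mul_zero]
    · exact fun h' => h (Fin.cons_injective_iff.1 h')
    · exact fun h' => h (Fin.snoc_injective_iff.1 h').symm

theorem sum_cons {M : Type w} [AddCommMonoid M] (F : (Fin (m + 1) → Fin n) → M) :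
    ∑ i, F i = ∑ x : Fin n, ∑ i : Fin m → Fin n, F (Fin.cons x i) := by
  rw [← Fintype.sum_prod_type']
  exact (Fintype.sum_equiv (Fin.consEquiv fun _ => Fin n) _ _ fun _ => rfl).symm

theorem sum_snoc {M : Type w} [AddCommMonoid M] (F : (Fin (m + 1) → Fin n) → M) :
    ∑ i, F i = ∑ x : Fin n, ∑ i : Fin m → Fin n, F (Fin.snoc i x) := by
  rw [← Fintype.sum_prod_type']
  exact (Fintype.sum_equiv (Fin.snocEquiv fun _ => Fin n) _ _ fun _ => rfl).symm

theorem skewSign_cons_succAbove (q : Fin (m + 1) → Fin (m + 1) → k) {x y : Fin (m + 1)}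
    (h : y ≠ x) : skewSign q (Fin.cons y x.succAbove : Fin (m + 1) → Fin (m + 1)) = 0 := by
  refine skewSign_of_not_injective q fun h' => (Fin.cons_injective_iff.1 h').1 ?_
  rw [Fin.range_succAbove]
  exact h

/-- The cofactors come from the columns other than `l` in increasing order. Placing column `j` in
front of these and splitting off the first letter gives one identity; placing it behind and
splitting off the last gives the other, with the twist from `skewSign_snoc_eq`. For `j ≠ l` a column
is repeated and the right side vanishes. -/
theorem ColRel.exists_adjugate {q : Fin n → Fin n → k} (hq : IsMulAntisymm q)
    {v : Fin n → Fin n → R} {D : R} (h : ColRel q v D) : ∃ X : Fin n → Fin n → R,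
      (∀ j l, ∑ i, v i j * X i l = if j = l then D else 0) ∧
      ∀ j l, ∑ i, twist q i • (X i l * v i j) = if j = l then twist q j • D else 0 := by
  cases n with
  | zero => exact ⟨v, fun j => j.elim0, fun j => j.elim0⟩
  | succ m =>
    -- The sign of moving column `l` to the front, by which the cofactors are normalized.
    set ε : Fin (m + 1) → k := fun l =>
      skewSign q (Fin.cons l l.succAbove : Fin (m + 1) → Fin (m + 1)) with hε
    have hε0 : ∀ l, ε l ≠ 0 := fun l => skewSign_ne_zero hq
      (Fin.cons_injective_iff.2 ⟨by simp [Fin.range_succAbove], Fin.succAbove_right_injective⟩)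
    have hεj : ∀ j l : Fin (m + 1), skewSign q (Fin.cons j l.succAbove : Fin (m + 1) → Fin (m + 1))
        = if j = l then ε l else 0 := fun j l => by
      split_ifs with hjl
      · rw [hjl]
      · exact skewSign_cons_succAbove q hjl
    refine ⟨fun i l => (ε l)⁻¹ • ∑ a : Fin m → Fin (m + 1),
      skewSign q (Fin.cons i a : Fin (m + 1) → Fin (m + 1)) • word v a l.succAbove,
      fun j l => ?_, fun j l => ?_⟩
    · have := h (Fin.cons j l.succAbove)
      rw [sum_cons, hεj] at this
      simp only [word_cons] at this
      simp only [mul_smul_comm, Finset.mul_sum]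
      rw [← Finset.smul_sum, this]
      split_ifs
      · rw [smul_smul, inv_mul_cancel₀ (hε0 l), one_smul]
      · rw [zero_smul, smul_zero]
    · have := h (Fin.snoc l.succAbove j)
      rw [sum_snoc, skewSign_snoc_eq hq, hεj] at this
      simp only [word_snoc, skewSign_snoc_eq hq] at this
      trans (ε l)⁻¹ • ((twist q j * if j = l then ε l else 0) • D)
      · rw [← this]
        simp only [smul_mul_assoc, Finset.sum_mul, Finset.smul_sum, smul_smul, mul_left_comm]
      · split_ifs
        · rw [smul_smul, mul_comm (twist q j), inv_mul_cancel_left₀ (hε0 l)]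
        · rw [mul_zero, zero_smul, smul_zero]

/-- The column and row relations supply adjugates `X` and `Y` on different sides of `v`. Comparing
them costs one factor `D` and inserting them another, hence `D * D`; no invertibility enters. The
scalars allow `D * D` to define an automorphism rescaling the entries. -/
theorem ColRel.normal {p q : Fin n → Fin n → k} (hp : IsMulAntisymm p) (hq : IsMulAntisymm q)
    {v : Fin n → Fin n → R} {D : R} (hE : ColRel q v D) (hF : ColRel p (fun i j => v j i) D)
    (l j : Fin n) :
    (twist p l / twist q l) • (v l j * (D * D)) = (twist p j / twist q j) • (D * D * v l j) := by
  obtain ⟨X, hX₁, hX₂⟩ := hE.exists_adjugate hq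
  obtain ⟨Y, hY₁, hY₂⟩ := hF.exists_adjugate hp
  -- Both sides evaluate the same product of `X`, `v` and `Y`, bracketed in the two possible ways.
  have key : ∀ a b, twist q b • (X b a * D) = twist q a • (D * Y a b) := by
    intro a b
    have h₁ : ∑ c, (∑ i, twist q i • (X i a * v i c)) * Y c b = twist q a • (D * Y a b) := by
      simp only [hX₂, ite_mul, zero_mul, Finset.sum_ite_eq', Finset.mem_univ, if_true,
        smul_mul_assoc]
    rw [← h₁]
    simp only [Finset.sum_mul]
    rw [Finset.sum_comm]
    simp only [smul_mul_assoc, mul_assoc, ← Finset.smul_sum, ← Finset.mul_sum, hY₁]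
    simp
  have h₂ : ∀ c, ∑ i, v i j * (twist q c • ((twist q i)⁻¹ • (D * Y c i)))
      = if j = c then D * D else 0 := by
    intro c
    rw [← zero_mul D, ← ite_mul, ← hX₁, Finset.sum_mul]
    refine Finset.sum_congr rfl fun i _ => ?_
    rw [smul_comm, ← key, smul_smul, inv_mul_cancel₀ (twist_ne_zero hq _), one_smul, mul_assoc]
  -- Again a double sum computed twice: summing over `i` first gives `D * D * v l j`, summing over
  -- `c` first gives `v l j * (D * D)`, up to twists.
  have h₃ : ∑ c, (∑ i, v i j * (twist q c • ((twist q i)⁻¹ • (D * Y c i))))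
      * ((twist p c / twist q c) • v l c) = (twist p j / twist q j) • (D * D * v l j) := by
    simp only [h₂]
    simp only [ite_mul, zero_mul, mul_smul_comm, smul_ite, smul_zero, Finset.sum_ite_eq,
      Finset.mem_univ, if_true]
  rw [← h₃]
  simp only [Finset.sum_mul]
  rw [Finset.sum_comm]
  have h₄ : ∀ i c, v i j * (twist q c • ((twist q i)⁻¹ • (D * Y c i)))
      * ((twist p c / twist q c) • v l c)
      = (twist q i)⁻¹ • (v i j * D * (twist p c • (Y c i * v l c))) := by
    intro i c
    simp only [mul_smul_comm, smul_mul_assoc, smul_smul, mul_assoc]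
    congr 1
    field_simp [twist_ne_zero hq]
  simp only [h₄, ← Finset.smul_sum, ← Finset.mul_sum, hY₂]
  simp only [mul_ite, mul_zero, smul_ite, smul_zero, Finset.sum_ite_eq, Finset.mem_univ, if_true,
    mul_smul_comm, smul_smul, mul_assoc]
  rw [div_eq_inv_mul]

/-! ### Passing from the degree `n` relations to the quadratic ones -/

theorem IsSkewAlt.cons {M : Type w} [AddCommGroup M] [Module k M] {q : Fin n → Fin n → k}
    {S : (Fin (m + 1) → Fin n) → M} (hS : IsSkewAlt q S) (x : Fin n) :
    IsSkewAlt q fun j : Fin m → Fin n => S (Fin.cons x j) := by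
  refine ⟨fun j r r' h e => hS.eq_zero _ r.succ r'.succ (by simp [h]) (by simpa using e),
    fun j r r' h => ?_⟩
  rw [hS.swap (Fin.cons x j) r.succ r'.succ (by simp [h])]
  simp only [Fin.cons_succ]
  congr 3
  ext y
  cases y using Fin.cases with
  | zero => simp [Equiv.swap_apply_of_ne_of_ne, (Fin.succ_ne_zero _).symm]
  | succ y =>
    simp only [Function.comp, Fin.cons_succ, Equiv.swap_apply_def, Fin.succ_inj]
    split_ifs <;> simp

/-- Multiplying on the left by `L x y` and summing over the first column index `y` turns the first
letter of each word into a Kronecker delta, which fixes the first row index as `x`. The alternating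
property in the remaining columns is untouched. -/
theorem IsSkewAlt.peel {q : Fin n → Fin n → k} {v L : Fin n → Fin n → R}
    (hL : ∀ x i, ∑ j, L x j * v i j = if i = x then 1 else 0) {t : (Fin (m + 1) → Fin n) → k}
    (ht : IsSkewAlt q fun j : Fin (m + 1) → Fin n => ∑ i, t i • word v i j) (x : Fin n) :
    IsSkewAlt q fun j : Fin m → Fin n => ∑ i, t (Fin.cons x i) • word v i j := by
  have h : ∀ j : Fin m → Fin n, ∑ i : Fin m → Fin n, t (Fin.cons x i) • word v i j
      = ∑ y, L x y * ∑ i, t i • word v i (Fin.cons y j : Fin (m + 1) → Fin n) := by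
    intro j
    simp only [sum_cons, word_cons]
    simp only [Finset.mul_sum]
    rw [Finset.sum_comm]
    simp only [mul_smul_comm, ← mul_assoc]
    have : ∀ a, ∑ y, ∑ i : Fin m → Fin n, t (Fin.cons a i) • (L x y * v a y * word v i j)
        = if a = x then ∑ i : Fin m → Fin n, t (Fin.cons a i) • word v i j else 0 := by
      intro a
      rw [Finset.sum_comm]
      simp only [← Finset.smul_sum, ← Finset.sum_mul, hL, ite_mul, one_mul, zero_mul]
      split_ifs <;> simp
    simp [this]
  simp only [h]
  refine ⟨fun j r r' hr e => Finset.sum_eq_zero fun y _ => ?_, fun j r r' hr => ?_⟩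
  · rw [(ht.cons y).eq_zero j r r' hr e, mul_zero]
  · rw [Finset.smul_sum, ← Finset.sum_neg_distrib]
    refine Finset.sum_congr rfl fun y _ => ?_
    rw [(ht.cons y).swap j r r' hr, mul_neg, mul_smul_comm]

theorem pair_comp_swap (a b : Fin n) : (![a, b] : Fin 2 → Fin n) ∘ Equiv.swap 0 1 = ![b, a] := by
  ext x; fin_cases x <;> simp

theorem sum_pair {M : Type w} [AddCommGroup M] {a b : Fin n} (hab : a ≠ b)
    {F : (Fin 2 → Fin n) → M} (hF : ∀ i, i ≠ ![a, b] → i ≠ ![b, a] → F i = 0) :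
    ∑ i, F i = F ![a, b] + F ![b, a] := by
  refine Finset.sum_eq_add _ _ (fun e => hab (by simpa using congr_fun e 0))
    (fun i _ hi => hF i hi.1 hi.2) (by simp) (by simp)

theorem word_pair (v : Fin n → Fin n → R) (i j : Fin 2 → Fin n) :
    word v i j = v (i 0) (j 0) * v (i 1) (j 1) := by
  simp [word, List.ofFn_succ]

/-- With support in the two orderings of `a` and `b`, the contraction is a nonzero multiple of `v b
c * v a d - q b a • (v a c * v b d)`. Its vanishing at `c = d` and its exchange rule are the
required relations. -/
theorem pair_relations {q : Fin n → Fin n → k} {v : Fin n → Fin n → R}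
    {t : (Fin 2 → Fin n) → k} {a b : Fin n} (hab : a ≠ b) (ht : IsSkewAlt q t)
    (h0 : t ![a, b] ≠ 0) (hs : ∀ i, t i ≠ 0 → i = ![a, b] ∨ i = ![b, a])
    (hS : IsSkewAlt q fun j : Fin 2 → Fin n => ∑ i, t i • word v i j) :
    (∀ c, v b c * v a c = q b a • (v a c * v b c)) ∧
    ∀ c d, v b c * v a d + q d c • (v b d * v a c)
      = q b a • (v a c * v b d + q d c • (v a d * v b c)) := by
  have hsw := ht.swap ![a, b] 0 1 rfl
  rw [pair_comp_swap] at hsw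
  simp only [Matrix.cons_val_zero, Matrix.cons_val_one, smul_eq_mul] at hsw
  have hba : t ![b, a] ≠ 0 := by
    intro e
    rw [hsw, e] at h0
    simp at h0
  have hval : ∀ c d, ∑ i, t i • word v i ![c, d]
      = t ![b, a] • (v b c * v a d - q b a • (v a c * v b d)) := by
    intro c d
    rw [sum_pair hab (fun i h₁ h₂ => ?_), hsw]
    · simp only [word_pair, Matrix.cons_val_zero, Matrix.cons_val_one]
      module
    · have : t i = 0 := by
        by_contra h
        rcases hs i h with h | h
        exacts [h₁ h, h₂ h]
      rw [this, zero_smul]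
  refine ⟨fun c => ?_, fun c d => ?_⟩
  · have := hS.eq_zero ![c, c] 0 1 rfl rfl
    rw [hval, smul_eq_zero_iff_right hba, sub_eq_zero] at this
    exact this
  · have := hS.swap ![c, d] 0 1 rfl
    rw [pair_comp_swap, hval, hval, smul_comm, ← smul_neg] at this
    have := smul_right_injective R hba this
    simp only [Matrix.cons_val_zero, Matrix.cons_val_one] at this
    have h' := sub_eq_zero.2 this
    rw [← sub_eq_zero, ← h']
    module

end Adjugate

/-! ### The column condition: from degree `n` and from the relations of `OM` -/

section Quadratic

variable {k : Type u} [Field k] {n m : ℕ} {R : Type v} [Ring R] [Algebra k R]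

theorem skewCols_of_pairs {q : Fin n → Fin n → k} (hq : IsMulAntisymm q) {v : Fin n → Fin n → R}
    (h : ∀ a b, a ≠ b → ∃ t : (Fin 2 → Fin n) → k, IsSkewAlt q t ∧ t ![a, b] ≠ 0 ∧
      (∀ i, t i ≠ 0 → i = ![a, b] ∨ i = ![b, a]) ∧
      IsSkewAlt q fun j : Fin 2 → Fin n => ∑ i, t i • word v i j) : SkewCols q v := by
  refine ⟨fun i j c => ?_, fun i j c d => ?_⟩ <;> rcases eq_or_ne i j with rfl | hij
  · rw [hq.1, one_smul]
  · obtain ⟨t, h₁, h₂, h₃, h₄⟩ := h i j hij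
    exact (pair_relations hij h₁ h₂ h₃ h₄).1 c
  · rw [hq.1, one_smul]
  · obtain ⟨t, h₁, h₂, h₃, h₄⟩ := h i j hij
    exact (pair_relations hij h₁ h₂ h₃ h₄).2 c d

/-- All letters of `x` but the last two are peeled off in turn. The surviving form is supported on
rearrangements of what is left of `x`. -/
theorem exists_pair_form {q : Fin n → Fin n → k} {v L : Fin n → Fin n → R}
    (hL : ∀ x i, ∑ j, L x j * v i j = if i = x then 1 else 0) {t : (Fin (m + 2) → Fin n) → k}
    {x : Fin (m + 2) → Fin n} (ht : IsSkewAlt q t) (h0 : t x ≠ 0)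
    (hs : ∀ i, t i ≠ 0 → (List.ofFn i).Perm (List.ofFn x))
    (hS : IsSkewAlt q fun j : Fin (m + 2) → Fin n => ∑ i, t i • word v i j) :
    ∃ t' : (Fin 2 → Fin n) → k, IsSkewAlt q t' ∧ t' ![x ⟨m, by omega⟩, x ⟨m + 1, by omega⟩] ≠ 0 ∧
      (∀ i, t' i ≠ 0 → i = ![x ⟨m, by omega⟩, x ⟨m + 1, by omega⟩] ∨
        i = ![x ⟨m + 1, by omega⟩, x ⟨m, by omega⟩]) ∧
      IsSkewAlt q fun j : Fin 2 → Fin n => ∑ i, t' i • word v i j := by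
  induction m with
  | zero =>
    have hx : x = ![x ⟨0, by omega⟩, x ⟨0 + 1, by omega⟩] := by
      ext y; fin_cases y <;> rfl
    refine ⟨t, ht, hx ▸ h0, fun i hi => ?_, hS⟩
    have := hs i hi
    rw [hx, show i = ![i 0, i 1] by ext y; fin_cases y <;> rfl] at this
    simp only [List.ofFn_succ, Matrix.cons_val_zero, Matrix.cons_val_succ, List.ofFn_zero] at this
    rcases List.perm_pair.1 this.symm with h | h <;>
      simp only [List.cons.injEq, and_true] at h
    · left
      funext y; fin_cases y
      exacts [h.1.symm, h.2.symm]
    · right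
      funext y; fin_cases y
      exacts [h.2.symm, h.1.symm]
  | succ m ih =>
    refine ih (ht.cons (x 0)) (x := Fin.tail x) ?_ (fun i hi => ?_) (hS.peel hL (x 0))
    · rwa [Fin.cons_self_tail]
    · have := hs _ hi
      rw [← Fin.cons_self_tail x, List.ofFn_cons, List.ofFn_cons, Fin.cons_zero] at this
      exact (List.perm_cons _).1 this

theorem exists_perm_last_two (a b : Fin (m + 2)) (hab : a ≠ b) :
    ∃ σ : Equiv.Perm (Fin (m + 2)), σ ⟨m, by omega⟩ = a ∧ σ ⟨m + 1, by omega⟩ = b := by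
  have h01 : (⟨m, by omega⟩ : Fin (m + 2)) ≠ ⟨m + 1, by omega⟩ := by simp
  refine ⟨(Equiv.swap (⟨m, by omega⟩ : Fin (m + 2)) a).trans
    (Equiv.swap (Equiv.swap (⟨m, by omega⟩ : Fin (m + 2)) a ⟨m + 1, by omega⟩) b), ?_, ?_⟩
  · rw [Equiv.trans_apply, Equiv.swap_apply_left, Equiv.swap_apply_of_ne_of_ne _ hab]
    intro h
    refine h01 ((Equiv.swap (⟨m, by omega⟩ : Fin (m + 2)) a).injective ?_)
    exact (Equiv.swap_apply_left _ _).trans h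
  · rw [Equiv.trans_apply, Equiv.swap_apply_left]

/-- For each pair `a ≠ b`, peeling starts from a permutation ending in `a, b`. The matrix `L`
inverts the transpose of `v` from the left, so it has to come from the row relations. -/
theorem ColRel.skewCols {q : Fin n → Fin n → k} (hq : IsMulAntisymm q) (hn : 2 ≤ n)
    {v L : Fin n → Fin n → R} {D : R} (h : ColRel q v D)
    (hL : ∀ x i, ∑ j, L x j * v i j = if i = x then 1 else 0) : SkewCols q v := by
  obtain ⟨m, rfl⟩ := Nat.exists_eq_add_of_le' hn
  refine skewCols_of_pairs hq fun a b hab => ?_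
  obtain ⟨σ, rfl, rfl⟩ := exists_perm_last_two a b hab
  have hs := isSkewAlt_skewSign (m := m + 2) hq
  refine exists_pair_form hL hs (x := σ) (skewSign_ne_zero hq σ.injective) (fun i hi => ?_) ?_
  · have hi' : Function.Injective i := by
      by_contra h'
      exact hi (skewSign_of_not_injective q h')
    have : i = σ ∘ ((Equiv.ofBijective i (Finite.injective_iff_bijective.1 hi')).trans σ.symm) := by
      ext; simp
    rw [this]
    exact Equiv.Perm.ofFn_comp_perm _ _
  -- By hypothesis the contraction is `skewSign q j • D`, which visibly alternates.
  · have hfun : (fun j : Fin (m + 2) → Fin (m + 2) => ∑ i : Fin (m + 2) → Fin (m + 2),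
        skewSign q i • word v i j) = fun j => skewSign q j • D := funext fun j => h j
    rw [hfun]
    refine ⟨fun j r r' hr e => ?_, fun j r r' hr => ?_⟩
    · rw [hs.eq_zero j r r' hr e, zero_smul]
    · rw [hs.swap j r r' hr, neg_smul, smul_smul, smul_eq_mul]

/-! ### The relations of `O_{A(e,2),A(f,2)}(M)` -/

theorem concat_comp_swap {N : ℕ} (l : Fin (n - N) → Fin m) (i : Fin N → Fin m) (hN : N ≤ n)
    (r r' : Fin N) :
    concat (m := n) l (i ∘ Equiv.swap r r') = concat (m := n) l i ∘
      Equiv.swap ⟨n - N + r.1, by omega⟩ ⟨n - N + r'.1, by omega⟩ := by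
  have hb : ∀ y : Fin N, n - N + y.1 < n := fun y => by omega
  ext x
  by_cases hx : x.1 < n - N
  · rw [Function.comp_apply, Equiv.swap_apply_of_ne_of_ne] <;>
      simp only [concat, hx, dif_pos, ne_eq, Fin.ext_iff] <;> omega
  · obtain ⟨y, rfl⟩ : ∃ y : Fin N, x = ⟨n - N + y.1, hb y⟩ :=
      ⟨⟨x.1 - (n - N), by omega⟩, Fin.ext (by simp; omega)⟩
    have h : ∀ y : Fin N, concat (m := n) l i ⟨n - N + y.1, by omega⟩ = i y := fun y => by
      simp [concat]
    have : (Equiv.swap (⟨n - N + r.1, by omega⟩ : Fin n) ⟨n - N + r'.1, by omega⟩)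
        ⟨n - N + y.1, by omega⟩ = ⟨n - N + (Equiv.swap r r' y).1, by omega⟩ := by
      simp only [Equiv.swap_apply_def, Fin.ext_iff]
      split_ifs <;> simp_all
    rw [Function.comp_apply, this, h]
    simp [concat]

theorem concat_apply {N : ℕ} (l : Fin (n - N) → Fin m) (i : Fin N → Fin m) (hN : N ≤ n)
    (r : Fin N) : concat (m := n) l i ⟨n - N + r.1, by omega⟩ = i r := by
  simp [concat]

theorem isSkewAlt_concat {N : ℕ} {q : Fin n → Fin n → k} (hq : IsMulAntisymm q) (hN : N ≤ n)
    (l : Fin (n - N) → Fin n) :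
    IsSkewAlt q fun i : Fin N → Fin n => skewSign q (concat (m := n) l i) := by
  have h := isSkewAlt_skewSign (m := n) hq
  refine ⟨fun j r r' hr e => ?_, fun j r r' hr => ?_⟩
  · refine h.eq_zero _ ⟨n - N + r.1, by omega⟩ ⟨n - N + r'.1, by omega⟩ (by simp; omega) ?_
    rw [concat_apply l j hN, concat_apply l j hN, e]
  · have := h.swap (concat (m := n) l j) ⟨n - N + r.1, by omega⟩ ⟨n - N + r'.1, by omega⟩
      (by simp; omega)
    rwa [← concat_comp_swap l j hN, concat_apply l j hN, concat_apply l j hN] at this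

/-- The prefix `l` lists all the letters other than `a` and `b`, leaving room for just these two. -/
theorem exists_concat_pair {q : Fin n → Fin n → k} (hq : IsMulAntisymm q) (hn : 2 ≤ n)
    {a b : Fin n} (hab : a ≠ b) : ∃ l : Fin (n - 2) → Fin n,
      skewSign q (concat (m := n) l ![a, b]) ≠ 0 ∧
      ∀ i : Fin 2 → Fin n, skewSign q (concat (m := n) l i) ≠ 0 → i = ![a, b] ∨ i = ![b, a] := by
  obtain ⟨m, rfl⟩ := Nat.exists_eq_add_of_le' hn
  obtain ⟨σ, rfl, rfl⟩ := exists_perm_last_two a b hab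
  have hm : m + 2 - 2 = m := by omega
  have hc : concat (m := m + 2) (fun r : Fin (m + 2 - 2) => σ ⟨r.1, by omega⟩)
      ![σ ⟨m, by omega⟩, σ ⟨m + 1, by omega⟩] = σ := by
    funext r
    by_cases h : r.1 < m
    · simp [concat, hm, h]
    · have : r.1 = m ∨ r.1 = m + 1 := by omega
      rcases this with h' | h'
      · obtain rfl : r = ⟨m, by simp⟩ := Fin.ext h'
        simp [concat]
      · obtain rfl : r = ⟨m + 1, by simp⟩ := Fin.ext h'
        simp [concat]
  refine ⟨fun r => σ ⟨r.1, by omega⟩, ?_, fun i hi => ?_⟩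
  · rw [hc]
    exact skewSign_ne_zero hq σ.injective
  · have hi' : Function.Injective (concat (m := m + 2) (fun r : Fin (m + 2 - 2) =>
        σ ⟨r.1, by omega⟩) i) := by
      by_contra h'
      exact hi (skewSign_of_not_injective q h')
    have hv : ∀ y : Fin 2, concat (m := m + 2) (fun r : Fin (m + 2 - 2) => σ ⟨r.1, by omega⟩) i
        ⟨m + y.1, by omega⟩ = i y := fun y => by simp [concat]
    have hl : ∀ r : Fin m, concat (m := m + 2) (fun r : Fin (m + 2 - 2) => σ ⟨r.1, by omega⟩) i
        ⟨r.1, by omega⟩ = σ ⟨r.1, by omega⟩ := fun r => by simp [concat]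
    have hmem : ∀ y : Fin 2, i y = σ ⟨m, by omega⟩ ∨ i y = σ ⟨m + 1, by omega⟩ := by
      intro y
      obtain ⟨r, hr⟩ := σ.surjective (i y)
      by_cases h : r.1 < m
      · have := hi' (((hl ⟨r.1, h⟩).trans hr).trans (hv y).symm)
        simp only [Fin.mk.injEq] at this
        omega
      · have : r.1 = m ∨ r.1 = m + 1 := by omega
        rcases this with h' | h'
        · obtain rfl : r = ⟨m, by simp⟩ := Fin.ext h'
          exact Or.inl hr.symm
        · obtain rfl : r = ⟨m + 1, by simp⟩ := Fin.ext h'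
          exact Or.inr hr.symm
    have hne : i 0 ≠ i 1 := fun e => by
      have := hi' (((hv 0).trans e).trans (hv 1).symm)
      simp at this
    have hi2 : i = ![i 0, i 1] := by
      ext y; fin_cases y <;> rfl
    rcases hmem 0 with h0 | h0 <;> rcases hmem 1 with h1 | h1
    · exact absurd (h0.trans h1.symm) hne
    · left
      rw [hi2, h0, h1]
    · right
      rw [hi2, h0, h1]
    · exact absurd (h0.trans h1.symm) hne

/-- The first half of the relations of `O_{A(e,2),A(f,2)}(M)`. -/
def PerpRel (q : Fin n → Fin n → k) (v : Fin n → Fin n → R) : Prop :=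
  ∀ (l : Fin (n - 2) → Fin n) (μ : (Fin 2 → Fin n) → k), μ ∈ perp (formE q) 2 →
    ∑ i : Fin 2 → Fin n, ∑ j : Fin 2 → Fin n,
      (coeff (formE q) (concat l i) * μ j) • word v i j = 0

/-- The annihilator `perp` consists of the `q`-symmetric tensors, and the contracted words must be
orthogonal to it. This holds exactly when they are `q`-alternating in the column indices. -/
theorem perpRel_iff {q : Fin n → Fin n → k} (hq : IsMulAntisymm q) (hn : 2 ≤ n)
    {v : Fin n → Fin n → R} : PerpRel q v ↔ SkewCols q v := by
  have hsum : ∀ (l : Fin (n - 2) → Fin n) (μ : (Fin 2 → Fin n) → k),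
      ∑ i : Fin 2 → Fin n, ∑ j : Fin 2 → Fin n,
        (coeff (formE q) (concat l i) * μ j) • word v i j
      = ∑ j, μ j • ∑ i : Fin 2 → Fin n, skewSign q (concat (m := n) l i) • word v i j := by
    intro l μ
    rw [Finset.sum_comm]
    simp only [Finset.smul_sum, smul_smul, coeff_formE, mul_comm]
  constructor
  · intro h
    refine skewCols_of_pairs hq fun a b hab => ?_
    obtain ⟨l, h₁, h₂⟩ := exists_concat_pair hq hn hab
    have hp : ∀ μ ∈ perp (formE q) 2,
        ∑ j, μ j • ∑ i : Fin 2 → Fin n, skewSign q (concat (m := n) l i) • word v i j = 0 :=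
      fun μ hμ => by rw [← hsum]; exact h l μ hμ
    refine ⟨_, isSkewAlt_concat hq hn l, h₁, h₂, ⟨fun j r r' hr e => ?_, fun j r r' hr => ?_⟩⟩
    -- A diagonal basis tensor lies in `perp`, because the form vanishes on repeated letters.
    · have := hp (Pi.single j 1) (fun l' => ?_)
      · simpa [Pi.single_apply] using this
      · simp only [coeff_formE]
        simpa [Pi.single_apply] using (isSkewAlt_concat hq hn l').eq_zero j r r' hr e
    -- The `q`-symmetrization of a basis tensor lies in `perp`, by the exchange rule for the form.
    · have := hp (Pi.single j 1 + q (j r') (j r) • Pi.single (j ∘ Equiv.swap r r') 1)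
        (fun l' => ?_)
      · simpa [Pi.single_apply, add_smul, Finset.sum_add_distrib, mul_smul,
          ← eq_neg_iff_add_eq_zero] using this
      · simp only [coeff_formE]
        have := (isSkewAlt_concat hq hn l').swap j r r' hr
        rw [eq_neg_iff_add_eq_zero] at this
        simpa [Pi.single_apply, mul_add, Finset.sum_add_distrib, mul_comm] using this
  · intro h l μ hμ
    rw [hsum]
    have hT := h.isSkewAlt_sum (isSkewAlt_concat hq hn l)
    refine Finset.sum_involution (fun i _ => i ∘ Equiv.swap 0 1) (fun j _ => ?_)
      (fun j _ hj he => hj ?_) (fun i _ => Finset.mem_univ _) (fun i _ => comp_swap_swap i)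
    · rcases eq_or_ne (j 0) (j 1) with e | e
      · rw [hT.eq_zero j 0 1 rfl e, hT.eq_zero (j ∘ Equiv.swap 0 1) 0 1 rfl (by simpa using e.symm)]
        simp
      · obtain ⟨l', h₁, h₂⟩ := exists_concat_pair hq hn e
        have hj2 : j = ![j 0, j 1] := by
          ext y; fin_cases y <;> rfl
        have hsw := pair_comp_swap (j 0) (j 1)
        rw [← hj2] at hsw
        have hμ' := hμ l'
        simp only [coeff_formE] at hμ'
        rw [sum_pair e fun i hi₁ hi₂ => ?_, ← hj2, ← hsw] at hμ'
        · have h3 := (isSkewAlt_concat hq hn l').swap j 0 1 rfl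
          rw [← hj2] at h₁
          simp only [smul_eq_mul] at h3
          have hne : skewSign q (concat (m := n) l' (j ∘ Equiv.swap 0 1)) ≠ 0 := by
            intro e'
            rw [h3, e', mul_zero, neg_zero] at h₁
            exact h₁ rfl
          rw [h3] at hμ'
          -- A prefix leaving only the letters of `j` isolates two terms in the condition on `μ`,
          -- which forces `μ` to be `q`-symmetric at `j`.
          have hμ2 : μ (j ∘ Equiv.swap 0 1) = q (j 1) (j 0) * μ j := by
            refine mul_left_cancel₀ hne ?_
            linear_combination hμ'
          rw [hT.swap j 0 1 rfl, hμ2, smul_neg, smul_smul, mul_comm, neg_add_cancel]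
        · by_contra h'
          rcases h₂ i (left_ne_zero_of_mul h') with h' | h'
          exacts [hi₁ h', hi₂ h']
    · rw [hT.eq_zero j 0 1 rfl (by simpa using (congr_fun he 0).symm), smul_zero]

end Quadratic

/-! ### Skew polynomial rings and linear coactions -/

section SkewPolynomials

variable {k : Type u} [Field k] {n m : ℕ} {R : Type v} [Ring R] [Algebra k R]

/-- The relations `x_j x_i = q_ji x_i x_j` for elements of an arbitrary algebra. -/
def SkewCommute (q : Fin n → Fin n → k) (x : Fin n → R) : Prop :=
  ∀ i j, x j * x i = q j i • (x i * x j)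

/-- In the difference of the two products, the terms for column indices `(a, b)` and `(b, a)` cancel
by `mixed`, the diagonal ones by `same`. -/
theorem SkewCols.skewCommute {q : Fin n → Fin n → k} {v : Fin n → Fin n → R} {x : Fin n → R}
    (hv : SkewCols q v) (hx : SkewCommute q x) (hvx : ∀ i j l, Commute (v i j) (x l)) :
    SkewCommute q fun i => ∑ l, v i l * x l := by
  intro i j
  have h : ∀ i j, (∑ l, v i l * x l) * ∑ l, v j l * x l
      = ∑ a : Fin n × Fin n, v i a.1 * v j a.2 * (x a.1 * x a.2) := by
    intro i j
    rw [Finset.sum_mul_sum, ← Fintype.sum_prod_type']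
    refine Finset.sum_congr rfl fun a _ => ?_
    rw [mul_assoc, ← mul_assoc (x a.1), ← (hvx j a.2 a.1).eq, mul_assoc, mul_assoc]
  rw [h, h, ← sub_eq_zero, Finset.smul_sum, ← Finset.sum_sub_distrib]
  refine Finset.sum_involution (fun a _ => a.swap) (fun a _ => ?_) (fun a _ ha he => ha ?_)
    (fun _ _ => Finset.mem_univ _) (fun a _ => a.swap_swap)
  · have hm := congr_arg (· * (x a.1 * x a.2)) (hv.mixed i j a.1 a.2)
    simp only [Prod.fst_swap, Prod.snd_swap, hx a.1 a.2]
    simp only [add_mul, smul_mul_assoc, mul_smul_comm, smul_add] at hm ⊢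
    rw [← sub_eq_zero] at hm
    rw [← hm]
    module
  · have he' : a.2 = a.1 := congr_arg Prod.fst he
    rw [he', hv.same i j a.1, smul_mul_assoc, sub_self]

/-- The pair `(A, x)` is a copy of the algebra with relations `x_j x_i = q_ji x_i x_j`. -/
def IsSkewPoly (q : Fin n → Fin n → k) {A : Type v} [Ring A] [Algebra k A] (x : Fin n → A) : Prop :=
  ∃ ψ : SkewPoly q ≃ₐ[k] A, ∀ i, ψ (SkewPoly.x q i) = x i

theorem isSkewPoly_x (q : Fin n → Fin n → k) : IsSkewPoly q (SkewPoly.x q) :=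
  ⟨AlgEquiv.refl, fun _ => rfl⟩

theorem skewCommute_x (q : Fin n → Fin n → k) : SkewCommute q (SkewPoly.x q) := fun i j => by
  have := RingQuot.mkAlgHom_rel k (SkewRel.comm (q := q) i j)
  simpa [SkewPoly.x] using this

theorem SkewPoly.exists_lift {q : Fin n → Fin n → k} {y : Fin n → R} (hy : SkewCommute q y) :
    ∃ φ : SkewPoly q →ₐ[k] R, ∀ i, φ (SkewPoly.x q i) = y i := by
  refine ⟨RingQuot.liftAlgHom k ⟨FreeAlgebra.lift k y, ?_⟩, fun i => ?_⟩
  · rintro _ _ ⟨i, j⟩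
    simpa using hy i j
  · simp [SkewPoly.x]

theorem SkewPoly.algHom_ext {q : Fin n → Fin n → k} {φ ψ : SkewPoly q →ₐ[k] R}
    (h : ∀ i, φ (SkewPoly.x q i) = ψ (SkewPoly.x q i)) : φ = ψ := by
  refine RingQuot.ringQuot_ext' _ _ _ ?_
  ext i
  exact h i

variable {A : Type w} [Ring A] [Algebra k A]

theorem IsSkewPoly.skewCommute {q : Fin n → Fin n → k} {x : Fin n → A} (hx : IsSkewPoly q x) :
    SkewCommute q x := by
  obtain ⟨ψ, hψ⟩ := hx
  intro i j
  simp only [← hψ, ← map_mul, ← map_smul, skewCommute_x q i j]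

theorem IsSkewPoly.exists_lift {q : Fin n → Fin n → k} {x : Fin n → A} (hx : IsSkewPoly q x)
    {y : Fin n → R} (hy : SkewCommute q y) : ∃ φ : A →ₐ[k] R, ∀ i, φ (x i) = y i := by
  obtain ⟨ψ, hψ⟩ := hx
  obtain ⟨φ, hφ⟩ := SkewPoly.exists_lift hy
  refine ⟨φ.comp ψ.symm, fun i => ?_⟩
  simp [← hψ, hφ]

theorem IsSkewPoly.algHom_ext {q : Fin n → Fin n → k} {x : Fin n → A} (hx : IsSkewPoly q x)
    {φ φ' : A →ₐ[k] R} (h : ∀ i, φ (x i) = φ' (x i)) : φ = φ' := by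
  obtain ⟨ψ, hψ⟩ := hx
  have : φ.comp ψ.toAlgHom = φ'.comp ψ.toAlgHom := SkewPoly.algHom_ext fun i => by simp [hψ, h]
  ext a
  simpa using DFunLike.congr_fun this (ψ.symm a)

/-- The action of `x_i` on a three-step quotient of the regular representation. -/
def truncAct (s : Fin n → Fin n → k) (i : Fin n) : Module.End k (k × (Fin n → k) × k) where
  toFun z := (0, z.1 • Pi.single i 1, ∑ j, s i j * z.2.1 j)
  map_add' a b := by simp [add_smul, mul_add, Finset.sum_add_distrib]
  map_smul' c a := by simp [mul_smul, Finset.mul_sum, mul_left_comm]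

/-- The representation `truncAct` sends `(1, 0, 0)` to the degree one basis and then to the values
`s i j`, so its matrix coefficients are the functionals. This replaces a monomial basis: the
generators are independent, and `hs` is the only constraint on functionals of the products `x i * x
j`. -/
theorem IsSkewPoly.exists_functional {q : Fin n → Fin n → k} {x : Fin n → A} (hx : IsSkewPoly q x)
    {s : Fin n → Fin n → k} (hs : ∀ i j, s j i = q j i * s i j) :
    (∃ f : A →ₗ[k] k, ∀ i j, f (x i * x j) = s i j) ∧
    ∀ l, ∃ f : A →ₗ[k] k, ∀ i, f (x i) = if i = l then 1 else 0 := by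
  have hmul : ∀ i j z, (truncAct s i * truncAct s j) z = (0, 0, z.1 * s i j) := by
    intro i j z
    simp [truncAct, Pi.single_apply, mul_comm]
  obtain ⟨φ, hφ⟩ := hx.exists_lift (y := truncAct s) fun i j => by
    refine LinearMap.ext fun z => ?_
    rw [LinearMap.smul_apply, hmul, hmul, hs]
    simp [mul_left_comm]
  refine ⟨⟨(LinearMap.snd k _ _ ∘ₗ LinearMap.snd k _ _) ∘ₗ
    (LinearMap.applyₗ (R := k) (M := k × (Fin n → k) × k) (M₂ := k × (Fin n → k) × k) (1, 0, 0))
      ∘ₗ φ.toLinearMap, fun i j => ?_⟩, fun l => ⟨(LinearMap.proj l ∘ₗ LinearMap.fst k _ _ ∘ₗ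
        LinearMap.snd k _ _) ∘ₗ (LinearMap.applyₗ (R := k) (M := k × (Fin n → k) × k)
          (M₂ := k × (Fin n → k) × k) (1, 0, 0)) ∘ₗ φ.toLinearMap, fun i => ?_⟩⟩
  · simp only [LinearMap.comp_apply, AlgHom.toLinearMap_apply, map_mul, hφ, LinearMap.applyₗ_apply_apply,
      hmul, LinearMap.snd_apply, one_mul]
  · simp only [LinearMap.comp_apply, AlgHom.toLinearMap_apply, hφ, LinearMap.applyₗ_apply_apply,
      LinearMap.snd_apply, LinearMap.fst_apply, LinearMap.proj_apply]
    simp [truncAct, Pi.single_apply, eq_comm]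

/-- Contraction of the second tensor factor with a functional. -/
def contract (R : Type v) [Ring R] [Algebra k R] (f : A →ₗ[k] k) : R ⊗[k] A →ₗ[k] R :=
  (TensorProduct.rid k R).toLinearMap ∘ₗ f.lTensor R

theorem contract_tmul (f : A →ₗ[k] k) (r : R) (a : A) : contract R f (r ⊗ₜ a) = f a • r := by
  simp [contract]

theorem IsSkewPoly.coeff_ext {q : Fin n → Fin n → k} {x : Fin n → A} (hx : IsSkewPoly q x)
    {c d : Fin n → R} (h : ∑ l, c l ⊗ₜ[k] x l = ∑ l, d l ⊗ₜ[k] x l) (l : Fin n) : c l = d l := by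
  obtain ⟨f, hf⟩ := (hx.exists_functional (s := fun _ _ => 0) (by simp)).2 l
  simpa [contract_tmul, hf] using congr_arg (contract R f) h

/-- Apply functionals in the second tensor factor. The tables `s` concentrated at `(a, a)`, or at
`(a, b)` and `(b, a)` with ratio `q b a`, pick out the individual relations. -/
theorem IsSkewPoly.skewCols {q : Fin n → Fin n → k} (hq : IsMulAntisymm q) {x : Fin n → A}
    (hx : IsSkewPoly q x) {v : Fin n → Fin n → R}
    (h : SkewCommute q fun i => ∑ l, v i l ⊗ₜ[k] x l) : SkewCols q v := by
  have key : ∀ s : Fin n → Fin n → k, (∀ i j, s j i = q j i * s i j) → ∀ i j,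
      ∑ a : Fin n × Fin n, s a.1 a.2 • (v j a.1 * v i a.2)
        = q j i • ∑ a : Fin n × Fin n, s a.1 a.2 • (v i a.1 * v j a.2) := by
    intro s hs i j
    obtain ⟨f, hf⟩ := (hx.exists_functional hs).1
    have := congr_arg (contract R f) (h i j)
    rw [map_smul, Finset.sum_mul_sum, Finset.sum_mul_sum, ← Fintype.sum_prod_type',
      ← Fintype.sum_prod_type'] at this
    simpa only [Algebra.TensorProduct.tmul_mul_tmul, map_sum, contract_tmul, hf] using this
  have hsame : ∀ i j a, v j a * v i a = q j i • (v i a * v j a) := by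
    intro i j a
    have := key (fun c d => if (c, d) = (a, a) then 1 else 0) (fun c d => by
      by_cases hcd : c = d
      · rw [hcd, hq.1, one_mul]
      · rw [if_neg, if_neg, mul_zero]
        · simp only [Prod.mk.injEq]; rintro ⟨rfl, rfl⟩; exact hcd rfl
        · simp only [Prod.mk.injEq]; rintro ⟨rfl, rfl⟩; exact hcd rfl) i j
    simpa [ite_smul] using this
  refine ⟨hsame, fun i j a b => ?_⟩
  by_cases hab : a = b
  · subst hab
    rw [hsame i j a, smul_add, smul_comm]
  · have hne : (a, b) ≠ (b, a) := fun e => hab (congr_arg Prod.fst e)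
    have := key (fun c d => (if (c, d) = (a, b) then 1 else 0) + if (c, d) = (b, a) then q b a else 0)
      (fun c d => by
        by_cases h1 : (c, d) = (a, b)
        · obtain ⟨rfl, rfl⟩ := Prod.mk.inj h1
          simp [hab, Ne.symm hab]
        · by_cases h2 : (c, d) = (b, a)
          · obtain ⟨rfl, rfl⟩ := Prod.mk.inj h2
            simp [hab, Ne.symm hab, hq.2]
          · have h1' : (d, c) ≠ (b, a) := fun e => h1 (congr_arg Prod.swap e)
            have h2' : (d, c) ≠ (a, b) := fun e => h2 (congr_arg Prod.swap e)
            simp [h1, h2, h1', h2']) i j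
    simpa [ite_smul, add_smul, Finset.sum_add_distrib] using this

theorem SkewCols.map {S : Type w} [Ring S] [Algebra k S] {q : Fin n → Fin n → k}
    {v : Fin n → Fin n → R} (hv : SkewCols q v) (φ : R →ₐ[k] S) : SkewCols q fun i j => φ (v i j) := by
  refine ⟨fun i j a => ?_, fun i j a b => ?_⟩
  · simp only [← map_mul, ← map_smul, hv.same i j a]
  · simp only [← map_mul, ← map_smul, ← map_add, hv.mixed i j a b]

/-- The product matrix acts on the skew polynomial ring as the composite of two substitutions, each
of which preserves the defining relations. -/
theorem SkewCols.mul {q : Fin n → Fin n → k} (hq : IsMulAntisymm q) {a b : Fin n → Fin n → R}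
    (ha : SkewCols q a) (hb : SkewCols q b) (hab : ∀ i j i' j', Commute (a i j) (b i' j')) :
    SkewCols q fun i j => ∑ l, a i l * b l j := by
  refine (isSkewPoly_x q).skewCols hq ?_
  have h₁ := (hb.map (Algebra.TensorProduct.includeLeft : R →ₐ[k] R ⊗[k] SkewPoly q)).skewCommute
    (x := fun l => 1 ⊗ₜ SkewPoly.x q l) (fun i j => by
      simp [skewCommute_x q i j]) (fun i j l => by
        simp [Commute, SemiconjBy])
  have h₂ := (ha.map (Algebra.TensorProduct.includeLeft : R →ₐ[k] R ⊗[k] SkewPoly q)).skewCommute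
    h₁ (fun i j l => Commute.sum_right _ _ _ fun c _ => by
        simp [Commute, SemiconjBy, (hab i j l c).eq])
  refine (congr_arg (SkewCommute q) (funext fun i => ?_)).mp h₂
  simp only [Algebra.TensorProduct.includeLeft_apply, Algebra.TensorProduct.tmul_mul_tmul, mul_one,
    one_mul, Finset.mul_sum, TensorProduct.sum_tmul]
  rw [Finset.sum_comm]

end SkewPolynomials

/-! ### Quantum matrices: row and column relations together -/

section QuantumMatrices

variable {k : Type u} [Field k] {n m : ℕ} {R : Type v} [Ring R] [Algebra k R]

/-- The standing assumptions on the parameters of `O_{p,λ}(GL_n)`. -/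
structure IsParam (p q : Fin n → Fin n → k) (lam : k) : Prop where
  two_le : 2 ≤ n
  p_antisymm : IsMulAntisymm p
  q_antisymm : IsMulAntisymm q
  lam_ne : lam ≠ -1
  rel : ∀ i j : Fin n, i < j → q j i = lam * p j i

/-- The quadratic relations of both kinds. -/
structure IsQMat (p q : Fin n → Fin n → k) (v : Fin n → Fin n → R) : Prop where
  cols : SkewCols q v
  rows : SkewCols (fun i j => p j i) fun i j => v j i

/-- Exchanging `i, j` or `a, b` only rescales a relation, by antisymmetry of `q`, and the degenerate
cases reduce to `same` or are trivial. -/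
theorem SkewCols.of_lt {q : Fin n → Fin n → k} (hq : IsMulAntisymm q) {v : Fin n → Fin n → R}
    (h₁ : ∀ i j a, i < j → v j a * v i a = q j i • (v i a * v j a))
    (h₂ : ∀ i j a b, i < j → a < b → v j a * v i b + q b a • (v j b * v i a)
      = q j i • (v i a * v j b + q b a • (v i b * v j a))) : SkewCols q v := by
  have hs : ∀ i j a, v j a * v i a = q j i • (v i a * v j a) := by
    intro i j a
    rcases lt_trichotomy i j with h | rfl | h
    · exact h₁ i j a h
    · rw [hq.1, one_smul]
    · rw [h₁ j i a h, smul_smul, hq.2, one_smul]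
  have hm : ∀ i j a b, i < j → v j a * v i b + q b a • (v j b * v i a)
      = q j i • (v i a * v j b + q b a • (v i b * v j a)) := by
    intro i j a b h
    rcases lt_trichotomy a b with h' | rfl | h'
    · exact h₂ i j a b h h'
    · rw [hs i j a, smul_add, smul_comm]
    · have := congr_arg (q b a • ·) (h₂ i j b a h h')
      simp only [smul_add, smul_smul, hq.2, one_smul, mul_left_comm, mul_one] at this ⊢
      rw [add_comm, this, add_comm, mul_comm]
  refine ⟨hs, fun i j a b => ?_⟩
  rcases lt_trichotomy i j with h | rfl | h
  · exact hm i j a b h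
  · rw [hq.1, one_smul]
  · rw [hm j i a b h, smul_smul, hq.2, one_smul]

/-- The quadratic relations of `O_{p,λ}(GL_n)`. -/
structure ASTQuad (p : Fin n → Fin n → k) (lam : k) (v : Fin n → Fin n → R) : Prop where
  rel₁ : ∀ i j a b, i < j → a < b → v j b * v i a
    = (p j i * p a b) • (v i a * v j b) + ((lam - 1) * p j i) • (v i b * v j a)
  rel₂ : ∀ i j a b, i < j → b ≤ a → v j b * v i a = (lam * p j i * p a b) • (v i a * v j b)
  rel₃ : ∀ i a b, a < b → v i b * v i a = p a b • (v i a * v i b)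

/-- Solving the row relation for `v j b * v i a` and substituting in the column relation cancels the
product `v i a * v j b`. What remains is the claim multiplied by `1 + λ`. -/
theorem IsQMat.antidiagonal {p q : Fin n → Fin n → k} {lam : k} (hP : IsParam p q lam)
    {v : Fin n → Fin n → R} (hv : IsQMat p q v) (i j a b : Fin n) (hij : i < j) (hab : a < b) :
    v j a * v i b = (lam * p j i * p b a) • (v i b * v j a) := by
  have h₁ := hv.cols.mixed i j a b
  have h₂ := congr_arg (p j i • ·) (hv.rows.mixed a b i j)
  rw [hP.rel _ _ hij, hP.rel _ _ hab] at h₁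
  simp only [smul_add, smul_smul, ← mul_assoc, hP.p_antisymm.2, one_smul] at h₁ h₂
  have hl : (1 + lam) ≠ 0 := fun h => hP.lam_ne (eq_neg_of_add_eq_zero_right h)
  have h3 : v j b * v i a = (p j i * p a b) • (v i a * v j b) + p a b • (v j a * v i b)
      - p j i • (v i b * v j a) := by
    rw [eq_sub_iff_add_eq, add_comm, h₂]
    simp only [mul_right_comm, hP.p_antisymm.2, one_mul]
  rw [h3] at h₁
  refine smul_right_injective R hl ?_
  have hpp := hP.p_antisymm.2 a b
  simp only [smul_add, smul_sub, smul_smul] at h₁ ⊢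
  have e1 : lam * p b a * (p j i * p a b) = lam * p j i := by linear_combination lam * p j i * hpp
  have e2 : lam * p b a * p a b = lam := by linear_combination lam * hpp
  rw [e1, e2] at h₁
  have h4 : v j a * v i b + lam • (v j a * v i b)
      = (lam * p b a * p j i + lam * p j i * lam * p b a) • (v i b * v j a) := by
    rw [add_smul, ← sub_eq_zero]
    rw [← sub_eq_zero] at h₁
    rw [← h₁]
    abel
  rw [add_smul, one_smul, h4]
  congr 1
  ring

/-- The three-term relation is the mixed row relation after `v j a * v i b` has been reordered by
`IsQMat.antidiagonal`. -/
theorem IsQMat.astQuad {p q : Fin n → Fin n → k} {lam : k} (hP : IsParam p q lam)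
    {v : Fin n → Fin n → R} (hv : IsQMat p q v) : ASTQuad p lam v := by
  refine ⟨fun i j a b hij hab => ?_, fun i j a b hij hab => ?_, fun i a b _ => hv.rows.same a b i⟩
  · have h₂ := congr_arg (p j i • ·) (hv.rows.mixed a b i j)
    rw [hv.antidiagonal hP i j a b hij hab] at h₂
    simp only [smul_add, smul_smul, ← mul_assoc, hP.p_antisymm.2, one_smul] at h₂
    rw [← sub_eq_zero] at h₂ ⊢
    rw [← h₂]
    have h1 := hP.p_antisymm.2 a b
    have h2 := hP.p_antisymm.2 j i
    match_scalars
    · ring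
    · ring
    · linear_combination (lam * p j i * (p j i * p i j)) * h1 + lam * p j i * h2
  · rcases hab.eq_or_lt with rfl | h
    · rw [hv.cols.same i j b, hP.rel i j hij, hP.p_antisymm.1, mul_one]
    · exact hv.antidiagonal hP i j b a hij h

theorem ASTQuad.isQMat {p q : Fin n → Fin n → k} {lam : k} (hP : IsParam p q lam)
    {v : Fin n → Fin n → R} (hv : ASTQuad p lam v) : IsQMat p q v := by
  refine ⟨.of_lt hP.q_antisymm (fun i j a h => ?_) fun i j a b hij hab => ?_,
    .of_lt hP.p_antisymm.transpose (fun i j a h => hv.rel₃ a i j h) fun i j a b hij hab => ?_⟩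
  · rw [hv.rel₂ i j a a h le_rfl, hP.rel i j h, hP.p_antisymm.1, mul_one]
  · rw [hv.rel₁ i j a b hij hab, hv.rel₂ i j b a hij hab.le, hP.rel i j hij, hP.rel a b hab]
    have h1 := hP.p_antisymm.2 a b
    match_scalars
    · ring
    · linear_combination (lam * p j i) * h1
  · rw [hv.rel₁ a b i j hab hij, hv.rel₂ a b j i hab hij.le]
    have h1 := hP.p_antisymm.2 a b
    have h2 := hP.p_antisymm.2 i j
    match_scalars
    · linear_combination -h1 - (lam * p a b * p b a) * h2
    · linear_combination p i j * h1

theorem IsQMat.map {S : Type w} [Ring S] [Algebra k S] {p q : Fin n → Fin n → k}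
    {v : Fin n → Fin n → R} (hv : IsQMat p q v) (φ : R →ₐ[k] S) :
    IsQMat p q fun i j => φ (v i j) :=
  ⟨hv.cols.map φ, hv.rows.map φ⟩

theorem IsQMat.mul {p q : Fin n → Fin n → k} (hp : IsMulAntisymm p) (hq : IsMulAntisymm q)
    {a b : Fin n → Fin n → R} (ha : IsQMat p q a) (hb : IsQMat p q b)
    (hab : ∀ i j i' j', Commute (a i j) (b i' j')) :
    IsQMat p q fun i j => ∑ l, a i l * b l j := by
  refine ⟨ha.cols.mul hq hb.cols hab, ?_⟩
  convert hb.rows.mul hp.transpose ha.rows (fun i j i' j' => (hab _ _ _ _).symm) using 4 with i j l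
  exact (hab _ _ _ _).eq

theorem skewCols_one {q : Fin n → Fin n → k} (hq : IsMulAntisymm q) :
    SkewCols q fun i j => (if i = j then 1 else 0 : R) := by
  refine (isSkewPoly_x q).skewCols hq ?_
  intro i j
  simp [TensorProduct.ite_tmul, skewCommute_x q i j]

theorem isQMat_one {p q : Fin n → Fin n → k} (hp : IsMulAntisymm p) (hq : IsMulAntisymm q) :
    IsQMat p q fun i j => (if i = j then 1 else 0 : R) := by
  refine ⟨skewCols_one hq, ?_⟩
  simpa only [eq_comm] using skewCols_one (R := R) hp.transpose

/-- Each relation is homogeneous in every row index and every column index. The resulting rescalings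
of `OM` describe commutation with the square of the determinant. -/
theorem IsQMat.scale {p q : Fin n → Fin n → k} {v : Fin n → Fin n → R} (hv : IsQMat p q v)
    (a b : Fin n → k) : IsQMat p q fun i j => (a i * b j) • v i j := by
  refine ⟨⟨fun i j c => ?_, fun i j c d => ?_⟩, ⟨fun i j c => ?_, fun i j c d => ?_⟩⟩ <;>
    simp only [smul_mul_smul_comm]
  · rw [hv.cols.same i j c]
    module
  · have h := congr_arg ((a i * a j * b c * b d) • ·) (hv.cols.mixed i j c d)
    simp only [smul_add, smul_smul] at h ⊢
    rw [← sub_eq_zero] at h ⊢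
    rw [← h]
    module
  · rw [hv.rows.same i j c]
    module
  · have h := congr_arg ((b i * b j * a c * a d) • ·) (hv.rows.mixed i j c d)
    simp only [smul_add, smul_smul] at h ⊢
    rw [← sub_eq_zero] at h ⊢
    rw [← h]
    module

theorem word_map {S : Type w} [Ring S] [Algebra k S] (φ : R →ₐ[k] S) (v : Fin n → Fin n → R)
    (i j : Fin m → Fin n) : φ (word v i j) = word (fun a b => φ (v a b)) i j := by
  simp [word, map_list_prod, List.map_ofFn, Function.comp_def]

theorem colDet_map {S : Type w} [Ring S] [Algebra k S] (φ : R →ₐ[k] S) (e : Form k n n)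
    (v : Fin n → Fin n → R) : φ (colDet e v) = colDet e fun i j => φ (v i j) := by
  simp [colDet, word_map]

theorem rowDet_map {S : Type w} [Ring S] [Algebra k S] (φ : R →ₐ[k] S) (e : Form k n n)
    (v : Fin n → Fin n → R) : φ (rowDet e v) = rowDet e fun i j => φ (v i j) := by
  simp [rowDet, word_map]

theorem word_scale (v : Fin n → Fin n → R) (a b : Fin n → k) (i j : Fin m → Fin n) :
    word (fun x y => (a x * b y) • v x y) i j
      = ((∏ r, a (i r)) * ∏ r, b (j r)) • word v i j := by
  induction m with
  | zero => simp [word_zero]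
  | succ m ih =>
    rw [word_succ, ih, word_succ v, Fin.prod_univ_succ, Fin.prod_univ_succ, smul_mul_smul_comm]
    congr 1
    simp only [Fin.tail]
    ring

theorem colDet_scale (q : Fin n → Fin n → k) (v : Fin n → Fin n → R) (a b : Fin n → k) :
    colDet (formE q) (fun i j => (a i * b j) • v i j)
      = ((∏ r, a r) * ∏ r, b r) • colDet (formE q) v := by
  simp only [colDet_eq, word_scale, id]
  rw [sum_skewSign_eq_sum_perm, sum_skewSign_eq_sum_perm, Finset.smul_sum]
  refine Finset.sum_congr rfl fun σ _ => ?_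
  rw [Equiv.prod_comp σ a, smul_comm]

theorem Commute.word_right {v : Fin n → Fin n → R} {x : R} (h : ∀ i j, Commute x (v i j))
    (i j : Fin m → Fin n) : Commute x (word v i j) := by
  refine Commute.list_prod_right _ _ fun y hy => ?_
  obtain ⟨r, rfl⟩ := (List.mem_ofFn' _ _).1 hy
  exact h _ _

theorem word_mul {a b : Fin n → Fin n → R} (hab : ∀ i j i' j', Commute (a i j) (b i' j'))
    (i j : Fin m → Fin n) : word (fun x y => ∑ l, a x l * b l y) i j
      = ∑ l : Fin m → Fin n, word a i l * word b l j := by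
  induction m with
  | zero => simp [word_zero]
  | succ m ih =>
    rw [word_succ, ih, sum_cons, Finset.sum_mul_sum]
    refine Finset.sum_congr rfl fun x _ => Finset.sum_congr rfl fun l _ => ?_
    rw [word_succ a, word_succ b]
    simp only [Fin.cons_zero, Fin.tail_cons]
    have := Commute.word_right (v := a) (x := b x (j 0)) (fun i' j' => (hab i' j' _ _).symm)
      (Fin.tail i) l
    rw [mul_assoc, ← mul_assoc (b x (j 0)), this.eq, mul_assoc, mul_assoc]

theorem ColRel.map {S : Type w} [Ring S] [Algebra k S] {q : Fin n → Fin n → k}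
    {v : Fin n → Fin n → R} {D : R} (h : ColRel q v D) (φ : R →ₐ[k] S) :
    ColRel q (fun i j => φ (v i j)) (φ D) := fun j => by
  rw [← map_smul, ← h j, map_sum]
  simp [word_map]

theorem ColRel.mul {q : Fin n → Fin n → k} {a b : Fin n → Fin n → R} {D D' : R}
    (ha : ColRel q a D) (hb : ColRel q b D') (hab : ∀ i j i' j', Commute (a i j) (b i' j')) :
    ColRel q (fun i j => ∑ l, a i l * b l j) (D * D') := fun j => by
  simp only [word_mul hab, Finset.smul_sum]
  rw [Finset.sum_comm]
  simp only [← smul_mul_assoc, ← Finset.sum_mul, ha _]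
  simp only [smul_mul_assoc]
  simp only [← mul_smul_comm, ← Finset.mul_sum, hb _]

theorem eq_iff_head_tail (i j : Fin (m + 1) → Fin n) :
    i = j ↔ i 0 = j 0 ∧ Fin.tail i = Fin.tail j := by
  refine ⟨by rintro rfl; exact ⟨rfl, rfl⟩, fun h => ?_⟩
  rw [← Fin.cons_self_tail i, h.1, h.2, Fin.cons_self_tail]

theorem word_one (i j : Fin m → Fin n) :
    word (fun x y => (if x = y then 1 else 0 : R)) i j = if i = j then 1 else 0 := by
  induction m with
  | zero => simp [word_zero, Subsingleton.elim i j]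
  | succ m ih =>
    rw [word_succ, ih]
    simp only [eq_iff_head_tail i j]
    split_ifs <;> simp_all

theorem colRel_one (q : Fin n → Fin n → k) :
    ColRel q (fun x y => (if x = y then 1 else 0 : R)) 1 := fun j => by
  simp [word_one]

theorem ColRel.exists_right {q : Fin n → Fin n → k} (hq : IsMulAntisymm q)
    {v : Fin n → Fin n → R} {D D' : R} (h : ColRel q v D) (hD : D * D' = 1) :
    ∃ T : Fin n → Fin n → R, ∀ j l, ∑ i, v i j * T i l = if j = l then 1 else 0 := by
  obtain ⟨X, hX, -⟩ := h.exists_adjugate hq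
  refine ⟨fun i l => X i l * D', fun j l => ?_⟩
  simp only [← mul_assoc, ← Finset.sum_mul, hX, ite_mul, hD, zero_mul]

theorem ColRel.exists_left {q : Fin n → Fin n → k} (hq : IsMulAntisymm q)
    {v : Fin n → Fin n → R} {D D' : R} (h : ColRel q v D) (hD : D' * D = 1) :
    ∃ T : Fin n → Fin n → R, ∀ l j, ∑ i, T l i * v i j = if j = l then 1 else 0 := by
  obtain ⟨X, -, hX⟩ := h.exists_adjugate hq
  refine ⟨fun l i => D' * ((twist q l)⁻¹ • twist q i • X i l), fun l j => ?_⟩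
  simp only [mul_assoc, ← Finset.mul_sum, smul_mul_assoc, ← Finset.smul_sum, hX]
  split_ifs with e
  · rw [e, smul_smul, inv_mul_cancel₀ (twist_ne_zero hq l), one_smul, hD]
  · simp

/-- The row relations provide a right inverse and the column relations a left one; the two coincide.
-/
theorem ColRel.exists_inverse {p q : Fin n → Fin n → k} (hp : IsMulAntisymm p)
    (hq : IsMulAntisymm q) {v : Fin n → Fin n → R} {D D' E E' : R} (h : ColRel q v D)
    (h' : ColRel (fun i j => p j i) (fun i j => v j i) E) (hD : D' * D = 1) (hE : E * E' = 1) :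
    ∃ w : Fin n → Fin n → R, (∀ i j, ∑ l, v i l * w l j = if i = j then 1 else 0) ∧
      ∀ i j, ∑ l, w i l * v l j = if i = j then 1 else 0 := by
  obtain ⟨T, hT⟩ := h'.exists_right hp.transpose hE
  obtain ⟨L, hL⟩ := h.exists_left hq hD
  have h₁ : Matrix.of v * Matrix.of T = 1 := by
    ext i j
    simpa [Matrix.mul_apply, Matrix.one_apply] using hT i j
  have h₂ : Matrix.of L * Matrix.of v = 1 := by
    ext i j
    simpa [Matrix.mul_apply, Matrix.one_apply, eq_comm] using hL i j
  refine ⟨T, hT, fun i j => ?_⟩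
  rw [left_inv_eq_right_inv h₂ h₁] at h₂
  simpa [Matrix.mul_apply, Matrix.one_apply] using congr_fun (congr_fun h₂ i) j

/-- Each family of degree `n` relations gives the one-sided inverse needed to peel words for the
other. The determinants `D` and `E` may differ a priori, as in `H`. -/
theorem isQMat_of_colRel {p q : Fin n → Fin n → k} (hn : 2 ≤ n) (hp : IsMulAntisymm p)
    (hq : IsMulAntisymm q) {v : Fin n → Fin n → R} {D D' E E' : R} (h : ColRel q v D)
    (h' : ColRel (fun i j => p j i) (fun i j => v j i) E) (hD : D' * D = 1) (hE : E' * E = 1) :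
    IsQMat p q v := by
  obtain ⟨T, hT⟩ := h'.exists_left hp.transpose hE
  obtain ⟨L, hL⟩ := h.exists_left hq hD
  exact ⟨h.skewCols hq hn hT, h'.skewCols hp.transpose hn hL⟩

-- A word in `v` times the reversed word in the inverse telescopes to a Kronecker delta. Contracting
-- this with the form, applying the relation for `v` and cancelling `D` gives the relation for the
-- inverse, with the order of factors reversed.
open MulOpposite in
theorem ColRel.op_of_right {q : Fin n → Fin n → k} {v w : Fin n → Fin n → R} {D D' : R}
    (h : ColRel q v D) (hD : D' * D = 1)
    (hw : ∀ i j, ∑ l, v i l * w l j = if i = j then 1 else 0) :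
    ColRel q (fun i j => op (w i j)) (op D') := by
  have key : ∀ m (i j : Fin m → Fin n), ∑ l : Fin m → Fin n,
      word v i l * unop (word (fun i j => op (w i j)) l j) = if i = j then 1 else 0 := by
    intro m
    induction m with
    | zero => intro i j; simp [word_zero, Subsingleton.elim i j]
    | succ m ih =>
      intro i j
      rw [sum_cons]
      simp only [word_succ, Fin.cons_zero, Fin.tail_cons, unop_mul, unop_op, mul_assoc,
        ← Finset.mul_sum]
      simp only [← mul_assoc _ _ (w _ _), ← Finset.sum_mul, ih]
      simp only [eq_iff_head_tail i j, ite_mul, zero_mul, mul_ite, mul_zero]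
      split_ifs with h1 h2 h2 <;> simp_all
  intro j
  apply unop_injective
  simp only [Finset.unop_sum, unop_smul, unop_op]
  have h₂ : ∑ i : Fin n → Fin n, ∑ l : Fin n → Fin n, skewSign q i •
      (word v i l * unop (word (fun i j => op (w i j)) l j)) = skewSign q j • (1 : R) := by
    simp only [← Finset.smul_sum, key]
    simp
  rw [Finset.sum_comm] at h₂
  simp only [← smul_mul_assoc, ← Finset.sum_mul, h _] at h₂
  have := congr_arg (D' * ·) h₂
  simpa [Finset.mul_sum, ← mul_assoc, hD] using this

open MulOpposite in
theorem ColRel.op_of_left {q : Fin n → Fin n → k} {v w : Fin n → Fin n → R} {D D' : R}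
    (h : ColRel q v D) (hD : D * D' = 1)
    (hw : ∀ i j, ∑ l, w l i * v j l = if i = j then 1 else 0) :
    ColRel q (fun i j => op (w i j)) (op D') := by
  have key : ∀ m (i j : Fin m → Fin n), ∑ l : Fin m → Fin n,
      unop (word (fun i j => op (w i j)) l i) * word v j l = if i = j then 1 else 0 := by
    intro m
    induction m with
    | zero => intro i j; simp [word_zero, Subsingleton.elim i j]
    | succ m ih =>
      intro i j
      rw [sum_cons, Finset.sum_comm]
      simp only [word_succ, Fin.cons_zero, Fin.tail_cons, unop_mul, unop_op, mul_assoc,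
        ← Finset.mul_sum]
      simp only [← mul_assoc (w _ _), ← Finset.sum_mul, hw]
      simp only [eq_iff_head_tail i j, ite_mul, one_mul, zero_mul, mul_ite, mul_zero]
      split_ifs with h1 h2 h2 <;> simp_all
  intro j
  apply unop_injective
  simp only [Finset.unop_sum, unop_smul, unop_op]
  have h₂ : ∑ i : Fin n → Fin n, ∑ l : Fin n → Fin n, skewSign q i •
      (unop (word (fun i j => op (w i j)) l j) * word v i l) = skewSign q j • (1 : R) := by
    simp only [← Finset.smul_sum, key]
    simp
  rw [Finset.sum_comm] at h₂
  simp only [← mul_smul_comm, ← Finset.mul_sum, h _] at h₂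
  have := congr_arg (· * D') h₂
  simpa [Finset.sum_mul, mul_assoc, hD] using this

end QuantumMatrices

/-! ### The universal property of `AST` -/

section Universal

variable {k : Type u} [Field k] {n m : ℕ} {R : Type v} [Ring R] [Algebra k R]

/-- A quantum matrix together with an inverse of its quantum determinant. -/
structure IsQGL (p q : Fin n → Fin n → k) (h : DGen n → R) : Prop where
  mat : IsQMat p q fun i j => h (DGen.u i j)
  det : h DGen.D = colDet (formE q) fun i j => h (DGen.u i j)
  mul_inv : h DGen.D * h DGen.DInv = 1
  inv_mul : h DGen.DInv * h DGen.D = 1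

variable {p q : Fin n → Fin n → k} {lam : k}

theorem IsQMat.colDet_eq_rowDet (hP : IsParam p q lam) {v : Fin n → Fin n → R}
    (hv : IsQMat p q v) : colDet (formE q) v = rowDet (formF p) v :=
  QGL.colDet_eq_rowDet hP.p_antisymm hP.q_antisymm hP.rel (hv.antidiagonal hP)

theorem IsQMat.colRel (hP : IsParam p q lam) {v : Fin n → Fin n → R} (hv : IsQMat p q v) :
    ColRel q v (colDet (formE q) v) := hv.cols.colRel hP.q_antisymm

theorem IsQMat.rowRel (hP : IsParam p q lam) {v : Fin n → Fin n → R} (hv : IsQMat p q v) :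
    ColRel (fun i j => p j i) (fun i j => v j i) (colDet (formE q) v) := by
  rw [hv.colDet_eq_rowDet hP]
  exact hv.rows.colRel hP.p_antisymm.transpose

theorem IsQGL.colRel (hP : IsParam p q lam) {h : DGen n → R} (hh : IsQGL p q h) :
    ColRel q (fun i j => h (DGen.u i j)) (h DGen.D) := by
  rw [hh.det]
  exact hh.mat.colRel hP

theorem IsQGL.rowRel (hP : IsParam p q lam) {h : DGen n → R} (hh : IsQGL p q h) :
    ColRel (fun i j => p j i) (fun i j => h (DGen.u j i)) (h DGen.D) := by
  rw [hh.det]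
  exact hh.mat.rowRel hP

theorem IsQGL.of_colRel (hP : IsParam p q lam) {h : DGen n → R} {E E' : R}
    (h₁ : ColRel q (fun i j => h (DGen.u i j)) (h DGen.D))
    (h₂ : ColRel (fun i j => p j i) (fun i j => h (DGen.u j i)) E) (h₃ : h DGen.D * h DGen.DInv = 1)
    (h₄ : h DGen.DInv * h DGen.D = 1) (h₅ : E' * E = 1) : IsQGL p q h :=
  ⟨isQMat_of_colRel hP.two_le hP.p_antisymm hP.q_antisymm h₁ h₂ h₄ h₅, h₁.colDet_eq.symm, h₃, h₄⟩

theorem IsQGL.map {S : Type w} [Ring S] [Algebra k S] {h : DGen n → R} (hh : IsQGL p q h)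
    (φ : R →ₐ[k] S) : IsQGL p q fun d => φ (h d) :=
  ⟨hh.mat.map φ, by rw [hh.det, colDet_map], by rw [← map_mul, hh.mul_inv, map_one],
    by rw [← map_mul, hh.inv_mul, map_one]⟩

theorem AST.isQGL_gen (hP : IsParam p q lam) : IsQGL p q (AST.gen p q lam) := by
  have hrel : ∀ {x y}, ASTRel p q lam x y → RingQuot.mkAlgHom k (ASTRel p q lam) x
      = RingQuot.mkAlgHom k (ASTRel p q lam) y := fun h => RingQuot.mkAlgHom_rel k h
  refine ⟨ASTQuad.isQMat hP ⟨fun i j a b hij hab => ?_, fun i j a b hij hab => ?_,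
    fun i a b hab => ?_⟩, ?_, ?_, ?_⟩
  · simpa [AST.gen, freeU] using hrel (.rel₁ i j a b hij hab)
  · simpa [AST.gen, freeU] using hrel (.rel₂ i j a b hij hab)
  · simpa [AST.gen, freeU] using hrel (.rel₃ i a b hab)
  · have := hrel .col
    rwa [colDet_map] at this
  · simpa [AST.gen, freeU] using hrel .mul_inv
  · simpa [AST.gen, freeU] using hrel .inv_mul

theorem AST.exists_lift (hP : IsParam p q lam) {h : DGen n → R} (hh : IsQGL p q h) :
    ∃ φ : AST p q lam →ₐ[k] R, ∀ d, φ (AST.gen p q lam d) = h d := by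
  have hl : ∀ d, FreeAlgebra.lift k h (FreeAlgebra.ι k d) = h d := fun d => by simp
  have hA := hh.mat.astQuad hP
  have hrel : ∀ ⦃x y⦄, ASTRel p q lam x y → FreeAlgebra.lift k h x = FreeAlgebra.lift k h y := by
    intro x y hxy
    cases hxy with
    | rel₁ i j a b hij hab => simpa using hA.rel₁ i j a b hij hab
    | rel₂ i j a b hij hab => simpa using hA.rel₂ i j a b hij hab
    | rel₃ i a b hab => simpa using hA.rel₃ i a b hab
    | col =>
      rw [colDet_map, hl, hh.det]
      simp
    -- `IsQGL` records only the column formula for `D`; the row formula follows from the comparison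
    -- of determinants.
    | row =>
      rw [rowDet_map, hl, hh.det, hh.mat.colDet_eq_rowDet hP]
      simp
    | mul_inv => simpa using hh.mul_inv
    | inv_mul => simpa using hh.inv_mul
  exact ⟨RingQuot.liftAlgHom k ⟨FreeAlgebra.lift k h, hrel⟩, fun d =>
    (RingQuot.liftAlgHom_mkAlgHom_apply _ _ _ _).trans (hl d)⟩

theorem AST.induction {P : AST p q lam → Prop} (hc : ∀ c, P (algebraMap k _ c))
    (hg : ∀ d, P (AST.gen p q lam d)) (hm : ∀ a b, P a → P b → P (a * b))
    (ha : ∀ a b, P a → P b → P (a + b)) (x : AST p q lam) : P x := by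
  obtain ⟨y, rfl⟩ := RingQuot.mkAlgHom_surjective k (ASTRel p q lam) x
  induction y using FreeAlgebra.induction with
  | grade0 c => simpa using hc c
  | grade1 d => exact hg d
  | mul a b ha hb => rw [map_mul]; exact hm _ _ ha hb
  | add a b ha' hb => rw [map_add]; exact ha _ _ ha' hb

variable {O : Type w} [Ring O] [Algebra k O]

/-- The pair `(O, g)` is a copy of `O_{p,λ}(GL_n)`. -/
def IsGLAlgebra (p q : Fin n → Fin n → k) (lam : k) (g : DGen n → O) : Prop :=
  ∃ ψ : AST p q lam ≃ₐ[k] O, ∀ d, ψ (AST.gen p q lam d) = g d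

variable {g : DGen n → O}

theorem IsGLAlgebra.isQGL (hP : IsParam p q lam) (hg : IsGLAlgebra p q lam g) : IsQGL p q g := by
  obtain ⟨ψ, hψ⟩ := hg
  have := (AST.isQGL_gen hP).map ψ.toAlgHom
  simpa [hψ] using this

theorem IsGLAlgebra.exists_lift (hP : IsParam p q lam) (hg : IsGLAlgebra p q lam g)
    {h : DGen n → R} (hh : IsQGL p q h) : ∃ φ : O →ₐ[k] R, ∀ d, φ (g d) = h d := by
  obtain ⟨ψ, hψ⟩ := hg
  obtain ⟨φ, hφ⟩ := AST.exists_lift hP hh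
  exact ⟨φ.comp ψ.symm, fun d => by simp [← hψ, hφ]⟩

theorem IsGLAlgebra.induction (hg : IsGLAlgebra p q lam g) {P : O → Prop}
    (hc : ∀ c, P (algebraMap k _ c)) (hgen : ∀ d, P (g d)) (hm : ∀ a b, P a → P b → P (a * b))
    (ha : ∀ a b, P a → P b → P (a + b)) (x : O) : P x := by
  obtain ⟨ψ, hψ⟩ := hg
  obtain ⟨y, rfl⟩ := ψ.surjective x
  refine AST.induction (P := fun y => P (ψ y)) (fun c => ?_) (fun d => ?_) (fun a b h h' => ?_)
    (fun a b h h' => ?_) y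
  · simpa using hc c
  · rw [hψ]; exact hgen d
  · rw [map_mul]; exact hm _ _ h h'
  · rw [map_add]; exact ha _ _ h h'

theorem IsGLAlgebra.algHom_ext (hg : IsGLAlgebra p q lam g) {φ ψ : O →ₐ[k] R}
    (h : ∀ d, φ (g d) = ψ (g d)) : φ = ψ := by
  refine AlgHom.ext fun x => ?_
  induction x using hg.induction with
  | hc c => simp
  | hgen d => exact h d
  | hm a b ha hb => rw [map_mul, map_mul, ha, hb]
  | ha a b ha hb => rw [map_add, map_add, ha, hb]

/-- The determinant is a polynomial in the entries, and inverses are unique. -/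
theorem IsGLAlgebra.algHom_ext' (hP : IsParam p q lam) (hg : IsGLAlgebra p q lam g)
    {φ ψ : O →ₐ[k] R} (h : ∀ i j, φ (g (DGen.u i j)) = ψ (g (DGen.u i j))) : φ = ψ := by
  have hQ := hg.isQGL hP
  have hD : φ (g DGen.D) = ψ (g DGen.D) := by
    rw [hQ.det, colDet_map, colDet_map]
    simp only [h]
  refine hg.algHom_ext fun d => ?_
  cases d with
  | u i j => exact h i j
  | D => exact hD
  | DInv =>
    refine left_inv_eq_right_inv (a := φ (g DGen.D)) ?_ ?_
    · rw [← map_mul, hQ.inv_mul, map_one]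
    · rw [hD, ← map_mul, hQ.mul_inv, map_one]

theorem IsGLAlgebra.of_inverse (hP : IsParam p q lam) (hQ : IsQGL p q g)
    (hlift : ∃ φ : O →ₐ[k] AST p q lam, ∀ d, φ (g d) = AST.gen p q lam d)
    (hext : ∀ φ φ' : O →ₐ[k] O, (∀ d, φ (g d) = φ' (g d)) → φ = φ') : IsGLAlgebra p q lam g := by
  obtain ⟨ψ, hψ⟩ := AST.exists_lift hP hQ
  obtain ⟨φ, hφ⟩ := hlift
  have hA : IsGLAlgebra p q lam (AST.gen p q lam) := ⟨AlgEquiv.refl, fun _ => rfl⟩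
  refine ⟨AlgEquiv.ofAlgHom ψ φ (hext _ _ fun d => by simp [hφ, hψ])
    (hA.algHom_ext fun d => by simp [hφ, hψ]), fun d => by simp [hψ]⟩

end Universal

/-! ### Comultiplication, counit and antipode -/

section HopfStructure

variable {k : Type u} [Field k] {n : ℕ}

theorem isQMat_comul {p q : Fin n → Fin n → k} {R : Type v} [Ring R] [Algebra k R]
    (hp : IsMulAntisymm p) (hq : IsMulAntisymm q) {v : Fin n → Fin n → R} (hv : IsQMat p q v) :
    IsQMat p q fun i j => ∑ l, v i l ⊗ₜ[k] v l j := by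
  have := (hv.map (Algebra.TensorProduct.includeLeft : R →ₐ[k] R ⊗[k] R)).mul hp hq
    (hv.map (Algebra.TensorProduct.includeRight : R →ₐ[k] R ⊗[k] R))
    (fun i j i' j' => by simp [Commute, SemiconjBy])
  simpa using this

theorem colRel_comul {q : Fin n → Fin n → k} {R : Type v} [Ring R] [Algebra k R]
    {v : Fin n → Fin n → R} {D : R} (hv : ColRel q v D) :
    ColRel q (fun i j => ∑ l, v i l ⊗ₜ[k] v l j) (D ⊗ₜ[k] D) := by
  have := (hv.map (Algebra.TensorProduct.includeLeft : R →ₐ[k] R ⊗[k] R)).mul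
    (hv.map (Algebra.TensorProduct.includeRight : R →ₐ[k] R ⊗[k] R))
    (fun i j i' j' => by simp [Commute, SemiconjBy])
  simpa using this

/-- The antipode reverses products, so in `S(ab)₁ (ab)₂` the inner factor `S(a₁) a₂` collapses to a
scalar first; dually on the other side it is the factor of `b`. The antipode axioms thus pass from
generators to products. -/
theorem antipode_axiom_mul {A : Type v} [Ring A] [Algebra k A] (φ : A →ₐ[k] Aᵐᵒᵖ) (x y : A ⊗[k] A)
    (c : k) :
    (LinearMap.mul' k A (((MulOpposite.opLinearEquiv k).symm.toLinearMap ∘ₗ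
        φ.toLinearMap).rTensor A x) = algebraMap k A c →
      LinearMap.mul' k A (((MulOpposite.opLinearEquiv k).symm.toLinearMap ∘ₗ
        φ.toLinearMap).rTensor A (x * y)) = c • LinearMap.mul' k A
          (((MulOpposite.opLinearEquiv k).symm.toLinearMap ∘ₗ φ.toLinearMap).rTensor A y)) ∧
    (LinearMap.mul' k A (((MulOpposite.opLinearEquiv k).symm.toLinearMap ∘ₗ
        φ.toLinearMap).lTensor A y) = algebraMap k A c →
      LinearMap.mul' k A (((MulOpposite.opLinearEquiv k).symm.toLinearMap ∘ₗ
        φ.toLinearMap).lTensor A (x * y)) = c • LinearMap.mul' k A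
          (((MulOpposite.opLinearEquiv k).symm.toLinearMap ∘ₗ φ.toLinearMap).lTensor A x)) := by
  constructor
  · intro hx
    induction y using TensorProduct.induction_on with
    | zero => simp
    | add y z hy hz => rw [mul_add, map_add, map_add, hy, hz, map_add, map_add, smul_add]
    | tmul r s =>
      have : ∀ x : A ⊗[k] A, LinearMap.mul' k A (((MulOpposite.opLinearEquiv k).symm.toLinearMap ∘ₗ
          φ.toLinearMap).rTensor A (x * (r ⊗ₜ s))) = (φ r).unop * LinearMap.mul' k A
          (((MulOpposite.opLinearEquiv k).symm.toLinearMap ∘ₗ φ.toLinearMap).rTensor A x) * s := by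
        intro x
        induction x using TensorProduct.induction_on with
        | zero => simp
        | add y z hy hz => rw [add_mul, map_add, map_add, hy, hz, map_add, map_add, mul_add, add_mul]
        | tmul a b => simp [mul_assoc]
      rw [this, hx, ← Algebra.commutes, mul_assoc, ← Algebra.smul_def]
      simp
  · intro hy
    induction x using TensorProduct.induction_on with
    | zero => simp
    | add x z hx hz => rw [add_mul, map_add, map_add, hx, hz, map_add, map_add, smul_add]
    | tmul r s =>
      have : ∀ y : A ⊗[k] A, LinearMap.mul' k A (((MulOpposite.opLinearEquiv k).symm.toLinearMap ∘ₗ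
          φ.toLinearMap).lTensor A ((r ⊗ₜ s) * y)) = r * LinearMap.mul' k A
          (((MulOpposite.opLinearEquiv k).symm.toLinearMap ∘ₗ φ.toLinearMap).lTensor A y)
            * (φ s).unop := by
        intro y
        induction y using TensorProduct.induction_on with
        | zero => simp
        | add y z hy hz => rw [mul_add, map_add, map_add, hy, hz, map_add, map_add, mul_add, add_mul]
        | tmul a b => simp [mul_assoc]
      rw [this, hy, ← Algebra.commutes, mul_assoc, ← Algebra.smul_def]
      simp

/-- Matrix coalgebra structure on the `u_ij`, with `D` and `D⁻¹` grouplike. -/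
structure IsGLCoalgebra {O : Type v} [Ring O] [Algebra k O] (S : BialgebraData k O)
    (g : DGen n → O) : Prop where
  comul_u : ∀ i j, S.comul (g (DGen.u i j)) = ∑ l, g (DGen.u i l) ⊗ₜ[k] g (DGen.u l j)
  counit_u : ∀ i j, S.counit (g (DGen.u i j)) = if i = j then 1 else 0
  comul_D : S.comul (g DGen.D) = g DGen.D ⊗ₜ[k] g DGen.D
  counit_D : S.counit (g DGen.D) = 1
  comul_DInv : S.comul (g DGen.DInv) = g DGen.DInv ⊗ₜ[k] g DGen.DInv
  counit_DInv : S.counit (g DGen.DInv) = 1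

variable {p q : Fin n → Fin n → k} {lam : k} {O : Type v} [Ring O] [Algebra k O] {g : DGen n → O}

theorem IsGLAlgebra.exists_bialgebraData (hP : IsParam p q lam) (hg : IsGLAlgebra p q lam g) :
    ∃ S : BialgebraData k O, IsGLCoalgebra S g := by
  have hQ := hg.isQGL hP
  obtain ⟨Δ, hΔ⟩ := hg.exists_lift hP (R := O ⊗[k] O) (h := fun d => match d with
    | DGen.u i j => ∑ l, g (DGen.u i l) ⊗ₜ[k] g (DGen.u l j)
    | DGen.D => g DGen.D ⊗ₜ[k] g DGen.D
    | DGen.DInv => g DGen.DInv ⊗ₜ[k] g DGen.DInv)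
    ⟨isQMat_comul hP.p_antisymm hP.q_antisymm hQ.mat, (colRel_comul (hQ.colRel hP)).colDet_eq.symm,
      by simp [hQ.mul_inv, Algebra.TensorProduct.one_def],
      by simp [hQ.inv_mul, Algebra.TensorProduct.one_def]⟩
  obtain ⟨ε, hε⟩ := hg.exists_lift hP (R := k) (h := fun d => match d with
    | DGen.u i j => if i = j then 1 else 0
    | DGen.D => 1
    | DGen.DInv => 1)
    ⟨isQMat_one hP.p_antisymm hP.q_antisymm, (colRel_one q).colDet_eq.symm, by simp, by simp⟩
  have h₁ : ∀ i j, Δ (g (DGen.u i j)) = ∑ l, g (DGen.u i l) ⊗ₜ[k] g (DGen.u l j) :=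
    fun i j => hΔ (DGen.u i j)
  have h₂ : ∀ i j, ε (g (DGen.u i j)) = if i = j then 1 else 0 := fun i j => hε (DGen.u i j)
  refine ⟨⟨Δ, ε, hg.algHom_ext' hP fun i j => ?_, hg.algHom_ext' hP fun i j => ?_,
    hg.algHom_ext' hP fun i j => ?_⟩, h₁, h₂, hΔ DGen.D, hε DGen.D, hΔ DGen.DInv, hε DGen.DInv⟩
  · simp only [AlgHom.comp_apply, h₁, map_sum, Algebra.TensorProduct.map_tmul, AlgHom.id_apply,
      TensorProduct.sum_tmul, TensorProduct.tmul_sum]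
    exact Finset.sum_comm
  · simp [h₁, h₂, TensorProduct.ite_tmul]
  · simp [h₁, h₂, TensorProduct.tmul_ite]

/-- The inverse matrix, with the determinant and its inverse exchanged, satisfies the defining
relations in the opposite algebra. The universal property makes it an algebra map to `Oᵐᵒᵖ`, the
antipode. -/
theorem IsGLAlgebra.exists_hopfData (hP : IsParam p q lam) (hg : IsGLAlgebra p q lam g) :
    ∃ S : HopfData k O, IsGLCoalgebra S.toBialgebraData g := by
  obtain ⟨S, hS⟩ := hg.exists_bialgebraData hP
  have hQ := hg.isQGL hP
  obtain ⟨w, hw₁, hw₂⟩ := (hQ.colRel hP).exists_inverse hP.p_antisymm hP.q_antisymm (hQ.rowRel hP)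
    hQ.inv_mul hQ.mul_inv
  have hE := (hQ.colRel hP).op_of_right hQ.inv_mul hw₁
  have hF := (hQ.rowRel hP).op_of_left (w := fun i j => w j i) hQ.mul_inv
    hw₂
  obtain ⟨φ, hφ⟩ := hg.exists_lift hP (R := Oᵐᵒᵖ) (h := fun d => match d with
    | DGen.u i j => MulOpposite.op (w i j)
    | DGen.D => MulOpposite.op (g DGen.DInv)
    | DGen.DInv => MulOpposite.op (g DGen.D))
    (.of_colRel hP hE hF (by rw [← MulOpposite.op_mul, hQ.mul_inv, MulOpposite.op_one])
      (by rw [← MulOpposite.op_mul, hQ.inv_mul, MulOpposite.op_one])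
      (E' := MulOpposite.op (g DGen.D))
      (by rw [← MulOpposite.op_mul, hQ.inv_mul, MulOpposite.op_one]))
  refine ⟨{ S with
    antipode := (MulOpposite.opLinearEquiv k).symm.toLinearMap ∘ₗ φ.toLinearMap
    antipode_left := LinearMap.ext fun x => ?_
    antipode_right := LinearMap.ext fun x => ?_ }, hS⟩
  · induction x using hg.induction with
    | hc c => simp
    | ha a b ha hb => rw [map_add, map_add, ha, hb]
    | hgen d =>
      cases d with
      | u i j => simp [hS.comul_u, hS.counit_u, hφ, hw₂]
      | D => simp [hS.comul_D, hS.counit_D, hφ, hQ.inv_mul]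
      | DInv => simp [hS.comul_DInv, hS.counit_DInv, hφ, hQ.mul_inv]
    | hm a b ha hb =>
      simp only [LinearMap.comp_apply, AlgHom.toLinearMap_apply, map_mul,
        Algebra.linearMap_apply] at *
      rw [(antipode_axiom_mul φ _ _ (S.counit a)).1 ha, hb, Algebra.smul_def]
  · induction x using hg.induction with
    | hc c => simp
    | ha a b ha hb => rw [map_add, map_add, ha, hb]
    | hgen d =>
      cases d with
      | u i j => simp [hS.comul_u, hS.counit_u, hφ, hw₁]
      | D => simp [hS.comul_D, hS.counit_D, hφ, hQ.mul_inv]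
      | DInv => simp [hS.comul_DInv, hS.counit_DInv, hφ, hQ.inv_mul]
    | hm a b ha hb =>
      simp only [LinearMap.comp_apply, AlgHom.toLinearMap_apply, map_mul,
        Algebra.linearMap_apply] at *
      rw [(antipode_axiom_mul φ _ _ (S.counit b)).2 hb, ha, Algebra.smul_def, Algebra.commutes]

end HopfStructure

/-! ### Ore conditions from an automorphism implemented by `D²` -/

section OreSets

variable {R : Type v} [Ring R] {D : R} {σ σ' : R →+* R}

/-- Moving `D * D` across an element applies `σ` or its inverse `σ'`. Both fix `D`, so left and
right equality after multiplication by `D * D` are equivalent; `D` need not be a nonzerodivisor. -/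
theorem exists_oreSet_aux (h : ∀ r, D * D * r = σ r * (D * D)) (h₁ : ∀ r, σ (σ' r) = r)
    (h₂ : ∀ r, σ' (σ r) = r) (hD : σ D = D) (a : ℕ) :
    (∀ r, ∃ r', (D * D) ^ a * r = r' * (D * D) ^ a) ∧
    (∀ r, ∃ r', r * (D * D) ^ a = (D * D) ^ a * r') ∧
    (∀ r₁ r₂, r₁ * (D * D) ^ a = r₂ * (D * D) ^ a ↔ (D * D) ^ a * r₁ = (D * D) ^ a * r₂) := by
  have hN : ∀ r, D * D * σ' r = r * (D * D) := fun r => by rw [h, h₁]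
  have hD' : σ' D = D := by rw [← hD, h₂, hD]
  have hc : ∀ r₁ r₂, r₁ * (D * D) = r₂ * (D * D) ↔ D * D * r₁ = D * D * r₂ := by
    refine fun r₁ r₂ => ⟨fun e => ?_, fun e => ?_⟩
    · rw [← hN, ← hN] at e
      simpa [h₁, hD] using congr_arg σ e
    · rw [h, h] at e
      simpa [h₂, hD'] using congr_arg σ' e
  induction a with
  | zero => exact ⟨fun r => ⟨r, by simp⟩, fun r => ⟨r, by simp⟩, fun r₁ r₂ => by simp⟩
  | succ a ih =>
    obtain ⟨ih₁, ih₂, ih₃⟩ := ih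
    refine ⟨fun r => ?_, fun r => ?_, fun r₁ r₂ => ?_⟩
    · obtain ⟨r', hr'⟩ := ih₁ (σ r)
      exact ⟨r', by rw [pow_succ, mul_assoc, h, ← mul_assoc, hr', mul_assoc]⟩
    · obtain ⟨r', hr'⟩ := ih₂ r
      exact ⟨σ' r', by rw [pow_succ, ← mul_assoc, hr', mul_assoc, mul_assoc, hN]⟩
    · rw [pow_succ, ← mul_assoc r₁, ← mul_assoc r₂, hc, ← mul_assoc, ← mul_assoc, ih₃,
        mul_assoc (_ ^ a), mul_assoc (_ ^ a)]

theorem pow_mem_powers_of_sq (D : R) (a : ℕ) : (D * D) ^ a ∈ Submonoid.powers D :=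
  ⟨2 * a, by simp only [pow_mul, sq]⟩

theorem exists_oreSet (h : ∀ r, D * D * r = σ r * (D * D)) (h₁ : ∀ r, σ (σ' r) = r)
    (h₂ : ∀ r, σ' (σ r) = r) (hD : σ D = D) :
    Nonempty (OreLocalization.OreSet (Submonoid.powers D)) ∧
    Nonempty (OreLocalization.OreSet (Submonoid.powers D).op) := by
  have hpow : ∀ a : ℕ, (D * D) ^ a = D ^ a * D ^ a := fun a => (Commute.refl D).mul_pow a
  constructor
  · have key : ∀ (r : R) (s : Submonoid.powers D), ∃ (r' : R) (s' : Submonoid.powers D),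
        s' * r = r' * s := by
      rintro r ⟨_, a, rfl⟩
      obtain ⟨r', hr'⟩ := (exists_oreSet_aux h h₁ h₂ hD a).1 r
      -- To meet the denominator `D ^ a`, its square is used: half of `(D * D) ^ a` goes into the
      -- numerator.
      refine ⟨r' * D ^ a, ⟨(D * D) ^ a, pow_mem_powers_of_sq D a⟩, ?_⟩
      simp only [hr']
      rw [hpow, mul_assoc]
    choose num den hnd using key
    refine ⟨⟨?_, num, den, hnd⟩⟩
    rintro r₁ r₂ ⟨_, a, rfl⟩ e
    refine ⟨⟨(D * D) ^ a, pow_mem_powers_of_sq D a⟩,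
      ((exists_oreSet_aux h h₁ h₂ hD a).2.2 r₁ r₂).1 ?_⟩
    rw [hpow, ← mul_assoc, ← mul_assoc]
    exact congr_arg (· * D ^ a) e
  · have key : ∀ (r : Rᵐᵒᵖ) (s : (Submonoid.powers D).op),
        ∃ (r' : Rᵐᵒᵖ) (s' : (Submonoid.powers D).op), s' * r = r' * s := by
      rintro r ⟨s, a, hs⟩
      obtain ⟨r', hr'⟩ := (exists_oreSet_aux h h₁ h₂ hD a).2.1 r.unop
      refine ⟨MulOpposite.op (D ^ a * r'), ⟨MulOpposite.op ((D * D) ^ a),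
        pow_mem_powers_of_sq D a⟩, MulOpposite.unop_injective ?_⟩
      simp only [MulOpposite.unop_mul, MulOpposite.unop_op, hr', ← hs]
      rw [hpow, mul_assoc]
    choose num den hnd using key
    refine ⟨⟨?_, num, den, hnd⟩⟩
    rintro r₁ r₂ ⟨s, a, hs⟩ e
    refine ⟨⟨MulOpposite.op ((D * D) ^ a), pow_mem_powers_of_sq D a⟩,
      MulOpposite.unop_injective
        (((exists_oreSet_aux h h₁ h₂ hD a).2.2 r₁.unop r₂.unop).2 ?_)⟩
    have e' : D ^ a * r₁.unop = D ^ a * r₂.unop := by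
      simpa [← hs] using congr_arg MulOpposite.unop e
    rw [hpow, mul_assoc, mul_assoc, e']

end OreSets

/-! ### The bialgebra `OM` and its Ore set -/

section Matrices

variable {k : Type u} [Field k] {n : ℕ} {R : Type v} [Ring R] [Algebra k R]
  {p q : Fin n → Fin n → k} {lam : k}

theorem OM.isQMat (hP : IsParam p q lam) : IsQMat p q (OM.z (formE q) (formF p) 2) := by
  have hw : ∀ i j : Fin 2 → Fin n, RingQuot.mkAlgHom k (MRel (formE q) (formF p) 2)
      (word (fun a b => FreeAlgebra.ι k (a, b)) i j) = word (OM.z (formE q) (formF p) 2) i j :=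
    fun i j => word_map _ _ _ _
  refine ⟨(perpRel_iff hP.q_antisymm hP.two_le).1 fun l μ hμ => ?_,
    (perpRel_iff hP.p_antisymm.transpose hP.two_le).1 fun l μ hμ => ?_⟩
  · have := RingQuot.mkAlgHom_rel k (MRel.relE (e := formE q) (f := formF p) l μ hμ)
    simpa [hw] using this
  · have := RingQuot.mkAlgHom_rel k (MRel.relF (e := formE q) (f := formF p) l μ hμ)
    simp only [map_sum, map_smul, hw, map_zero] at this
    rw [Finset.sum_comm]
    exact this

theorem OM.exists_lift (hP : IsParam p q lam) {v : Fin n → Fin n → R} (hv : IsQMat p q v) :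
    ∃ φ : OM (formE q) (formF p) 2 →ₐ[k] R, ∀ i j, φ (OM.z (formE q) (formF p) 2 i j) = v i j := by
  have hl : ∀ d, FreeAlgebra.lift k (fun d : Fin n × Fin n => v d.1 d.2) (FreeAlgebra.ι k d)
      = v d.1 d.2 := fun d => by simp
  have hrel : ∀ ⦃x y⦄, MRel (formE q) (formF p) 2 x y →
      FreeAlgebra.lift k (fun d : Fin n × Fin n => v d.1 d.2) x
        = FreeAlgebra.lift k (fun d : Fin n × Fin n => v d.1 d.2) y := by
    intro x y hxy
    cases hxy with
    | relE l μ hμ =>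
      have := (perpRel_iff hP.q_antisymm hP.two_le).2 hv.cols l μ hμ
      simpa [word_map] using this
    | relF l μ hμ =>
      have := (perpRel_iff hP.p_antisymm.transpose hP.two_le).2 hv.rows l μ hμ
      rw [Finset.sum_comm] at this
      simp only [map_sum, map_smul, word_map, map_zero, hl]
      exact this
  exact ⟨RingQuot.liftAlgHom k ⟨_, hrel⟩, fun i j =>
    (RingQuot.liftAlgHom_mkAlgHom_apply _ _ _ _).trans (hl (i, j))⟩

theorem OM.algHom_ext {e f : Form k n n} {φ ψ : OM e f 2 →ₐ[k] R}
    (h : ∀ i j, φ (OM.z e f 2 i j) = ψ (OM.z e f 2 i j)) : φ = ψ := by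
  refine RingQuot.ringQuot_ext' _ _ _ ?_
  ext ⟨i, j⟩
  exact h i j

theorem OM.induction {e f : Form k n n} {P : OM e f 2 → Prop} (hc : ∀ c, P (algebraMap k _ c))
    (hg : ∀ i j, P (OM.z e f 2 i j)) (hm : ∀ a b, P a → P b → P (a * b))
    (ha : ∀ a b, P a → P b → P (a + b)) (x : OM e f 2) : P x := by
  obtain ⟨y, rfl⟩ := RingQuot.mkAlgHom_surjective k (MRel e f 2) x
  induction y using FreeAlgebra.induction with
  | grade0 c => simpa using hc c
  | grade1 d => exact hg d.1 d.2
  | mul a b ha hb => rw [map_mul]; exact hm _ _ ha hb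
  | add a b ha' hb => rw [map_add]; exact ha _ _ ha' hb

theorem OM.exists_bialgebraData (hP : IsParam p q lam) :
    ∃ S : BialgebraData k (OM (formE q) (formF p) 2), ∀ i j,
      S.comul (OM.z (formE q) (formF p) 2 i j) = ∑ l, OM.z (formE q) (formF p) 2 i l ⊗ₜ[k]
        OM.z (formE q) (formF p) 2 l j ∧
      S.counit (OM.z (formE q) (formF p) 2 i j) = if i = j then 1 else 0 := by
  obtain ⟨Δ, h₁⟩ := OM.exists_lift hP (isQMat_comul hP.p_antisymm hP.q_antisymm (OM.isQMat hP))
  obtain ⟨ε, h₂⟩ := OM.exists_lift hP (R := k) (isQMat_one hP.p_antisymm hP.q_antisymm)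
  refine ⟨⟨Δ, ε, OM.algHom_ext fun i j => ?_, OM.algHom_ext fun i j => ?_,
    OM.algHom_ext fun i j => ?_⟩, fun i j => ⟨h₁ i j, h₂ i j⟩⟩
  · simp only [AlgHom.comp_apply, h₁, map_sum, Algebra.TensorProduct.map_tmul, AlgHom.id_apply,
      TensorProduct.sum_tmul, TensorProduct.tmul_sum]
    exact Finset.sum_comm
  · simp [h₁, h₂, TensorProduct.ite_tmul]
  · simp [h₁, h₂, TensorProduct.tmul_ite]

/-- By `ColRel.normal`, conjugation by `D²` multiplies the entries by ratios `t i / t j` of twists.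
The rescaling `σ` extends this to all of `OM`, and the opposite ratios give `σ'`. -/
theorem OM.exists_oreSet (hP : IsParam p q lam) :
    Nonempty (OreLocalization.OreSet (OM.powersD (formE q) (formF p))) ∧
    Nonempty (OreLocalization.OreSet (OM.powersD (formE q) (formF p)).op) := by
  have hz := OM.isQMat hP
  set z := OM.z (formE q) (formF p) 2 with hzdef
  set D := colDet (formE q) z with hDdef
  set t : Fin n → k := fun l => twist (fun i j => p j i) l / twist q l with ht
  have ht0 : ∀ l, t l ≠ 0 := fun l =>
    div_ne_zero (twist_ne_zero hP.p_antisymm.transpose l) (twist_ne_zero hP.q_antisymm l)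
  have hN : ∀ l j, D * D * z l j = (t l * (t j)⁻¹) • (z l j * (D * D)) := fun l j => by
    have := (hz.colRel hP).normal hP.p_antisymm.transpose hP.q_antisymm (hz.rowRel hP) l j
    rw [mul_comm (t l), mul_smul, this, smul_smul, inv_mul_cancel₀ (ht0 j), one_smul]
  obtain ⟨σ, hσ⟩ : ∃ σ : OM (formE q) (formF p) 2 →ₐ[k] OM (formE q) (formF p) 2,
      ∀ i j, σ (z i j) = (t i * (t j)⁻¹) • z i j :=
    OM.exists_lift hP (hz.scale t fun j => (t j)⁻¹)
  obtain ⟨σ', hσ'⟩ : ∃ σ : OM (formE q) (formF p) 2 →ₐ[k] OM (formE q) (formF p) 2,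
      ∀ i j, σ (z i j) = ((t i)⁻¹ * t j) • z i j :=
    OM.exists_lift hP (hz.scale (fun j => (t j)⁻¹) t)
  have h₁ : σ.comp σ' = AlgHom.id k _ := OM.algHom_ext fun i j => by
    simp only [← hzdef, AlgHom.comp_apply, hσ', map_smul, hσ, smul_smul, AlgHom.id_apply]
    rw [show (t i)⁻¹ * t j * (t i * (t j)⁻¹) = 1 by field_simp [ht0 i, ht0 j], one_smul]
  have h₂ : σ'.comp σ = AlgHom.id k _ := OM.algHom_ext fun i j => by
    simp only [← hzdef, AlgHom.comp_apply, hσ', map_smul, hσ, smul_smul, AlgHom.id_apply]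
    rw [show t i * (t j)⁻¹ * ((t i)⁻¹ * t j) = 1 by field_simp [ht0 i, ht0 j], one_smul]
  refine QGL.exists_oreSet (D := D) (σ := σ.toRingHom) (σ' := σ'.toRingHom) (fun r => ?_)
    (DFunLike.congr_fun h₁) (DFunLike.congr_fun h₂) ?_
  · induction r using OM.induction with
    | hc c => simp [Algebra.commutes]
    | hg i j =>
      rw [← hzdef, hN, ← smul_mul_assoc]
      exact congr_arg (· * (D * D)) (hσ i j).symm
    | hm a b ha hb => rw [← mul_assoc, ha, mul_assoc, hb, map_mul, mul_assoc]
    | ha a b ha hb => rw [mul_add, ha, hb, map_add, add_mul]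
  -- Each row and each column occurs once in every determinant monomial, so the factors `t i` and
  -- `(t j)⁻¹` cancel in total.
  · have : σ D = D := by
      rw [hDdef, colDet_map]
      simp only [hσ]
      rw [colDet_scale, Finset.prod_inv_distrib,
        mul_inv_cancel₀ (Finset.prod_ne_zero_iff.2 fun i _ => ht0 i), one_smul]
    exact this

end Matrices

/-! ### The localized bialgebra as a copy of `AST` -/

section Localization

variable {k : Type u} [Field k]

/-- The localization homomorphism. -/
def oreHom (k : Type u) [Field k] {R : Type v} [Ring R] [Algebra k R] (S : Submonoid R)
    [OreLocalization.OreSet S] : R →ₐ[k] OreLocalization S R :=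
  { OreLocalization.numeratorRingHom with commutes' := fun _ => rfl }

section Ore

variable {R : Type v} [Ring R] [Algebra k R] {S : Submonoid R} [OreLocalization.OreSet S]
  {T : Type w} [Ring T] [Algebra k T]

theorem oreHom_ext {φ φ' : OreLocalization S R →ₐ[k] T}
    (h : φ.comp (oreHom k S) = φ'.comp (oreHom k S)) : φ = φ' := by
  have hu : ∀ s : S, IsUnit ((φ.comp (oreHom k S)).toRingHom s) := fun s =>
    (OreLocalization.numerator_isUnit s).map φ.toRingHom
  have e₁ := OreLocalization.universalHom_unique (φ.comp (oreHom k S)).toRingHom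
    (IsUnit.liftRight ((φ.comp (oreHom k S)).toRingHom.toMonoidHom.comp S.subtype) hu)
    (fun s => rfl) φ.toRingHom (fun r => rfl)
  have e₂ := OreLocalization.universalHom_unique (φ.comp (oreHom k S)).toRingHom
    (IsUnit.liftRight ((φ.comp (oreHom k S)).toRingHom.toMonoidHom.comp S.subtype) hu)
    (fun s => rfl) φ'.toRingHom (fun r => (DFunLike.congr_fun h r).symm)
  ext x
  exact DFunLike.congr_fun (e₁.trans e₂.symm) x

theorem exists_oreLift (φ : R →ₐ[k] T) (hu : ∀ s : S, IsUnit (φ s)) :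
    ∃ ψ : OreLocalization S R →ₐ[k] T, ∀ r, ψ (oreHom k S r) = φ r := by
  let Φ := OreLocalization.universalHom φ.toRingHom
    (IsUnit.liftRight (φ.toRingHom.toMonoidHom.comp S.subtype) hu) (fun s => rfl)
  have hΦ : ∀ r, Φ (OreLocalization.numeratorHom r) = φ r := fun r =>
    OreLocalization.universalHom_commutes _ _ _
  exact ⟨{ Φ with commutes' := fun c => (hΦ _).trans (φ.commutes c) }, hΦ⟩

end Ore

/-- The entries of a matrix `z`, its column determinant `D` and the inverse of `D` in the
localization at the powers of `D`. -/
def oreGen {n : ℕ} {R : Type v} [Ring R] [Algebra k R] (e : Form k n n) (z : Fin n → Fin n → R)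
    [OreLocalization.OreSet (Submonoid.powers (colDet e z))] :
    DGen n → OreLocalization (Submonoid.powers (colDet e z)) R
  | DGen.u i j => OreLocalization.numeratorHom (z i j)
  | DGen.D => OreLocalization.numeratorHom (colDet e z)
  | DGen.DInv => ↑(OreLocalization.numeratorUnit
      (⟨colDet e z, Submonoid.mem_powers _⟩ : Submonoid.powers (colDet e z)))⁻¹

variable {n : ℕ} {p q : Fin n → Fin n → k} {lam : k}

theorem IsQMat.isQGL_oreGen {R : Type v} [Ring R] [Algebra k R] {z : Fin n → Fin n → R}
    [OreLocalization.OreSet (Submonoid.powers (colDet (formE q) z))] (hz : IsQMat p q z) :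
    IsQGL p q (oreGen (formE q) z) where
  mat := IsQMat.map (S := OreLocalization (Submonoid.powers (colDet (formE q) z)) R) hz
    (oreHom k (Submonoid.powers (colDet (formE q) z)))
  det := colDet_map (oreHom k (Submonoid.powers (colDet (formE q) z))) (formE q) z
  mul_inv := (OreLocalization.numeratorUnit (⟨_, Submonoid.mem_powers _⟩ :
    Submonoid.powers (colDet (formE q) z))).mul_inv
  inv_mul := (OreLocalization.numeratorUnit (⟨_, Submonoid.mem_powers _⟩ :
    Submonoid.powers (colDet (formE q) z))).inv_mul

/-- If `R` is universal for quantum matrices, localizing at the determinant makes it universal for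
those with an inverse determinant. The inverse map exists because `D` is already a unit in `AST`. -/
theorem isGLAlgebra_oreGen (hP : IsParam p q lam) {R : Type u} [Ring R] [Algebra k R]
    {z : Fin n → Fin n → R} [OreLocalization.OreSet (Submonoid.powers (colDet (formE q) z))]
    (hz : IsQMat p q z)
    (hlift : ∀ (v : Fin n → Fin n → AST p q lam), IsQMat p q v →
      ∃ φ : R →ₐ[k] AST p q lam, ∀ i j, φ (z i j) = v i j)
    (hext : ∀ {T : Type u} [Ring T] [Algebra k T] (φ ψ : R →ₐ[k] T),
      (∀ i j, φ (z i j) = ψ (z i j)) → φ = ψ) :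
    IsGLAlgebra p q lam (oreGen (formE q) z) := by
  refine .of_inverse hP hz.isQGL_oreGen ?_ fun φ φ' h =>
    oreHom_ext (hext _ _ fun i j => h (DGen.u i j))
  have hA := AST.isQGL_gen hP
  obtain ⟨φ, hφ⟩ := hlift _ hA.mat
  have hφD : φ (colDet (formE q) z) = AST.gen p q lam DGen.D := by
    rw [colDet_map, hA.det]
    simp only [hφ]
  have hu : ∀ s : Submonoid.powers (colDet (formE q) z), IsUnit (φ s) := by
    rintro ⟨_, a, rfl⟩
    simpa [hφD] using (show IsUnit (AST.gen p q lam DGen.D) from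
      ⟨⟨_, _, hA.mul_inv, hA.inv_mul⟩, rfl⟩).pow a
  obtain ⟨ψ, hψ⟩ := exists_oreLift φ hu
  refine ⟨ψ, fun d => ?_⟩
  cases d with
  | u i j => exact (hψ _).trans (hφ i j)
  | D => exact (hψ _).trans hφD
  | DInv =>
    refine left_inv_eq_right_inv (a := AST.gen p q lam DGen.D) ?_ hA.mul_inv
    rw [← hφD, ← hψ, ← map_mul]
    exact (congr_arg ψ (Units.inv_mul _)).trans (map_one ψ)

theorem OM.isGLAlgebra_oreGen (hP : IsParam p q lam)
    [OreLocalization.OreSet (OM.powersD (formE q) (formF p))] :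
    IsGLAlgebra p q lam (oreGen (formE q) (OM.z (formE q) (formF p) 2)) :=
  QGL.isGLAlgebra_oreGen hP (OM.isQMat hP) (fun _ hv => OM.exists_lift hP hv)
    fun _ _ h => OM.algHom_ext h

end Localization

section GroupLike

variable {k : Type u} [Field k] {n : ℕ} {O : Type v} [Ring O] [Algebra k O] {g : DGen n → O}
  {S : HopfData k O}

theorem IsGLCoalgebra.isMatrixCoalgebra (hS : IsGLCoalgebra S.toBialgebraData g) :
    letI := S.hopfAlgebra
    IsMatrixCoalgebra k fun i j => g (DGen.u i j) :=
  fun i j => ⟨hS.comul_u i j, hS.counit_u i j⟩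

theorem IsGLCoalgebra.isGroupLikeElem_D (hS : IsGLCoalgebra S.toBialgebraData g) :
    letI := S.hopfAlgebra
    IsGroupLikeElem k (g DGen.D) :=
  let := S.hopfAlgebra
  ⟨hS.counit_D, hS.comul_D⟩

theorem IsGLCoalgebra.isGroupLikeElem_DInv (hS : IsGLCoalgebra S.toBialgebraData g) :
    letI := S.hopfAlgebra
    IsGroupLikeElem k (g DGen.DInv) :=
  let := S.hopfAlgebra
  ⟨hS.counit_DInv, hS.comul_DInv⟩

end GroupLike

/-! ### The algebras `H` and `G` -/

section HG

variable {k : Type u} [Field k] {n : ℕ} {p q : Fin n → Fin n → k} {lam : k}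

/-- The generators `u_ij` and `D_e^{±1}` of `H(e, f)`. -/
def H.dgen (e f : Form k n n) : DGen n → H e f
  | DGen.u i j => H.gen e f (HGen.u i j)
  | DGen.D => H.gen e f HGen.De
  | DGen.DInv => H.gen e f HGen.DeInv

theorem H.colRel (f : Form k n n) :
    ColRel q (H.u (formE q) f) (H.gen (formE q) f HGen.De) := by
  intro j
  have := RingQuot.mkAlgHom_rel k (HRel.relE (e := formE q) (f := f) j)
  simp only [map_sum, map_smul, word_map, coeff_formE] at this
  exact this

theorem H.rowRel (e : Form k n n) :
    ColRel (fun i j => p j i) (fun i j => H.u e (formF p) j i) (H.gen e (formF p) HGen.DfInv) := by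
  intro j
  have := RingQuot.mkAlgHom_rel k (HRel.relF (e := e) (f := formF p) j)
  simp only [map_sum, map_smul, word_map] at this
  simp only [← coeff_formE]
  exact this

theorem H.De_mul_DeInv (e f : Form k n n) : H.gen e f HGen.De * H.gen e f HGen.DeInv = 1 := by
  simpa [H.gen] using RingQuot.mkAlgHom_rel k (HRel.De_mul_inv (e := e) (f := f))

theorem H.DeInv_mul_De (e f : Form k n n) : H.gen e f HGen.DeInv * H.gen e f HGen.De = 1 := by
  simpa [H.gen] using RingQuot.mkAlgHom_rel k (HRel.De_inv_mul (e := e) (f := f))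

theorem H.Df_mul_DfInv (e f : Form k n n) : H.gen e f HGen.Df * H.gen e f HGen.DfInv = 1 := by
  simpa [H.gen] using RingQuot.mkAlgHom_rel k (HRel.Df_mul_inv (e := e) (f := f))

theorem H.isQGL_dgen (hP : IsParam p q lam) : IsQGL p q (H.dgen (formE q) (formF p)) :=
  .of_colRel hP (H.colRel _) (H.rowRel _) (H.De_mul_DeInv _ _) (H.DeInv_mul_De _ _)
    (H.Df_mul_DfInv _ _)

/-- Invertibility of `D_e` and `D_f` makes the generators a quantum matrix, so its row determinant
`D_f⁻¹` equals its column determinant `D_e`. -/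
theorem H.DfInv_eq (hP : IsParam p q lam) :
    H.gen (formE q) (formF p) HGen.DfInv = H.gen (formE q) (formF p) HGen.De := by
  rw [← (H.rowRel (p := p) (formE q)).colDet_eq]
  exact ((H.isQGL_dgen hP).rowRel hP).colDet_eq

theorem H.Df_eq (hP : IsParam p q lam) :
    H.gen (formE q) (formF p) HGen.Df = H.gen (formE q) (formF p) HGen.DeInv := by
  refine left_inv_eq_right_inv (H.Df_mul_DfInv _ _) ?_
  rw [H.DfInv_eq hP, H.De_mul_DeInv]

theorem H.isGLAlgebra_dgen (hP : IsParam p q lam) :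
    IsGLAlgebra p q lam (H.dgen (formE q) (formF p)) := by
  refine .of_inverse hP (H.isQGL_dgen hP) ?_ fun φ φ' h => ?_
  · have hA := AST.isQGL_gen hP
    -- The row relation has `D_f⁻¹` on its right side, so `D_f⁻¹` goes to `D` and `D_f` to `D⁻¹`.
    let v : HGen n → AST p q lam
      | HGen.u i j => AST.gen p q lam (DGen.u i j)
      | HGen.De => AST.gen p q lam DGen.D
      | HGen.DeInv => AST.gen p q lam DGen.DInv
      | HGen.Df => AST.gen p q lam DGen.DInv
      | HGen.DfInv => AST.gen p q lam DGen.D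
    have hl : ∀ d, FreeAlgebra.lift k v (FreeAlgebra.ι k d) = v d := fun d => by simp
    have hrel : ∀ ⦃x y⦄, HRel (formE q) (formF p) x y →
        FreeAlgebra.lift k v x = FreeAlgebra.lift k v y := by
      intro x y hxy
      cases hxy with
      | relE j =>
        simp only [map_sum, map_smul, word_map, hl, coeff_formE]
        exact hA.colRel hP j
      | relF j =>
        simp only [map_sum, map_smul, word_map, hl]
        have := hA.rowRel hP j
        simp only [← coeff_formE] at this
        exact this
      | De_mul_inv => simpa [v] using hA.mul_inv
      | De_inv_mul => simpa [v] using hA.inv_mul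
      | Df_mul_inv => simpa [v] using hA.inv_mul
      | Df_inv_mul => simpa [v] using hA.mul_inv
    refine ⟨RingQuot.liftAlgHom k ⟨_, hrel⟩, fun d => ?_⟩
    cases d <;> exact (RingQuot.liftAlgHom_mkAlgHom_apply _ _ _ _).trans (hl _)
  · have h' : ∀ d, φ (H.gen (formE q) (formF p) d) = φ' (H.gen (formE q) (formF p) d) := by
      intro d
      cases d with
      | u i j => exact h (DGen.u i j)
      | De => exact h DGen.D
      | DeInv => exact h DGen.DInv
      | Df => rw [H.Df_eq hP]; exact h DGen.DInv
      | DfInv => rw [H.DfInv_eq hP]; exact h DGen.D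
    refine RingQuot.ringQuot_ext' _ _ _ ?_
    ext d
    exact h' d

/-- The generators `u_ij` and `D_e^{±1}` of `G(e, f)`. -/
def G.dgen (e f : Form k n n) (d : DGen n) : G e f :=
  RingQuot.mkAlgHom k (GRel e f) (H.dgen e f d)

/-- The extra relation already holds in `H` by `H.Df_eq`, so passing to the quotient changes
nothing. -/
theorem G.isGLAlgebra_dgen (hP : IsParam p q lam) :
    IsGLAlgebra p q lam (G.dgen (formE q) (formF p)) := by
  have hH := H.isGLAlgebra_dgen hP
  refine .of_inverse hP ((H.isQGL_dgen hP).map _) ?_ fun φ φ' h => ?_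
  · obtain ⟨φ, hφ⟩ := hH.exists_lift hP (AST.isQGL_gen hP)
    have hrel : ∀ ⦃x y⦄, GRel (formE q) (formF p) x y → φ x = φ y := by
      rintro _ _ ⟨⟩
      rw [H.Df_eq hP, H.De_mul_DeInv]
    exact ⟨RingQuot.liftAlgHom k ⟨_, hrel⟩, fun d =>
      (RingQuot.liftAlgHom_mkAlgHom_apply _ _ _ _).trans (hφ d)⟩
  · have := hH.algHom_ext (R := G (formE q) (formF p)) (φ := φ.comp (RingQuot.mkAlgHom k _))
      (ψ := φ'.comp (RingQuot.mkAlgHom k _)) h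
    exact RingQuot.ringQuot_ext' _ _ _ this

theorem isGroupLikeElem_H {S : HopfData k (H (formE q) (formF p))} (hP : IsParam p q lam)
    (hS : IsGLCoalgebra S.toBialgebraData (H.dgen (formE q) (formF p))) :
    letI := S.hopfAlgebra
    ∀ d, (∀ i j, d ≠ HGen.u i j) → IsGroupLikeElem k (H.gen (formE q) (formF p) d) := by
  let := S.hopfAlgebra
  intro d hd
  cases d with
  | u i j => exact absurd rfl (hd i j)
  | De => exact hS.isGroupLikeElem_D
  | DeInv => exact hS.isGroupLikeElem_DInv
  | Df => rw [H.Df_eq hP]; exact hS.isGroupLikeElem_DInv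
  | DfInv => rw [H.DfInv_eq hP]; exact hS.isGroupLikeElem_D

theorem isGroupLikeElem_G {S : HopfData k (G (formE q) (formF p))} (hP : IsParam p q lam)
    (hS : IsGLCoalgebra S.toBialgebraData (G.dgen (formE q) (formF p))) :
    letI := S.hopfAlgebra
    ∀ d, (∀ i j, d ≠ HGen.u i j) → IsGroupLikeElem k (G.gen (formE q) (formF p) d) := by
  let := S.hopfAlgebra
  intro d hd
  cases d with
  | u i j => exact absurd rfl (hd i j)
  | De => exact hS.isGroupLikeElem_D
  | DeInv => exact hS.isGroupLikeElem_DInv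
  | Df => rw [G.gen, H.Df_eq hP]; exact hS.isGroupLikeElem_DInv
  | DfInv => rw [G.gen, H.DfInv_eq hP]; exact hS.isGroupLikeElem_D

end HG

/-! ### Isomorphisms of Hopf algebras -/

section Iso

variable {k : Type u} [Field k] {n : ℕ} {p q : Fin n → Fin n → k} {lam : k}

theorem IsGLAlgebra.hopfIso (hP : IsParam p q lam) {O : Type v} {O' : Type w} [Ring O]
    [Algebra k O] [Ring O'] [Algebra k O'] {g : DGen n → O} {g' : DGen n → O'}
    (hg : IsGLAlgebra p q lam g) (hg' : IsGLAlgebra p q lam g') {S : HopfData k O}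
    {T : HopfData k O'} (hS : IsGLCoalgebra S.toBialgebraData g)
    (hT : IsGLCoalgebra T.toBialgebraData g') :
    HopfIso S T (fun i j => g (DGen.u i j)) fun i j => g' (DGen.u i j) := by
  obtain ⟨φ, hφ⟩ := hg.exists_lift hP (hg'.isQGL hP)
  obtain ⟨ψ, hψ⟩ := hg'.exists_lift hP (hg.isQGL hP)
  let := S.hopfAlgebra
  let := T.hopfAlgebra
  let θ : O ≃ₐ[k] O' := AlgEquiv.ofAlgHom φ ψ (hg'.algHom_ext fun d => by simp [hφ, hψ])
    (hg.algHom_ext fun d => by simp [hφ, hψ])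
  have hθ : ∀ d, θ (g d) = g' d := hφ
  refine ⟨BialgEquiv.ofAlgEquiv θ (hg.algHom_ext' hP fun i j => ?_)
    (hg.algHom_ext' hP fun i j => ?_), fun i j => hφ _⟩
  · exact (congr_arg T.counit (hφ _)).trans ((hT.counit_u i j).trans (hS.counit_u i j).symm)
  · have h₁ : Bialgebra.comulAlgHom k O (g (DGen.u i j)) = _ := hS.comul_u i j
    have h₂ : Bialgebra.comulAlgHom k O' (g' (DGen.u i j)) = _ := hT.comul_u i j
    simp [h₁, h₂, hθ]

end Iso

/-! ### Preregularity -/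

section Preregular

variable {k : Type u} [Field k] {n m : ℕ}

theorem form_apply (t : Form k n m) (z : Fin m → Fin n → k) :
    t z = ∑ i : Fin m → Fin n, (∏ r, z r (i r)) * coeff t i := by
  have hz : z = fun r => ∑ j, z r j • (Pi.single j 1 : Fin n → k) := by
    funext r
    simpa using (pi_eq_sum_univ' (z r))
  conv_lhs => rw [hz, MultilinearMap.map_sum]
  refine Finset.sum_congr rfl fun i _ => ?_
  rw [MultilinearMap.map_smul_univ, smul_eq_mul, coeff]

theorem formE_apply_succ (q : Fin (m + 1) → Fin (m + 1) → k) (z : Fin (m + 1) → Fin (m + 1) → k) :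
    formE q z = ∑ x, ∑ i : Fin m → Fin (m + 1), z 0 x * (∏ r, z (Fin.succ r) (i r)) *
      skewSign q (Fin.cons x i : Fin (m + 1) → Fin (m + 1)) := by
  rw [form_apply, sum_cons]
  simp only [Fin.prod_univ_succ, Fin.cons_zero, Fin.cons_succ, coeff_formE]

/-- Cyclicity is `skewSign_snoc_eq` with `φ` the diagonal matrix of twists. -/
theorem IsMulAntisymm.isPreregular_formE {q : Fin n → Fin n → k} (hq : IsMulAntisymm q)
    (hn : n ≠ 0) : IsPreregular (formE q) := by
  obtain ⟨m, rfl⟩ := Nat.exists_eq_succ_of_ne_zero hn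
  refine ⟨fun v hv => funext fun x => ?_, LinearEquiv.piCongrRight fun x =>
    LinearEquiv.smulOfNeZero k k (twist q x) (twist_ne_zero hq x), fun z => ?_⟩
  -- Filling the other slots with all the basis vectors except the one of index `x` isolates the
  -- coordinate `v x`, with a nonzero coefficient.
  · have h := hv (Fin.cons v fun r => Pi.single (x.succAbove r) 1) fun r hr => by
      rw [show r = 0 from Fin.ext hr, Fin.cons_zero]
    rw [formE_apply_succ, Finset.sum_eq_single x, Finset.sum_eq_single x.succAbove] at h
    · simpa [skewSign_ne_zero hq (j := (Fin.cons x x.succAbove : Fin (m + 1) → Fin (m + 1)))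
        (Fin.cons_injective_iff.2 ⟨by simp, x.succAbove_right_injective⟩)] using h
    · intro i _ hi
      obtain ⟨r, hr⟩ := Function.ne_iff.1 hi
      rw [Finset.prod_eq_zero (Finset.mem_univ r) (by simp [hr]), mul_zero, zero_mul]
    · simp
    · intro y _ hy
      refine Finset.sum_eq_zero fun i _ => ?_
      by_cases hi : i = x.succAbove
      · rw [hi, skewSign_cons_succAbove q hy, mul_zero]
      · obtain ⟨r, hr⟩ := Function.ne_iff.1 hi
        rw [Finset.prod_eq_zero (Finset.mem_univ r) (by simp [hr]), mul_zero, zero_mul]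
    · simp
  · rw [form_apply, sum_snoc, formE_apply_succ]
    refine Finset.sum_congr rfl fun x _ => Finset.sum_congr rfl fun i _ => ?_
    rw [Fin.prod_univ_castSucc, coeff_formE, skewSign_snoc_eq hq]
    simp only [Fin.snoc_castSucc, Fin.snoc_last]
    have h₀ : ∀ φ : (Fin (m + 1) → k) → Fin (m + 1) → k, rotate φ z 0 = φ (z (Fin.last m)) :=
      fun φ => rfl
    have h₁ : ∀ (φ : (Fin (m + 1) → k) → Fin (m + 1) → k) (r : Fin m),
        rotate φ z r.succ = z r.castSucc := fun φ r => by simp [rotate]; rfl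
    simp only [h₀, h₁]
    change _ = twist q x * z (Fin.last m) x * _ * _
    ring

end Preregular

/-! ### Coactions on skew polynomial rings -/

section Coactions

variable {k : Type u} [Field k] {n : ℕ} {q : Fin n → Fin n → k} {A : Type v} [Ring A] [Algebra k A]
  {x : Fin n → A} {K : Type w} [Ring K] [Algebra k K] {c d : Fin n → Fin n → K}

theorem SkewCommute.map {R : Type v} {S : Type w} [Ring R] [Algebra k R] [Ring S] [Algebra k S]
    {x : Fin n → R} (hx : SkewCommute q x) (φ : R →ₐ[k] S) : SkewCommute q fun i => φ (x i) :=
  fun i j => by rw [← map_mul, hx, map_smul, map_mul]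

theorem IsSkewPoly.exists_left (hx : IsSkewPoly q x) (hc : SkewCols q c) :
    ∃ φ : A →ₐ[k] K ⊗[k] A, ∀ i, φ (x i) = ∑ j, c i j ⊗ₜ x j := by
  obtain ⟨φ, hφ⟩ := hx.exists_lift
    ((hc.map (Algebra.TensorProduct.includeLeft : K →ₐ[k] K ⊗[k] A)).skewCommute
    (x := fun l => 1 ⊗ₜ x l) (hx.skewCommute.map (Algebra.TensorProduct.includeRight : A →ₐ[k] K ⊗[k] A))
    fun i j l => by simp [Commute, SemiconjBy])
  exact ⟨φ, fun i => by simp [hφ]⟩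

theorem IsSkewPoly.exists_right (hx : IsSkewPoly q x) (hc : SkewCols q fun i j => c j i) :
    ∃ φ : A →ₐ[k] A ⊗[k] K, ∀ j, φ (x j) = ∑ i, x i ⊗ₜ c i j := by
  obtain ⟨φ, hφ⟩ := hx.exists_left hc
  exact ⟨(Algebra.TensorProduct.comm k K A).toAlgHom.comp φ, fun i => by simp [hφ]⟩

theorem IsSkewPoly.skewCols_of_left (hq : IsMulAntisymm q) (hx : IsSkewPoly q x)
    (φ : A →ₐ[k] K ⊗[k] A) (h : ∀ i, φ (x i) = ∑ j, c i j ⊗ₜ x j) : SkewCols q c := by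
  have := hx.skewCommute.map φ
  simp only [h] at this
  exact hx.skewCols hq this

theorem IsSkewPoly.skewCols_of_right (hq : IsMulAntisymm q) (hx : IsSkewPoly q x)
    (φ : A →ₐ[k] A ⊗[k] K) (h : ∀ j, φ (x j) = ∑ i, x i ⊗ₜ c i j) :
    SkewCols q fun i j => c j i :=
  hx.skewCols_of_left hq ((Algebra.TensorProduct.comm k A K).toAlgHom.comp φ)
    fun i => by simp [h]

end Coactions

/-! ### The universal balanced coaction -/

section Universal

variable {k : Type u} [Field k] {n : ℕ} {p q : Fin n → Fin n → k} {lam : k} {O A B : Type u}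
  [Ring O] [Algebra k O] [Ring A] [Algebra k A] [Ring B] [Algebra k B] {g : DGen n → O}
  {x : Fin n → A} {y : Fin n → B}

theorem IsMatrixCoalgebra.exists_balancedCoaction {K : Type w} [Ring K] [HopfAlgebra k K]
    {c : Fin n → Fin n → K} (hc : IsMatrixCoalgebra k c) (hQ : IsQMat p q c)
    (hx : IsSkewPoly q x) (hy : IsSkewPoly (fun i j => p j i) y) :
    ∃ ρ : BalancedCoaction (k := k) x y K,
      (∀ i, ρ.left (x i) = ∑ j, c i j ⊗ₜ[k] x j) ∧ ∀ j, ρ.right (y j) = ∑ i, y i ⊗ₜ[k] c i j := by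
  obtain ⟨φ, hφ⟩ := hx.exists_left hQ.cols
  obtain ⟨ψ, hψ⟩ := hy.exists_right (c := c) hQ.rows
  refine ⟨⟨φ, hx.algHom_ext fun i => ?_, hx.algHom_ext fun i => ?_, ψ, hy.algHom_ext fun i => ?_,
    hy.algHom_ext fun i => ?_, c, hφ, hψ⟩, hφ, hψ⟩
  · simp [hφ, (hc _ _).1, TensorProduct.sum_tmul, TensorProduct.tmul_sum]
    exact Finset.sum_comm
  · simp [hφ, (hc _ _).2, TensorProduct.ite_tmul]
  · simp [hψ, (hc _ _).1, TensorProduct.sum_tmul, TensorProduct.tmul_sum]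
    exact Finset.sum_comm
  · simp [hψ, (hc _ _).2, TensorProduct.tmul_ite]

/-- The generators `x j` are linearly independent over any coefficient algebra, so coefficients can
be compared in coassociativity and counitality. -/
theorem BalancedCoaction.isMatrixCoalgebra {K : Type w} [Ring K] [HopfAlgebra k K]
    (τ : BalancedCoaction (k := k) x y K) (hx : IsSkewPoly q x) {c : Fin n → Fin n → K}
    (hc : ∀ i, τ.left (x i) = ∑ j, c i j ⊗ₜ[k] x j) : IsMatrixCoalgebra k c := by
  intro i j
  constructor
  · have h := congr_arg (Algebra.TensorProduct.assoc k k k K K A).symm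
      (DFunLike.congr_fun τ.left_coassoc (x i))
    simp [hc, TensorProduct.tmul_sum] at h
    rw [Finset.sum_comm] at h
    simp only [← TensorProduct.sum_tmul] at h
    exact hx.coeff_ext h j
  · have h := DFunLike.congr_fun τ.left_counit (x i)
    simp [hc] at h
    refine hx.coeff_ext (c := fun j => Coalgebra.counit (c i j))
      (d := fun j => if i = j then (1 : k) else 0) ?_ j
    simpa [TensorProduct.ite_tmul] using h

theorem IsMatrixCoalgebra.isGroupLikeElem_colDet (hP : IsParam p q lam) {K : Type w} [Ring K]
    [HopfAlgebra k K] {c : Fin n → Fin n → K} (hc : IsMatrixCoalgebra k c) (hQ : IsQMat p q c) :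
    IsGroupLikeElem k (colDet (formE q) c) := by
  constructor
  · have := colDet_map (Bialgebra.counitAlgHom k K) (formE q) c
    refine this.trans ?_
    simp only [Bialgebra.counitAlgHom_apply, (hc _ _).2]
    exact (colRel_one q).colDet_eq
  · have := colDet_map (Bialgebra.comulAlgHom k K) (formE q) c
    refine this.trans ?_
    simp only [Bialgebra.comulAlgHom_apply, (hc _ _).1]
    exact (colRel_comul (hQ.colRel hP)).colDet_eq

/-- The left coaction forces the column relations on the common matrix `c`, the right coaction the
row relations. The determinant of `c` is grouplike, so the antipode of `K` inverts it, and the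
universal property of `O` applies. -/
theorem IsGLAlgebra.isBalancedGL (hP : IsParam p q lam) (hg : IsGLAlgebra p q lam g)
    {S : HopfData k O} (hS : IsGLCoalgebra S.toBialgebraData g) (hx : IsSkewPoly q x)
    (hy : IsSkewPoly (fun i j => p j i) y) :
    letI := S.hopfAlgebra
    IsBalancedGL.{u, u, w} (k := k) x y O fun i j => g (DGen.u i j) := by
  let := S.hopfAlgebra
  have hO := hS.isMatrixCoalgebra
  obtain ⟨ρ, hl, hr⟩ := hO.exists_balancedCoaction (hg.isQGL hP).mat hx hy
  refine ⟨ρ, hl, hr, fun K _ _ τ => ?_⟩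
  obtain ⟨c, hcl, hcr⟩ := τ.balanced
  have hc := τ.isMatrixCoalgebra hx hcl
  have hQ : IsQMat p q c := ⟨hx.skewCols_of_left hP.q_antisymm _ hcl,
    hy.skewCols_of_right hP.p_antisymm.transpose _ hcr⟩
  have hD := hc.isGroupLikeElem_colDet hP hQ
  obtain ⟨φ, hφ⟩ := hg.exists_lift hP (R := K) (h := fun d => match d with
    | DGen.u i j => c i j
    | DGen.D => colDet (formE q) c
    | DGen.DInv => HopfAlgebra.antipode k (colDet (formE q) c))
    ⟨hQ, rfl, hD.mul_antipode_cancel, hD.antipode_mul_cancel⟩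
  have hφu : ∀ i j, φ (g (DGen.u i j)) = c i j := fun i j => hφ (DGen.u i j)
  have h₁ : ∀ i j, Coalgebra.comul (R := k) (g (DGen.u i j))
    = ∑ l, g (DGen.u i l) ⊗ₜ[k] g (DGen.u l j) := fun i j => (hO i j).1
  have h₂ : ∀ i j, Coalgebra.counit (R := k) (g (DGen.u i j))
    = if i = j then 1 else 0 := fun i j => (hO i j).2
  refine ⟨BialgHom.ofAlgHom φ (hg.algHom_ext' hP fun i j => ?_) (hg.algHom_ext' hP fun i j => ?_),
    ⟨hx.algHom_ext fun i => ?_, hy.algHom_ext fun j => ?_⟩, ?_⟩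
  · simp [hφu, (hc _ _).2, h₂]
  · simp [hφu, (hc _ _).1, h₁]
  · simp [hl, hcl, hφu]
  · simp [hr, hcr, hφu]
  · rintro ψ ⟨h, -⟩
    have : (ψ : O →ₐ[k] K) = φ := hg.algHom_ext' hP fun i j => by
      have h := DFunLike.congr_fun h (x i)
      simp [hl, hcl] at h
      rw [hφu]
      exact hx.coeff_ext h j
    exact BialgHom.ext fun a => DFunLike.congr_fun this a

end Universal

/-! ### Assembly of the chain -/

theorem IsGLAlgebra.quantumGLChain {k : Type u} [Field k] {n : ℕ} {p q : Fin n → Fin n → k}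
    {lam : k} {O A B : Type u} [Ring O] [Algebra k O] [Ring A] [Algebra k A] [Ring B] [Algebra k B]
    {g : DGen n → O} {x : Fin n → A} {y : Fin n → B} (hP : IsParam p q lam)
    (hg : IsGLAlgebra p q lam g) (hx : IsSkewPoly q x) (hy : IsSkewPoly (fun i j => p j i) y) :
    QuantumGLChain.{u, w} g (formE q) (formF p) x y := by
  have hn : n ≠ 0 := by have := hP.two_le; omega
  obtain ⟨⟨ore⟩, ore'⟩ := OM.exists_oreSet hP
  have hL := OM.isGLAlgebra_oreGen hP
  have hH := H.isGLAlgebra_dgen hP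
  have hG := G.isGLAlgebra_dgen hP
  obtain ⟨SO, hSO⟩ := hg.exists_hopfData hP
  obtain ⟨SM, hSM⟩ := OM.exists_bialgebraData hP
  obtain ⟨SL, hSL⟩ := hL.exists_hopfData hP
  obtain ⟨SH, hSH⟩ := hH.exists_hopfData hP
  obtain ⟨SG, hSG⟩ := hG.exists_hopfData hP
  refine ⟨hP.q_antisymm.isPreregular_formE hn,
    hP.p_antisymm.transpose.isPreregular_formE hn, (OM.isQMat hP).colDet_eq_rowDet hP, ore',
    ore, SO, SM, SL, SH, SG,
    ⟨hSO.isMatrixCoalgebra, hSO.isGroupLikeElem_D, hSO.isGroupLikeElem_DInv,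
      hg.isBalancedGL hP hSO hx hy⟩,
    hSM, hSL.isMatrixCoalgebra, ⟨hSH.isMatrixCoalgebra, isGroupLikeElem_H hP hSH⟩,
    ⟨hSG.isMatrixCoalgebra, isGroupLikeElem_G hP hSG⟩,
    hg.hopfIso hP hL hSO hSL, hg.hopfIso hP hH hSO hSH, hg.hopfIso hP hG hSO hSG⟩

/-! ### Takeuchi's two-parameter algebra -/

section OneParameter

variable {k : Type u} [Field k] {n : ℕ}

/-- The multiplicatively antisymmetric matrix with entries `p` above the diagonal. -/
def paramMatrix (n : ℕ) (p : k) (i j : Fin n) : k := if i < j then p else if j < i then p⁻¹ else 1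

theorem paramMatrix_of_lt (p : k) {i j : Fin n} (h : i < j) : paramMatrix n p i j = p := if_pos h

theorem paramMatrix_of_gt (p : k) {i j : Fin n} (h : i < j) : paramMatrix n p j i = p⁻¹ := by
  rw [paramMatrix, if_neg h.not_gt, if_pos h]

theorem paramMatrix_self (p : k) (i : Fin n) : paramMatrix n p i i = 1 := by simp [paramMatrix]

theorem isMulAntisymm_paramMatrix {p : k} (hp : p ≠ 0) : IsMulAntisymm (paramMatrix n p) := by
  refine ⟨paramMatrix_self p, fun i j => ?_⟩
  rcases lt_trichotomy i j with h | rfl | h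
  · rw [paramMatrix_of_lt p h, paramMatrix_of_gt p h, mul_inv_cancel₀ hp]
  · rw [paramMatrix_self, one_mul]
  · rw [paramMatrix_of_lt p h, paramMatrix_of_gt p h, inv_mul_cancel₀ hp]

theorem paramMatrix_inv (p : k) (i j : Fin n) : paramMatrix n p⁻¹ i j = paramMatrix n p j i := by
  rcases lt_trichotomy i j with h | rfl | h
  · rw [paramMatrix_of_lt _ h, paramMatrix_of_gt _ h]
  · rw [paramMatrix_self, paramMatrix_self]
  · rw [paramMatrix_of_lt _ h, paramMatrix_of_gt _ h, inv_inv]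

theorem paramMatrix_transpose (p : k) : (fun i j => paramMatrix n p j i) = paramMatrix n p⁻¹ :=
  funext fun i => funext fun j => (paramMatrix_inv p i j).symm

theorem formE_paramMatrix (q : k) : formE (paramMatrix n q⁻¹) = formT n q := by
  refine congr_arg permForm (funext fun σ => ?_)
  rw [inversions, zpow_neg, zpow_natCast, ← inv_pow, ← Finset.prod_const, Finset.prod_filter,
    Fintype.prod_prod_type]
  refine Finset.prod_congr rfl fun i _ => Finset.prod_congr rfl fun j _ => ?_
  split_ifs with h
  · rw [paramMatrix_of_lt _ h.2, inv_neg]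
  · rfl

theorem formF_paramMatrix (p : k) : formF (paramMatrix n p) = formT n p :=
  (congr_arg formE (paramMatrix_transpose p)).trans (formE_paramMatrix p)

/-- The value `q⁻¹` sits above the diagonal because `x_j x_i = q x_i x_j` for `i < j` reads off the
entry below it. There the entries are `q` and `p⁻¹`, whose ratio is `λ = p * q`. -/
theorem isParam_paramMatrix (hn : 2 ≤ n) {p q : k} (hp : p ≠ 0) (hq : q ≠ 0) (hpq : p * q ≠ -1) :
    IsParam (paramMatrix n p) (paramMatrix n q⁻¹) (p * q) where
  two_le := hn
  p_antisymm := isMulAntisymm_paramMatrix hp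
  q_antisymm := isMulAntisymm_paramMatrix (inv_ne_zero hq)
  lam_ne := hpq
  rel i j h := by
    rw [paramMatrix_inv, paramMatrix_of_lt _ h, paramMatrix_of_gt _ h, mul_right_comm,
      mul_inv_cancel₀ hp, one_mul]

theorem IsSkewPoly.of_inverse {q : Fin n → Fin n → k} {A : Type v} [Ring A] [Algebra k A]
    {x : Fin n → A} (hx : SkewCommute q x)
    (hlift : ∃ φ : A →ₐ[k] SkewPoly q, ∀ i, φ (x i) = SkewPoly.x q i)
    (hext : ∀ φ φ' : A →ₐ[k] A, (∀ i, φ (x i) = φ' (x i)) → φ = φ') : IsSkewPoly q x := by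
  obtain ⟨ψ, hψ⟩ := SkewPoly.exists_lift hx
  obtain ⟨φ, hφ⟩ := hlift
  exact ⟨AlgEquiv.ofAlgHom ψ φ (hext _ _ fun d => by simp [hφ, hψ])
    (SkewPoly.algHom_ext fun d => by simp [hφ, hψ]), fun d => by simp [hψ]⟩

theorem isSkewPoly_QSkewPoly {q : k} (hq : q ≠ 0) :
    IsSkewPoly (paramMatrix n q⁻¹) (QSkewPoly.x n q) := by
  have hrel : ∀ i j, i < j → QSkewPoly.x n q j * QSkewPoly.x n q i
      = q • (QSkewPoly.x n q i * QSkewPoly.x n q j) := fun i j h => by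
    have := RingQuot.mkAlgHom_rel k (QSkewRel.comm (q := q) i j h)
    simpa [QSkewPoly.x] using this
  refine .of_inverse (fun i j => ?_) ⟨RingQuot.liftAlgHom k
    ⟨FreeAlgebra.lift k (SkewPoly.x (paramMatrix n q⁻¹)), ?_⟩, fun i => ?_⟩ fun φ φ' h => ?_
  · rcases lt_trichotomy i j with h | rfl | h
    · rw [hrel i j h, paramMatrix_of_gt _ h, inv_inv]
    · rw [paramMatrix_self, one_smul]
    · rw [hrel j i h, paramMatrix_of_lt _ h, smul_smul, inv_mul_cancel₀ hq, one_smul]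
  · rintro _ _ ⟨i, j, h⟩
    simpa [paramMatrix_of_gt _ h] using skewCommute_x (paramMatrix n q⁻¹) i j
  · exact (RingQuot.liftAlgHom_mkAlgHom_apply _ _ _ _).trans (by simp)
  · refine RingQuot.ringQuot_ext' _ _ _ ?_
    ext i
    exact h i

theorem colDet_permForm {R : Type v} [Ring R] [Algebra k R] (c : Equiv.Perm (Fin n) → k)
    (v : Fin n → Fin n → R) : colDet (permForm c) v = ∑ σ, c σ • word v σ id := by
  simp only [colDet, coeff_permForm, Finset.sum_smul]
  rw [Finset.sum_comm]
  simp [ite_smul]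

theorem rowDet_permForm {R : Type v} [Ring R] [Algebra k R] (c : Equiv.Perm (Fin n) → k)
    (v : Fin n → Fin n → R) : rowDet (permForm c) v = ∑ σ, c σ • word v id σ :=
  colDet_permForm c fun i j => v j i

theorem astQuad_paramMatrix {R : Type v} [Ring R] [Algebra k R] {p q : k} (hp : p ≠ 0)
    {v : Fin n → Fin n → R} : ASTQuad (paramMatrix n p) (p * q) v ↔
    ((∀ i j a b, i < j → a < b → v j b * v i a = v i a * v j b + (q - p⁻¹) • (v i b * v j a)) ∧
    (∀ i j a, i < j → v j a * v i a = q • (v i a * v j a)) ∧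
    (∀ i j a b, i < j → b < a → v j b * v i a = (q * p⁻¹) • (v i a * v j b)) ∧
    ∀ i a b, a < b → v i b * v i a = p • (v i a * v i b)) := by
  have e₁ : p⁻¹ * p = 1 := inv_mul_cancel₀ hp
  have e₂ : (p * q - 1) * p⁻¹ = q - p⁻¹ := by field_simp
  have e₃ : p * q * p⁻¹ = q := by field_simp
  constructor
  · refine fun h => ⟨fun i j a b hij hab => ?_, fun i j a hij => ?_, fun i j a b hij hab => ?_,
      fun i a b hab => ?_⟩
    · simpa [paramMatrix_of_gt _ hij, paramMatrix_of_lt _ hab, e₁, e₂] using h.rel₁ i j a b hij hab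
    · simpa [paramMatrix_of_gt _ hij, paramMatrix_self, e₃] using h.rel₂ i j a a hij le_rfl
    · simpa [paramMatrix_of_gt _ hij, paramMatrix_of_gt _ hab, e₃] using h.rel₂ i j a b hij hab.le
    · simpa [paramMatrix_of_lt _ hab] using h.rel₃ i a b hab
  · rintro ⟨h₁, h₂, h₃, h₄⟩
    refine ⟨fun i j a b hij hab => ?_, fun i j a b hij hab => ?_, fun i a b hab => ?_⟩
    · simpa [paramMatrix_of_gt _ hij, paramMatrix_of_lt _ hab, e₁, e₂] using h₁ i j a b hij hab
    · rcases hab.eq_or_lt with rfl | hab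
      · simpa [paramMatrix_of_gt _ hij, paramMatrix_self, e₃] using h₂ i j b hij
      · simpa [paramMatrix_of_gt _ hij, paramMatrix_of_gt _ hab, e₃] using h₃ i j a b hij hab
    · simpa [paramMatrix_of_lt _ hab] using h₄ i a b hab

theorem isGLAlgebra_Tak (hn : 2 ≤ n) {p q : k} (hp : p ≠ 0) (hq : q ≠ 0) (hpq : p * q ≠ -1) :
    IsGLAlgebra (paramMatrix n p) (paramMatrix n q⁻¹) (p * q) (Tak.gen n p q) := by
  have hP := isParam_paramMatrix hn hp hq hpq
  have hrel : ∀ {x y}, TakRel n p q x y → RingQuot.mkAlgHom k (TakRel n p q) x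
      = RingQuot.mkAlgHom k (TakRel n p q) y := fun h => RingQuot.mkAlgHom_rel k h
  have hA := AST.isQGL_gen hP
  obtain ⟨a₁, a₂, a₃, a₄⟩ := (astQuad_paramMatrix hp).1 (hA.mat.astQuad hP)
  have hl : ∀ d, FreeAlgebra.lift k (AST.gen (paramMatrix n p) (paramMatrix n q⁻¹) (p * q))
      (FreeAlgebra.ι k d) = AST.gen _ _ _ d := fun d => by simp
  refine .of_inverse hP ⟨((astQuad_paramMatrix hp).2 ⟨fun i j a b hij hab => ?_,
    fun i j a hij => ?_, fun i j a b hij hab => ?_, fun i a b hab => ?_⟩).isQMat hP, ?_, ?_, ?_⟩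
    ⟨RingQuot.liftAlgHom k ⟨FreeAlgebra.lift k (AST.gen _ _ _), ?_⟩, fun d =>
      (RingQuot.liftAlgHom_mkAlgHom_apply _ _ _ _).trans (hl d)⟩ fun φ φ' h => ?_
  · simpa [Tak.gen, freeU] using hrel (.rel₁ i j a b hij hab)
  · simpa [Tak.gen, freeU] using hrel (.rel₂ i j a hij)
  · simpa [Tak.gen, freeU] using hrel (.rel₃ i j a b hij hab)
  · simpa [Tak.gen, freeU] using hrel (.rel₄ i a b hab)
  · have := hrel .col
    rw [formE_paramMatrix, formT, colDet_permForm]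
    simp only [map_sum, map_smul, word_map] at this
    exact this
  · simpa [Tak.gen, freeU] using hrel .mul_inv
  · simpa [Tak.gen, freeU] using hrel .inv_mul
  · intro x y hxy
    cases hxy with
    | rel₁ i j a b hij hab => simpa using a₁ i j a b hij hab
    | rel₂ i j a hij => simpa using a₂ i j a hij
    | rel₃ i j a b hij hab => simpa using a₃ i j a b hij hab
    | rel₄ i a b hab => simpa using a₄ i a b hab
    | col =>
      rw [hl, hA.det, formE_paramMatrix, formT, colDet_permForm]
      simp [word_map]
    | row =>
      rw [hl, hA.det, hA.mat.colDet_eq_rowDet hP, formF_paramMatrix, formT, rowDet_permForm]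
      simp [word_map]
    | mul_inv => simpa using hA.mul_inv
    | inv_mul => simpa using hA.inv_mul
  · refine RingQuot.ringQuot_ext' _ _ _ ?_
    ext d
    exact h d

theorem quantumGLChain_Tak (hn : 2 ≤ n) {p q : k} (hp : p ≠ 0) (hq : q ≠ 0) (hpq : p * q ≠ -1) :
    QuantumGLChain.{u, w} (Tak.gen n p q) (formT n q) (formT n p) (QSkewPoly.x n q)
      (QSkewPoly.x n p) := by
  rw [← formE_paramMatrix, ← formF_paramMatrix]
  refine (isGLAlgebra_Tak hn hp hq hpq).quantumGLChain (isParam_paramMatrix hn hp hq hpq)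
    (isSkewPoly_QSkewPoly hq) ?_
  rw [paramMatrix_transpose]
  exact isSkewPoly_QSkewPoly hp

end OneParameter

/-! ### The commutative case -/

section Classical

variable {k : Type u} [Field k] {n : ℕ}

theorem isMulAntisymm_one : IsMulAntisymm fun _ _ : Fin n => (1 : k) :=
  ⟨fun _ => rfl, fun _ _ => one_mul 1⟩

theorem isParam_one (hn : 2 ≤ n) (h : (1 : k) ≠ -1) :
    IsParam (fun _ _ : Fin n => (1 : k)) (fun _ _ => 1) 1 :=
  ⟨hn, isMulAntisymm_one, isMulAntisymm_one, h, fun _ _ _ => (one_mul 1).symm⟩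

theorem formE_one : formE (fun _ _ : Fin n => (1 : k)) = signForm k n := by
  refine congr_arg permForm (funext fun σ => ?_)
  rw [σ.sign_eq_prod_prod_Ioi]
  push_cast
  refine Finset.prod_congr rfl fun i _ => ?_
  rw [← Finset.prod_subset (Finset.subset_univ (Finset.Ioi i))]
  · refine Finset.prod_congr rfl fun j hj => ?_
    have hij := Finset.mem_Ioi.1 hj
    rcases lt_or_gt_of_ne (σ.injective.ne hij.ne) with h | h
    · simp [h, h.not_gt]
    · simp [h, h.not_gt, hij]
  · intro j _ hj
    rw [if_neg fun h => hj (Finset.mem_Ioi.2 h.1)]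

theorem colDet_signForm {R : Type v} [CommRing R] [Algebra k R] (v : Fin n → Fin n → R) :
    colDet (signForm k n) v = (Matrix.of v).det := by
  rw [signForm, colDet_permForm, Matrix.det_apply]
  refine Finset.sum_congr rfl fun σ _ => ?_
  simp [word, List.prod_ofFn, Units.smul_def, Int.cast_smul_eq_zsmul]

theorem isQMat_of_comm {R : Type v} [CommRing R] [Algebra k R] (v : Fin n → Fin n → R) :
    IsQMat (fun _ _ => (1 : k)) (fun _ _ => 1) v := by
  have h : ∀ v : Fin n → Fin n → R, SkewCols (fun _ _ => (1 : k)) v := fun v =>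
    ⟨fun i j a => by rw [one_smul, mul_comm], fun i j a b => by
      simp only [one_smul]
      ring⟩
  exact ⟨h v, h _⟩

theorem isQGL_OGL : IsQGL (fun _ _ => (1 : k)) (fun _ _ => 1) (OGL.gen k n) where
  mat := isQMat_of_comm _
  det := by
    rw [formE_one, colDet_signForm]
    change algebraMap _ _ (Matrix.det _) = _
    rw [RingHom.map_det]
    rfl
  mul_inv := IsLocalization.Away.mul_invSelf _
  inv_mul := (mul_comm _ _).trans (IsLocalization.Away.mul_invSelf _)

theorem OGL.algHom_ext {R : Type v} [Ring R] [Algebra k R] {φ ψ : OGL k n →ₐ[k] R}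
    (h : ∀ i j, φ (OGL.gen k n (DGen.u i j)) = ψ (OGL.gen k n (DGen.u i j))) : φ = ψ := by
  refine IsLocalization.algHom_ext (Submonoid.powers (genericDet k n)) ?_
  ext ⟨i, j⟩
  exact h i j

/-- Commutativity is a hypothesis rather than an instance: the target will be `AST` at trivial
parameters, whose commutativity is proved in `AST.mul_comm_of_one`. -/
theorem OGL.exists_lift {R : Type v} [Ring R] [Algebra k R] (hR : ∀ a b : R, a * b = b * a)
    {h : DGen n → R} (hh : IsQGL (fun _ _ => (1 : k)) (fun _ _ => 1) h) :
    ∃ φ : OGL k n →ₐ[k] R, ∀ d, φ (OGL.gen k n d) = h d := by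
  let : CommRing R := { ‹Ring R› with mul_comm := hR }
  have hD : MvPolynomial.aeval (fun d : Fin n × Fin n => h (DGen.u d.1 d.2)) (genericDet k n)
      = h DGen.D := by
    rw [hh.det, formE_one]
    refine Eq.trans ?_ (colDet_signForm _).symm
    rw [genericDet, AlgHom.map_det]
    congr 1
    ext i j
    simp
  have hu : ∀ s : Submonoid.powers (genericDet k n),
      IsUnit (MvPolynomial.aeval (fun d : Fin n × Fin n => h (DGen.u d.1 d.2)) s.1) := by
    rintro ⟨_, a, rfl⟩
    simpa [hD] using (IsUnit.of_mul_eq_one _ hh.mul_inv).pow a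
  have hφ : ∀ P, (IsLocalization.liftAlgHom hu : OGL k n →ₐ[k] R) (algebraMap _ _ P)
      = MvPolynomial.aeval (fun d : Fin n × Fin n => h (DGen.u d.1 d.2)) P :=
    fun P => IsLocalization.lift_eq _ P
  have hφD := (hφ (genericDet k n)).trans hD
  refine ⟨IsLocalization.liftAlgHom hu, fun d => ?_⟩
  cases d with
  | u i j => exact (hφ _).trans (by simp)
  | D => exact hφD
  | DInv =>
    refine left_inv_eq_right_inv (a := h DGen.D) ?_ hh.mul_inv
    rw [← hφD, ← map_mul]
    exact (congr_arg _ isQGL_OGL.inv_mul).trans (map_one _)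

/-- At `λ = 1` the correction term in `ASTQuad.rel₁` vanishes, so the entries commute. The
determinant is a polynomial in them, and its inverse commutes with whatever the determinant commutes
with. -/
theorem AST.mul_comm_of_one (hn : 2 ≤ n) (h : (1 : k) ≠ -1)
    (a b : AST (fun _ _ : Fin n => (1 : k)) (fun _ _ => 1) 1) : a * b = b * a := by
  have hP := isParam_one hn h
  have hA := AST.isQGL_gen hP
  have huu : ∀ i j i' j', Commute
      (AST.gen (fun _ _ : Fin n => (1 : k)) (fun _ _ => 1) 1 (DGen.u i j))
      (AST.gen _ _ _ (DGen.u i' j')) := by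
    have key : ∀ i j i' j', i < i' →
        Commute (AST.gen (fun _ _ : Fin n => (1 : k)) (fun _ _ => 1) 1 (DGen.u i j))
          (AST.gen _ _ _ (DGen.u i' j')) := by
      intro i j i' j' hi
      have hq := hA.mat.astQuad hP
      rcases lt_or_ge j j' with hj | hj
      · have := hq.rel₁ i i' j j' hi hj
        simp only [mul_one, one_smul, sub_self, zero_smul, add_zero] at this
        exact this.symm
      · have := hq.rel₂ i i' j j' hi hj
        simp only [mul_one, one_smul] at this
        exact this.symm
    intro i j i' j'
    rcases lt_trichotomy i i' with hi | rfl | hi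
    · exact key i j i' j' hi
    · have := hA.mat.rows.same j j' i
      rw [one_smul] at this
      exact this.symm
    · exact (key i' j' i j hi).symm
  have hD : ∀ x, (∀ i j, Commute x (AST.gen _ _ _ (DGen.u i j))) →
      Commute x (AST.gen (fun _ _ : Fin n => (1 : k)) (fun _ _ => 1) 1 DGen.D) := by
    intro x hx
    rw [hA.det]
    exact Commute.sum_right _ _ _ fun i _ => (Commute.word_right hx _ _).smul_right _
  have hI : ∀ x, Commute x (AST.gen (fun _ _ : Fin n => (1 : k)) (fun _ _ => 1) 1 DGen.D) →
      Commute x (AST.gen _ _ _ DGen.DInv) := fun x hx =>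
    Commute.units_inv_right (u := ⟨_, _, hA.mul_inv, hA.inv_mul⟩) hx
  have hall : ∀ x, (∀ i j, Commute x (AST.gen (fun _ _ : Fin n => (1 : k)) (fun _ _ => 1) 1
      (DGen.u i j))) → ∀ y, Commute x y := by
    intro x hx y
    induction y using AST.induction with
    | hc c => exact Algebra.commute_algebraMap_right c x
    | hg d =>
      cases d with
      | u i j => exact hx i j
      | D => exact hD x hx
      | DInv => exact hI x (hD x hx)
    | hm a b ha hb => exact ha.mul_right hb
    | ha a b ha hb => exact ha.add_right hb
  exact hall a (fun i j => (hall _ (huu i j) a).symm) b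

theorem isGLAlgebra_OGL (hn : 2 ≤ n) (h : (1 : k) ≠ -1) :
    IsGLAlgebra (fun _ _ => (1 : k)) (fun _ _ => 1) 1 (OGL.gen k n) :=
  .of_inverse (isParam_one hn h) isQGL_OGL
    (OGL.exists_lift (AST.mul_comm_of_one hn h) (AST.isQGL_gen (isParam_one hn h)))
    fun _ _ h => OGL.algHom_ext fun i j => h (DGen.u i j)

theorem exists_aeval_of_comm {ι : Type v} {R : Type w} [Ring R] [Algebra k R]
    {x : ι → R} (hx : ∀ a b : R, a * b = b * a) :
    ∃ φ : MvPolynomial ι k →ₐ[k] R, ∀ i, φ (MvPolynomial.X i) = x i := by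
  let : CommRing R := { ‹Ring R› with mul_comm := hx }
  exact ⟨MvPolynomial.aeval x, MvPolynomial.aeval_X x⟩

theorem SkewPoly.mul_comm_of_one (a b : SkewPoly fun _ _ : Fin n => (1 : k)) : a * b = b * a := by
  have hind : ∀ x : SkewPoly fun _ _ : Fin n => (1 : k),
      (∀ i, Commute x (SkewPoly.x _ i)) → ∀ y, Commute x y := by
    intro x hx y
    obtain ⟨y, rfl⟩ := RingQuot.mkAlgHom_surjective k _ y
    induction y using FreeAlgebra.induction with
    | grade0 c =>
      rw [AlgHom.commutes]
      exact Algebra.commute_algebraMap_right c x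
    | grade1 d => exact hx d
    | mul a b ha hb => rw [map_mul]; exact ha.mul_right hb
    | add a b ha hb => rw [map_add]; exact ha.add_right hb
  refine hind a (fun i => (hind _ (fun j => ?_) a).symm) b
  have := skewCommute_x (fun _ _ : Fin n => (1 : k)) j i
  rwa [one_smul] at this

theorem isSkewPoly_X :
    IsSkewPoly (fun _ _ => (1 : k)) fun i : Fin n => (MvPolynomial.X i : MvPolynomial (Fin n) k) :=
  .of_inverse (fun i j => by rw [one_smul, mul_comm])
    (exists_aeval_of_comm SkewPoly.mul_comm_of_one)
    fun _ _ h => MvPolynomial.algHom_ext h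

theorem quantumGLChain_OGL (hn : 2 ≤ n) (h : (1 : k) ≠ -1) :
    QuantumGLChain.{u, w} (OGL.gen k n) (signForm k n) (signForm k n)
      (fun i : Fin n => (MvPolynomial.X i : MvPolynomial (Fin n) k))
      (fun i : Fin n => (MvPolynomial.X i : MvPolynomial (Fin n) k)) := by
  have := (isGLAlgebra_OGL hn h).quantumGLChain (isParam_one hn h) isSkewPoly_X isSkewPoly_X
  rw [formE_one, show formF (fun _ _ : Fin n => (1 : k)) = signForm k n from formE_one] at this
  exact this

end Classical

end QGL

end

theorem propositionP {k : Type u} [Field k] {n : ℕ} (hn : 2 ≤ n) :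
    (∀ (p q : Fin n → Fin n → k) (lam : k), QGL.IsMulAntisymm p → QGL.IsMulAntisymm q →
      lam ≠ -1 → (∀ i j : Fin n, i < j → q j i = lam * p j i) →
      QGL.QuantumGLChain.{u, w} (QGL.AST.gen p q lam) (QGL.formE q) (QGL.formF p)
        (QGL.SkewPoly.x q) (QGL.SkewPoly.x fun j i => p i j)) ∧
    (∀ p q : k, p ≠ 0 → q ≠ 0 → p * q ≠ -1 →
      QGL.QuantumGLChain.{u, w} (QGL.Tak.gen n p q) (QGL.formT n q) (QGL.formT n p)
        (QGL.QSkewPoly.x n q) (QGL.QSkewPoly.x n p)) ∧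
    ((1 : k) ≠ -1 →
      QGL.QuantumGLChain.{u, w} (QGL.OGL.gen k n) (QGL.signForm k n) (QGL.signForm k n)
        (fun i : Fin n => (MvPolynomial.X i : MvPolynomial (Fin n) k))
        (fun i : Fin n => (MvPolynomial.X i : MvPolynomial (Fin n) k))) := by
  refine ⟨fun p q lam hp hq hlam hrel => ?_, fun p q hp hq hpq =>
    QGL.quantumGLChain_Tak hn hp hq hpq, fun h => QGL.quantumGLChain_OGL hn h⟩
  exact QGL.IsGLAlgebra.quantumGLChain ⟨hn, hp, hq, hlam, hrel⟩ ⟨AlgEquiv.refl, fun _ => rfl⟩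
    (QGL.isSkewPoly_x q) (QGL.isSkewPoly_x _)
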